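/- **Setting.** Let $r,r'\in\mathbb N$, let $\|\cdot\|_2$ be the Euclidean norm of vectors and the spectral norm of matrices, let $\le$ be the Loewner order, let $'$ denote transposition, and let $\mathbb S_r^+$ be the set of symmetric positive semi-definite $r\times r$ matrices. Let $A\in\mathbb R^{r\times r}$, $C\in\mathbb R^{r'\times r}$, let $R\in\mathbb R^{r\times r}$ and $\Sigma\in\mathbb R^{r'\times r'}$ be symmetric positive definite, and $S:=C'\Sigma^{-1}C$. Consider $$dX_t=AX_t\,dt+R^{1/2}dW_t,\qquad dY_t=CX_t\,dt+\Sigma^{1/2}dV_t,\qquad Y_0=0,$$ with $(W,V)$ an $(r+r')$-dimensional standard Brownian motion independent of the Gaussian vector $X_0$, and $\mathcal F_{s,t}=\sigma(Y_u,\ s\le u\le t)$. Put $$\mathcal O_t=\int_0^te^{-A'u}Se^{-Au}du,\qquad \mathcal C_t(\mathcal O)=\mathcal O_t^{-1}\Big[\int_0^te^{-(t-u)A'}\mathcal O_uR\,\mathcal O_ue^{-(t-u)A}du\Big]\mathcal O_t^{-1},$$ $$\mathcal C_t=\int_0^te^{Au}Re^{A'u}du,\qquad \mathcal O_t(\mathcal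 C)=\mathcal C_t^{-1}\Big[\int_0^te^{(t-u)A}\mathcal C_uS\,\mathcal C_ue^{(t-u)A'}du\Big]\mathcal C_t^{-1},$$ and let $v,\varpi_-^o,\varpi_-^c,\varpi_+^c(\mathcal O),\varpi_+^o(\mathcal C)>0$ satisfy $\mathcal O_v\ge\varpi_-^o\,Id$, $\mathcal C_v\ge\varpi_-^c\,Id$, $\mathcal C_v(\mathcal O)\le\varpi_+^c(\mathcal O)\,Id$ and $\mathcal O_v(\mathcal C)\le\varpi_+^o(\mathcal C)\,Id$. For a continuous map $\pi:\mathbb S_r^+\to\mathbb S_r^+$ let $$\mathrm{Ricc}(Q)=AQ+QA'-QSQ+R,\qquad \mathrm{Ricc}^\pi(Q)=[A-\pi(Q)S]Q+Q[A-\pi(Q)S]'+R+\pi(Q)S\pi(Q).$$ Let $\Pi$ be a set of such maps, and $B(\delta)=\{\pi\in\Pi:\ \sup_{Q\in\mathbb S_r^+}\|\pi(Q)-Q\|_2\le\delta\}$. Assume: * $(H)_0$: for each $\pi\in\Pi$ there are given symmetric matrices $B_0,B_1,B_2$ with $B_2\le S$, and a symmetric-matrix valued function $\mathcal R$ on $\mathbb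 S_r^+$ with $\varpi:=\sup_{Q\in\mathbb S_r^+}\|\mathcal R(Q)\|_2<\infty$ (all depending on $\pi$), such that $\mathrm{Ricc}^\pi(Q)-\mathrm{Ricc}(Q)=B_0+B_1Q+QB_1'+QB_2Q+\mathcal R(Q)$ for all $Q\in\mathbb S_r^+$. Set $A_\pi=A+B_1$, $R_\pi=R+B_0+\varpi\,Id$, $S_\pi=S-B_2$. * $(H)_2$: for all $\epsilon\in(0,1]$ and $\alpha\in(0,1)$ there is $\delta>0$ such that for all $\pi\in B(\delta)$: $\alpha S\le S_\pi\le\alpha^{-1}S$, $\alpha R\le R_\pi\le\alpha^{-1}R$ and $\|A-A_\pi\|_2\le\epsilon$. Let $\pi\in\Pi$ be such that $\partial_tP_t=\mathrm{Ricc}^\pi(P_t)$ has, from each initial state in $\mathbb S_r^+$, a unique $\mathbb S_r^+$-valued solution on $[0,\infty)$. Let $\phi_{s,t}=\phi_{t-s}$ and $\phi^\pi_{s,t}=\phi^\pi_{t-s}$ be the semigroups of $\partial_tP_t=\mathrm{Ricc}(P_t)$ and $\partial_tP_t=\mathrm{Ricc}^\pi(P_t)$. For $0\le s$, $x\in\mathbb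 R^r$, $Q\in\mathbb S_r^+$ let $\psi^\pi_{s,t}(x,Q)$, $t\ge s$, be the Kalman-Bucy filter $$d\psi_t=A\psi_t\,dt+\pi(\phi^\pi_{s,t}(Q))C'\Sigma^{-1}(dY_t-C\psi_t\,dt),\qquad \psi_s=x,$$ and $\overline\psi{}^\pi_{s,t}(x,Q)$, $t\ge s$, the nonlinear Kalman-Bucy diffusion $$d\overline X_t=A\overline X_t\,dt+R^{1/2}d\overline W_t+\pi(P_t)C'\Sigma^{-1}\big[dY_t-(C\overline X_t\,dt+\Sigma^{1/2}d\overline V_t)\big],\qquad \overline X_s\sim\mathcal N(x,Q),$$ where $P_t$ is the (deterministic, continuous in $t$) covariance matrix of $\mathrm{Law}(\overline X_t\mid\mathcal F_{s,t})$, $\overline W,\overline V$ are standard Brownian motions, and $\overline X_s,\overline W,\overline V$ are independent and independent of $(X_0,W,V)$. Let $\eta^\pi_{s,t}(x,Q)=\mathrm{Law}(\overline\psi{}^\pi_{s,t}(x,Q)\mid\mathcal F_{s,t})$, and let $\psi_{s,t}(x,Q)$, $\overline\psi_{s,t}(x,Q)$, $\eta_{s,t}(x,Q)$ be these objects for $\pi=id$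 (and $\phi$). Finally let $\mathbb W_n(\nu_1,\nu_2)=\inf\mathbb E(\|Z_1-Z_2\|_2^n)^{1/n}$ over all couplings $(Z_1,Z_2)$ of $\nu_1,\nu_2$. **Theorem 3.5.** For all $s\ge0$, $t\ge s+v$, $x\in\mathbb R^r$ and $Q\in\mathbb S_r^+$, almost surely $$\mathbb W_2[\eta^\pi_{s,t}(x,Q),\eta_{s,t}(x,Q)]^2\le\|\psi^\pi_{s,t}(x,Q)-\psi_{s,t}(x,Q)\|_2^2+\mathrm{tr}[\phi^\pi_{s,t}(Q)-\phi_{s,t}(Q)]+4r\Big[\varpi_+^c(\mathcal O)+\frac1{\varpi_-^o}\Big]\Big[\varpi_+^o(\mathcal C)+\frac1{\varpi_-^c}\Big]\|\phi^\pi_{s,t}(Q)-\phi_{s,t}(Q)\|_2 .$$ In addition, for all $n\ge1$, $x_1,x_2\in\mathbb R^r$ and $Q_1,Q_2\in\mathbb S_r^+$, almost surely $$\mathbb W_{2n}[\eta_{s,t}(x_1,Q_1),\eta^\pi_{s,t}(x_2,Q_2)]\le\|\psi_{s,t}(x_1,Q_1)-\psi^\pi_{s,t}(x_2,Q_2)\|_2+\sqrt{\frac{rn}2}\Big(\varpi_+^o(\mathcal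 C)+\frac1{\varpi_-^c}\Big)^{1/2}\|\phi_{t-s}(Q_1)-\phi^\pi_{t-s}(Q_2)\|_2\;e^{\frac12+\frac3{4n}} .$$ (All these Wasserstein distances are finite.) -/

import Mathlib

open MeasureTheory ProbabilityTheory Filter Topology
open scoped NNReal ENNReal Matrix MatrixOrder Matrix.Norms.L2Operator

/- Throughout, matrices carry the spectral norm `‖M‖ = ‖M‖₂` and the Loewner order
(`M ≤ N` iff `N - M` is positive semidefinite); vectors carry the Euclidean norm. -/

namespace KalmanBucy

noncomputable section

/-- Column vectors in Euclidean space. -/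
abbrev Vec (n : ℕ) := EuclideanSpace ℝ (Fin n)

/-- Square real matrices. -/
abbrev Mat (r : ℕ) := Matrix (Fin r) (Fin r) ℝ

/-- The cone of symmetric positive semidefinite matrices, with the subspace topology. -/
abbrev Psd (r : ℕ) := {Q : Mat r // Q.PosSemidef}

/-- The action of a matrix on a Euclidean vector. -/
def act {m n : ℕ} (M : Matrix (Fin m) (Fin n) ℝ) (z : Vec n) : Vec m := WithLp.toLp 2 (M *ᵥ z.ofLp)

/-! ### The filtering model and its Gramians -/

/-- The coefficients of the linear-Gaussian model `dX = A X dt + R^{1/2} dW`,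
`dY = C X dt + Sig^{1/2} dV`. -/
structure Model (r r' : ℕ) where
  A : Mat r
  C : Matrix (Fin r') (Fin r) ℝ
  R : Mat r
  Sig : Mat r'
  posDef_R : R.PosDef
  posDef_Sig : Sig.PosDef

/-- `S = C' Sig⁻¹ C`. -/
def Model.S {r r' : ℕ} (m : Model r r') : Mat r := m.Cᵀ * m.Sig⁻¹ * m.C

/-- The observability Gramian `∫₀ᵗ e^{-A'u} S e^{-Au} du`. -/
def obsGramian {r : ℕ} (A S : Mat r) (t : ℝ) : Mat r :=
  ∫ u in (0 : ℝ)..t, NormedSpace.exp (-u • Aᵀ) * S * NormedSpace.exp (-u • A)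

/-- The controllability Gramian `∫₀ᵗ e^{Au} R e^{A'u} du`. -/
def ctrGramian {r : ℕ} (A R : Mat r) (t : ℝ) : Mat r :=
  ∫ u in (0 : ℝ)..t, NormedSpace.exp (u • A) * R * NormedSpace.exp (u • Aᵀ)

/-- `C_t(O) = O_t⁻¹ [∫₀ᵗ e^{-(t-u)A'} O_u R O_u e^{-(t-u)A} du] O_t⁻¹`. -/
def ctrOfObs {r : ℕ} (A R S : Mat r) (t : ℝ) : Mat r :=
  (obsGramian A S t)⁻¹ *
    (∫ u in (0 : ℝ)..t, NormedSpace.exp (-(t - u) • Aᵀ) * obsGramian A S u * R *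
      obsGramian A S u * NormedSpace.exp (-(t - u) • A)) *
    (obsGramian A S t)⁻¹

/-- `O_t(C) = C_t⁻¹ [∫₀ᵗ e^{(t-u)A} C_u S C_u e^{(t-u)A'} du] C_t⁻¹`. -/
def obsOfCtr {r : ℕ} (A R S : Mat r) (t : ℝ) : Mat r :=
  (ctrGramian A R t)⁻¹ *
    (∫ u in (0 : ℝ)..t, NormedSpace.exp ((t - u) • A) * ctrGramian A R u * S *
      ctrGramian A R u * NormedSpace.exp ((t - u) • Aᵀ)) *
    (ctrGramian A R t)⁻¹

/-- The positive Gramian parameters at the observability-controllability interval `v`: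
`obsLow`, `ctrLow` are lower bounds of `O_v`, `C_v`, and `ctrObsUp`, `obsCtrUp` are upper bounds
of `C_v(O)`, `O_v(C)`. -/
structure GramianBounds {r r' : ℕ} (m : Model r r') (v obsLow ctrLow ctrObsUp obsCtrUp : ℝ) :
    Prop where
  v_pos : 0 < v
  obsLow_pos : 0 < obsLow
  ctrLow_pos : 0 < ctrLow
  ctrObsUp_pos : 0 < ctrObsUp
  obsCtrUp_pos : 0 < obsCtrUp
  obs_ge : obsLow • (1 : Mat r) ≤ obsGramian m.A m.S v
  ctr_ge : ctrLow • (1 : Mat r) ≤ ctrGramian m.A m.R v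
  ctrOfObs_le : ctrOfObs m.A m.R m.S v ≤ ctrObsUp • (1 : Mat r)
  obsOfCtr_le : obsOfCtr m.A m.R m.S v ≤ obsCtrUp • (1 : Mat r)

/-! ### Riccati equations -/

/-- The Riccati drift `A Q + Q A' - Q S Q + R`. -/
def ricc {r r' : ℕ} (m : Model r r') (Q : Psd r) : Mat r :=
  m.A * Q.1 + Q.1 * m.Aᵀ - Q.1 * m.S * Q.1 + m.R

/-- The `p`-perturbed Riccati drift
`[A - p(Q) S] Q + Q [A - p(Q) S]' + R + p(Q) S p(Q)`. -/
def riccPert {r r' : ℕ} (m : Model r r') (p : Psd r → Psd r) (Q : Psd r) : Mat r :=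
  (m.A - (p Q).1 * m.S) * Q.1 + Q.1 * (m.A - (p Q).1 * m.S)ᵀ + m.R
    + (p Q).1 * m.S * (p Q).1

/-- `P` is a positive semidefinite solution on `[0, ∞)` of `∂ₜ P = F(P)`, `P₀ = Q`. -/
def IsRiccatiSol {r : ℕ} (F : Psd r → Mat r) (Q : Psd r) (P : ℝ → Psd r) : Prop :=
  P 0 = Q ∧ ∀ t, 0 ≤ t →
    HasDerivWithinAt (fun u => (P u : Mat r)) (F (P t)) (Set.Ici 0) t

/-- `φ` is the semigroup of the equation `∂ₜ P = F(P)`: for every `Q ≥ 0`, the path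
`t ↦ φ t Q` is its unique positive semidefinite solution on `[0, ∞)` started at `Q`. The equation
is autonomous, so `φ_{s,t} = φ (t - s)`. -/
def IsRiccatiFlow {r : ℕ} (F : Psd r → Mat r) (φ : ℝ → Psd r → Psd r) : Prop :=
  ∀ Q, IsRiccatiSol F Q (fun t => φ t Q) ∧
    ∀ P, IsRiccatiSol F Q P → ∀ t, 0 ≤ t → P t = φ t Q

/-! ### The class of perturbations -/

/-- The data of the decomposition `B₀ + B₁ Q + Q B₁' + Q B₂ Q + rem(Q)`. -/
structure PertData (r : ℕ) where
  B₀ : Mat r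
  B₁ : Mat r
  B₂ : Mat r
  rem : Psd r → Mat r

/-- The uniform bound `sup_Q ‖rem(Q)‖` of the remainder. -/
def PertData.remBound {r : ℕ} (d : PertData r) : ℝ := ⨆ Q : Psd r, ‖d.rem Q‖

/-- `A_π = A + B₁`. -/
def PertData.APert {r r' : ℕ} (d : PertData r) (m : Model r r') : Mat r := m.A + d.B₁

/-- `R_π = R + B₀ + (sup_Q ‖rem(Q)‖) Id`. -/
def PertData.RPert {r r' : ℕ} (d : PertData r) (m : Model r r') : Mat r :=
  m.R + d.B₀ + d.remBound • (1 : Mat r)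

/-- `S_π = S - B₂`. -/
def PertData.SPert {r r' : ℕ} (d : PertData r) (m : Model r r') : Mat r := m.S - d.B₂

/-- Condition (H)₀ for the map `p`: the difference between the perturbed and the original
Riccati drifts is `B₀ + B₁ Q + Q B₁' + Q B₂ Q + rem(Q)`, with symmetric `B₀, B₁, B₂`, `B₂ ≤ S` and
a symmetric, uniformly bounded remainder. -/
structure CondH0 {r r' : ℕ} (m : Model r r') (p : Psd r → Psd r) (d : PertData r) : Prop where
  symm_B₀ : d.B₀.IsSymm
  symm_B₁ : d.B₁.IsSymm
  symm_B₂ : d.B₂.IsSymm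
  B₂_le : d.B₂ ≤ m.S
  symm_rem : ∀ Q, (d.rem Q).IsSymm
  bdd_rem : BddAbove (Set.range fun Q => ‖d.rem Q‖)
  drift_eq : ∀ Q, riccPert m p Q - ricc m Q =
    d.B₀ + d.B₁ * Q.1 + Q.1 * d.B₁ᵀ + Q.1 * d.B₂ * Q.1 + d.rem Q

/-- The ball of radius `δ` around the identity, for the uniform norm, in the class `Pert`. -/
def pertBall {r : ℕ} (Pert : Set C(Psd r, Psd r)) (δ : ℝ) : Set C(Psd r, Psd r) :=
  {p ∈ Pert | ∀ Q : Psd r, ‖(p Q).1 - Q.1‖ ≤ δ}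

/-- Condition (H)₂ for the class `Pert`: continuity of `(A_π, R_π, S_π)` at the identity. -/
def CondH2 {r r' : ℕ} (m : Model r r') (Pert : Set C(Psd r, Psd r))
    (d : C(Psd r, Psd r) → PertData r) : Prop :=
  ∀ ε α : ℝ, 0 < ε → ε ≤ 1 → 0 < α → α < 1 → ∃ δ : ℝ, 0 < δ ∧ ∀ p ∈ pertBall Pert δ,
    α • m.S ≤ (d p).SPert m ∧ (d p).SPert m ≤ α⁻¹ • m.S ∧
    α • m.R ≤ (d p).RPert m ∧ (d p).RPert m ≤ α⁻¹ • m.R ∧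
    ‖m.A - (d p).APert m‖ ≤ ε

/-! ### Signal, observation, filters and diffusions -/

section Processes

variable {Ω : Type*} [MeasurableSpace Ω]

/-- The path on `[0, ∞)` of a process. -/
def path {n : ℕ} (Z : ℝ → Ω → Vec n) (ω : Ω) : ℝ≥0 → Vec n := fun t => Z t ω

/-- `W` is a standard `n`-dimensional Brownian motion (on the time set `[0, ∞)`). -/
structure IsStdBrownian {n : ℕ} (μ : Measure Ω) (W : ℝ → Ω → Vec n) : Prop where
  measurable : ∀ t, Measurable (W t)
  brownian : ∀ i, IsBrownianReal (fun (t : ℝ≥0) ω => W t ω i) μ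
  indep : iIndepFun (fun i ω (t : ℝ≥0) => W t ω i) μ

/-- `I = ∫ₛᵗ K_u dZ_u`, for a deterministic integrand `K` which is continuous on `[s, t]`: the
limit in probability of the Riemann sums with left end points. -/
def IsStochIntegral {k n : ℕ} (μ : Measure Ω) (K : ℝ → Matrix (Fin k) (Fin n) ℝ)
    (Z : ℝ → Ω → Vec n) (s t : ℝ) (I : Ω → Vec k) : Prop :=
  TendstoInMeasure μ
    (fun (N : ℕ) ω => ∑ i ∈ Finset.range N,
      act (K (s + i * ((t - s) / N)))
        (Z (s + (i + 1) * ((t - s) / N)) ω - Z (s + i * ((t - s) / N)) ω))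
    atTop I

/-- The signal-observation pair: `dX = A X dt + R^{1/2} dW`, `dY = C X dt + Sig^{1/2} dV`, `Y₀ = 0`,
with `(W, V)` a standard Brownian motion of dimension `r + r'`, independent of the Gaussian
variable `X₀`. -/
structure IsSignalObs {r r' : ℕ} (m : Model r r') (μ : Measure Ω)
    (W : ℝ → Ω → Vec r) (V : ℝ → Ω → Vec r') (X : ℝ → Ω → Vec r) (Y : ℝ → Ω → Vec r') :
    Prop where
  brownian_W : IsStdBrownian μ W
  brownian_V : IsStdBrownian μ V
  indep_WV : IndepFun (path W) (path V) μ
  gaussian_X₀ : ∃ (x₀ : Vec r) (P₀ : Psd r), HasLaw (X 0) (multivariateGaussian x₀ P₀.1) μ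
  indep_X₀ : IndepFun (X 0) (fun ω => (path W ω, path V ω)) μ
  measurable_X : ∀ t, Measurable (X t)
  measurable_Y : ∀ t, Measurable (Y t)
  continuous_X : ∀ᵐ ω ∂μ, ContinuousOn (fun t => X t ω) (Set.Ici 0)
  eq_X : ∀ t, 0 ≤ t → ∀ᵐ ω ∂μ,
    X t ω = X 0 ω + (∫ u in (0 : ℝ)..t, act m.A (X u ω)) + act (CFC.sqrt m.R) (W t ω)
  eq_Y : ∀ t, 0 ≤ t → ∀ᵐ ω ∂μ,
    Y t ω = (∫ u in (0 : ℝ)..t, act m.C (X u ω)) + act (CFC.sqrt m.Sig) (V t ω)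

/-- The gain matrix `G C' Sig⁻¹`. -/
def gain {r r' : ℕ} (m : Model r r') (G : Psd r) : Matrix (Fin r) (Fin r') ℝ :=
  G.1 * m.Cᵀ * m.Sig⁻¹

/-- The process `ψ` on `[s, ∞)` is the Kalman-Bucy filter started at `x` at time `s`, driven by the
deterministic path of matrices `G`:
`dψ = A ψ dt + G_t C' Sig⁻¹ (dY - C ψ dt)`, `ψ_s = x`. -/
structure IsFilter {r r' : ℕ} (m : Model r r') (μ : Measure Ω) (Y : ℝ → Ω → Vec r')
    (G : ℝ → Psd r) (s : ℝ) (x : Vec r) (ψ : ℝ → Ω → Vec r) : Prop where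
  measurable : ∀ t, s ≤ t → Measurable (ψ t)
  continuous : ∀ᵐ ω ∂μ, ContinuousOn (fun t => ψ t ω) (Set.Ici s)
  init : ∀ᵐ ω ∂μ, ψ s ω = x
  eq : ∀ t, s ≤ t → IsStochIntegral μ (fun u => gain m (G u)) Y s t
    (fun ω => ψ t ω - x - ∫ u in s..t, (act m.A (ψ u ω) - act (gain m (G u)) (act m.C (ψ u ω))))

/-- `Law(Z | F_{s,t})`, the regular conditional distribution of `Z` given the observations
`(Y_u)_{s ≤ u ≤ t}`, as a random measure. -/
def condLaw {r r' : ℕ} (μ : Measure Ω) [IsFiniteMeasure μ] (Y : ℝ → Ω → Vec r') (s t : ℝ)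
    (Z : Ω → Vec r) (ω : Ω) : Measure (Vec r) :=
  condDistrib Z (fun ω (u : Set.Icc s t) => Y u ω) μ (fun u => Y u ω)

/-- The covariance matrix of a measure. -/
def covMatrix {r : ℕ} (ν : Measure (Vec r)) : Mat r :=
  Matrix.of fun i j => cov[fun z => z i, fun z => z j; ν]

/-- The process `Xb` on `[s, ∞)` is the nonlinear (McKean-Vlasov) Kalman-Bucy diffusion
`dXb = A Xb dt + R^{1/2} dWb + p(P_t) C' Sig⁻¹ [dY - (C Xb dt + Sig^{1/2} dVb)]`,
where `P_t` is the covariance matrix of `Law(Xb_t | F_{s,t})`. It starts at time `s` from a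
Gaussian variable of mean `x` and covariance `Q`; this variable and the Brownian motions `Wb`, `Vb`
are independent, and independent of the signal and the observations. The map `p = id`
is the unperturbed case. -/
def IsDiffusion {r r' : ℕ} (m : Model r r') (μ : Measure Ω) [IsFiniteMeasure μ]
    (W : ℝ → Ω → Vec r) (V : ℝ → Ω → Vec r') (X : ℝ → Ω → Vec r) (Y : ℝ → Ω → Vec r')
    (p : C(Psd r, Psd r)) (s : ℝ) (x : Vec r) (Q : Psd r) (Xb : ℝ → Ω → Vec r) : Prop :=
  ∃ (Wb : ℝ → Ω → Vec r) (Vb : ℝ → Ω → Vec r') (P : ℝ → Psd r),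
    IsStdBrownian μ Wb ∧ IsStdBrownian μ Vb ∧ IndepFun (path Wb) (path Vb) μ ∧
    IndepFun (Xb s) (fun ω => (path Wb ω, path Vb ω)) μ ∧
    IndepFun (fun ω => (X 0 ω, path W ω, path V ω))
      (fun ω => (Xb s ω, path Wb ω, path Vb ω)) μ ∧
    HasLaw (Xb s) (multivariateGaussian x Q.1) μ ∧
    (∀ t, s ≤ t → Measurable (Xb t)) ∧
    (∀ᵐ ω ∂μ, ContinuousOn (fun t => Xb t ω) (Set.Ici s)) ∧
    ContinuousOn P (Set.Ici s) ∧
    (∀ t, s ≤ t → ∀ᵐ ω ∂μ, covMatrix (condLaw μ Y s t (Xb t) ω) = (P t).1) ∧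
    ∀ t, s ≤ t → IsStochIntegral μ (fun u => gain m (p (P u)))
      (fun u ω => Y u ω - act (CFC.sqrt m.Sig) (Vb u ω)) s t
      (fun ω => Xb t ω - Xb s ω
        - (∫ u in s..t, (act m.A (Xb u ω) - act (gain m (p (P u))) (act m.C (Xb u ω))))
        - act (CFC.sqrt m.R) (Wb t ω - Wb s ω))

end Processes

/-- The Wasserstein distance of order `n ≥ 1`: the infimum of `E(‖Z₁ - Z₂‖ⁿ)^{1/n}` over all
couplings of `ν₁` and `ν₂`. -/
def wasserstein {r : ℕ} (n : ℕ) (ν₁ ν₂ : Measure (Vec r)) : ℝ≥0∞ :=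
  ⨅ γ ∈ {γ : Measure (Vec r × Vec r) | γ.map Prod.fst = ν₁ ∧ γ.map Prod.snd = ν₂},
    eLpNorm (fun z : Vec r × Vec r => z.1 - z.2) n γ

end

end KalmanBucy

/-! The proof has three parts, and the theorem combines them.

*Conditional laws.* The conditional law of the nonlinear diffusion given the observations is the
Gaussian law whose mean is the Kalman-Bucy filter and whose covariance is the Riccati flow
(`condLaw_diffusion`). Since the covariance `P` is deterministic, the diffusion solves a linear
equation `dX̄ = M X̄ dt + dF` with deterministic `M = A - G C`, where `G` is the gain. With `Φ` the
fundamental matrix of `M` and `Ψ = Φ⁻¹`, variation of constants reads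
`Ψ_t X̄_t = X̄_s + ∫ Ψ G dY + ∫ Ψ R^{1/2} dW̄ - ∫ Ψ G Sig^{1/2} dV̄`. The integral against `Y` is a
limit in probability of linear functions of the observations, and the filter satisfies the same
equation with the noise removed, so this part is `Ψ_t ψ_t` (`filter_eq`). The other terms are
independent of the observations and jointly Gaussian, and after multiplication by `Φ_t` their
covariance solves the Lyapunov equation of `M` (`hasDerivAt_covInt`). As the gain is computed from
this covariance, the Lyapunov equation is the perturbed Riccati equation, and uniqueness of its
solutions identifies the covariance with the flow. No stochastic calculus beyond Wiener integrals
of deterministic functions is involved: the integrals are limits of Riemann sums, and summation by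
parts against the differentiable `Ψ` works path by path (`tendsto_sum_act_increment`).

*Gramian bounds.* Beyond the time `v` the unperturbed Riccati flow lies between
`(obsCtrUp + 1 / ctrLow)⁻¹` and `ctrObsUp + 1 / obsLow` (`riccati_bounds`). The upper bound compares
the optimal filter with the suboptimal estimator built from the observability Gramian
(`riccati_upper`). The lower bound is the upper bound applied to the inverse, which solves the
Riccati equation of the dual system `(-A', S, R)`.

*Gaussian couplings.* The laws `N(m₁, P₁)` and `N(m₂, P₂)` are coupled by
`(m₁ + P₁^{1/2} ξ, m₂ + P₂^{1/2} ξ)` with `ξ` standard Gaussian. The square root is Lipschitz at a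
matrix bounded from below (`norm_sqrt_sub_sqrt_le`). Expanding the second moment gives the
quadratic bound, in which the trace is kept exact (`wasserstein_two_gaussian`); Minkowski's
inequality and an exponential-moment estimate of `E ‖ξ‖^{2n}` give the bound for even orders
(`wasserstein_even_gaussian`). -/

namespace KalmanBucy

noncomputable section

/-! ### Linear differential equations -/

/-- A linear equation `y' = L(u) y` with continuous bounded coefficients has a solution on the
whole line, given by its Neumann series. -/
theorem exists_linear_ode {E : Type*} [NormedAddCommGroup E] [NormedSpace ℝ E] [CompleteSpace E]
    (L : ℝ → E →L[ℝ] E) (hL : Continuous L) (K : ℝ) (hK : ∀ u, ‖L u‖ ≤ K) (a : ℝ) (x₀ : E) :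
    ∃ y : ℝ → E, y a = x₀ ∧ ∀ u, HasDerivAt y (L u (y u)) u := by
  have hK0 : 0 ≤ K := (norm_nonneg _).trans (hK 0)
  let y : ℕ → ℝ → E := fun n => Nat.rec (fun _ => x₀) (fun _ z u => ∫ w in a..u, L w (z w)) n
  have y0 : ∀ u, y 0 u = x₀ := fun _ => rfl
  have ys : ∀ n u, y (n + 1) u = ∫ w in a..u, L w (y n w) := fun _ _ => rfl
  have hcont : ∀ n, Continuous (y n) := by
    intro n
    induction n with
    | zero => exact continuous_const
    | succ n ih =>
      have : Continuous fun w => L w (y n w) := hL.clm_apply ih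
      exact intervalIntegral.continuous_primitive (fun _ _ => this.intervalIntegrable _ _) a
  have hcontL : ∀ n, Continuous fun w => L w (y n w) := fun n => hL.clm_apply (hcont n)
  have hbd : ∀ n u, ‖y n u‖ ≤ ‖x₀‖ * (K * |u - a|) ^ n / n.factorial := by
    intro n
    induction n with
    | zero => intro u; simp [y0]
    | succ n ih =>
      intro u
      rw [ys]
      calc ‖∫ w in a..u, L w (y n w)‖ ≤ ∫ w in Set.uIoc a u, ‖L w (y n w)‖ :=
            intervalIntegral.norm_integral_le_integral_norm_uIoc
        _ ≤ ∫ w in Set.uIoc a u, (‖x₀‖ * K ^ (n + 1) / n.factorial) * |w - a| ^ n := by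
            refine integral_mono ?_ ?_ ?_
            · exact ((hcontL n).norm.intervalIntegrable a u).def'
            · exact (Continuous.intervalIntegrable (by fun_prop) a u).def'
            · intro w
              calc ‖L w (y n w)‖ ≤ K * (‖x₀‖ * (K * |w - a|) ^ n / n.factorial) :=
                    (L w).le_of_opNorm_le_of_le (hK w) (ih w)
                _ = _ := by rw [mul_pow]; ring
        _ = _ := by
            rw [integral_const_mul, integral_pow_abs_sub_uIoc, Nat.factorial_succ]
            push_cast
            rw [mul_pow]
            field_simp
  have hderiv : ∀ n u, HasDerivAt (y (n + 1)) (L u (y n u)) u := fun n u =>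
    intervalIntegral.integral_hasDerivAt_right ((hcontL n).intervalIntegrable _ _)
      ((hcontL n).stronglyMeasurableAtFilter _ _) (hcontL n).continuousAt
  have hsum : ∀ u, Summable fun n => y n u := fun u => by
    refine Summable.of_norm_bounded (g := fun n => ‖x₀‖ * ((K * |u - a|) ^ n / n.factorial)) ?_ ?_
    · exact (Real.summable_pow_div_factorial _).mul_left _
    · intro n; rw [← mul_div_assoc]; exact hbd n u
  refine ⟨fun u => ∑' n, y n u, ?_, fun u => ?_⟩
  · change ∑' n, y n a = x₀
    rw [tsum_eq_single 0, y0]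
    · intro n hn
      obtain ⟨k, rfl⟩ := Nat.exists_eq_succ_of_ne_zero hn
      simp [ys]
  · let g' : ℕ → ℝ → E := fun n u => Nat.casesOn n 0 (fun k => L u (y k u))
    let ρ : ℝ := |u - a| + 1
    let b : ℕ → ℝ := fun n => Nat.casesOn n 0 (fun k => K * (‖x₀‖ * ((K * ρ) ^ k / k.factorial)))
    have hb : Summable b := by
      rw [← summable_nat_add_iff 1]
      exact ((Real.summable_pow_div_factorial _).mul_left _).mul_left _
    have key := hasDerivAt_tsum_of_isPreconnected (g := y) (g' := g') (u := b)
      (t := Metric.ball a ρ) (y₀ := u) (y := u) hb Metric.isOpen_ball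
      (convex_ball a ρ).isPreconnected ?_ ?_ ?_ (hsum u) ?_
    · have e : ∑' n, g' n u = L u (∑' n, y n u) := by
        rw [(L u).map_tsum (hsum u), Summable.tsum_eq_zero_add]
        · simp [g']
        · rw [← summable_nat_add_iff 1]
          exact (L u).summable (hsum u)
      rwa [e] at key
    · intro n w _
      cases n with
      | zero => exact hasDerivAt_const w x₀
      | succ n => exact hderiv n w
    · intro n w hw
      cases n with
      | zero => simp [g', b]
      | succ n =>
        have h1 : |w - a| ≤ ρ := (Real.dist_eq w a ▸ (Metric.mem_ball.1 hw)).le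
        refine (L w).le_of_opNorm_le_of_le (hK w) ((hbd n w).trans ?_)
        rw [mul_div_assoc]
        gcongr
    · simp [ρ, Real.dist_eq]
    · simp [ρ, Real.dist_eq]

/-- The fundamental matrix `Φ` of `y' = M(u) y` normalized at `a`, together with its inverse `Ψ`. -/
theorem exists_fundamental {r : ℕ} (M : ℝ → Mat r) (hM : Continuous M) (K : ℝ)
    (hK : ∀ u, ‖M u‖ ≤ K) (a : ℝ) :
    ∃ Φ Ψ : ℝ → Mat r, Φ a = 1 ∧ Ψ a = 1 ∧ (∀ u, HasDerivAt Φ (M u * Φ u) u) ∧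
      (∀ u, HasDerivAt Ψ (-(Ψ u * M u)) u) ∧ ∀ u, Φ u * Ψ u = 1 := by
  have hK0 : 0 ≤ K := (norm_nonneg _).trans (hK 0)
  obtain ⟨Φ, hΦa, hΦ⟩ := exists_linear_ode (fun u => ContinuousLinearMap.mul ℝ (Mat r) (M u))
    ((ContinuousLinearMap.continuous _).comp hM) K
    (fun u => ContinuousLinearMap.opNorm_le_bound _ hK0 fun z =>
      (norm_mul_le _ _).trans (by gcongr; exact hK u)) a 1
  obtain ⟨Ψ, hΨa, hΨ⟩ := exists_linear_ode
    (fun u => -(ContinuousLinearMap.mul ℝ (Mat r)).flip (M u))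
    ((ContinuousLinearMap.continuous _).comp hM).neg K
    (fun u => ContinuousLinearMap.opNorm_le_bound _ hK0 fun z => by
      simp only [neg_apply, ContinuousLinearMap.flip_apply,
        ContinuousLinearMap.mul_apply', norm_neg]
      rw [mul_comm K]
      exact (norm_mul_le _ _).trans (by gcongr; exact hK u)) a 1
  refine ⟨Φ, Ψ, hΦa, hΨa, hΦ, hΨ, fun u => ?_⟩
  -- `Ψ Φ` has derivative zero, and a left inverse of a square matrix is a right inverse
  refine mul_eq_one_comm.1 ?_
  have hd : ∀ w, HasDerivAt (fun w => Ψ w * Φ w) 0 w := fun w => by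
    have := (hΨ w).mul (hΦ w)
    simp only [neg_apply, ContinuousLinearMap.flip_apply,
      ContinuousLinearMap.mul_apply'] at this
    rwa [neg_mul, mul_assoc, neg_add_cancel] at this
  have := is_const_of_deriv_eq_zero (fun w => (hd w).differentiableAt) (fun w => (hd w).deriv) u a
  simpa [hΦa, hΨa] using this

/-! ### Riemann sums along uniform grids -/

/-- The action of matrices on Euclidean vectors, as a continuous bilinear map. -/
def actL (m n : ℕ) : Matrix (Fin m) (Fin n) ℝ →L[ℝ] Vec n →L[ℝ] Vec m :=
  LinearMap.mkContinuous₂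
    (LinearMap.mk₂ ℝ act
      (fun M N z => by ext i; simp [act, Matrix.add_mulVec])
      (fun c M z => by ext i; simp [act, Matrix.smul_mulVec])
      (fun M z w => by ext i; simp [act, Matrix.mulVec_add])
      (fun c M z => by ext i; simp [act, Matrix.mulVec_smul])) 1
    (fun M z => by rw [one_mul]; exact Matrix.l2_opNorm_mulVec M z)

@[simp]
theorem actL_apply {m n : ℕ} (M : Matrix (Fin m) (Fin n) ℝ) (z : Vec n) : actL m n M z = act M z :=
  rfl

theorem norm_act_le {m n : ℕ} (M : Matrix (Fin m) (Fin n) ℝ) (z : Vec n) :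
    ‖act M z‖ ≤ ‖M‖ * ‖z‖ := Matrix.l2_opNorm_mulVec M z

theorem act_mul {m n k : ℕ} (M : Matrix (Fin m) (Fin n) ℝ) (N : Matrix (Fin n) (Fin k) ℝ)
    (z : Vec k) : act (M * N) z = act M (act N z) := by
  ext i; simp [act, Matrix.mulVec_mulVec]

theorem act_add {m n : ℕ} (M : Matrix (Fin m) (Fin n) ℝ) (z w : Vec n) :
    act M (z + w) = act M z + act M w := (actL m n M).map_add z w

theorem act_sub {m n : ℕ} (M : Matrix (Fin m) (Fin n) ℝ) (z w : Vec n) :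
    act M (z - w) = act M z - act M w := (actL m n M).map_sub z w

theorem act_neg {m n : ℕ} (M : Matrix (Fin m) (Fin n) ℝ) (z : Vec n) :
    act M (-z) = -act M z := (actL m n M).map_neg z

theorem sub_act {m n : ℕ} (M N : Matrix (Fin m) (Fin n) ℝ) (z : Vec n) :
    act (M - N) z = act M z - act N z := by
  simp [← actL_apply]

theorem one_act {n : ℕ} (z : Vec n) : act (1 : Mat n) z = z := by
  ext i; simp [act]

theorem inner_act {m n : ℕ} (M : Matrix (Fin m) (Fin n) ℝ) (l : Vec m) (z : Vec n) :
    inner ℝ l (act M z) = inner ℝ (act Mᵀ l) z := by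
  simp only [act, EuclideanSpace.inner_eq_star_dotProduct, star_trivial]
  rw [dotProduct_comm, Matrix.dotProduct_mulVec, Matrix.mulVec_transpose, dotProduct_comm]

/-- The points of the uniform grid with `N` cells on `[s, t]`. -/
def grid (s t : ℝ) (N k : ℕ) : ℝ := s + k * ((t - s) / N)

theorem grid_zero (s t : ℝ) (N : ℕ) : grid s t N 0 = s := by simp [grid]

theorem grid_self (s t : ℝ) {N : ℕ} (hN : N ≠ 0) : grid s t N N = t := by
  have : (N : ℝ) ≠ 0 := by exact_mod_cast hN
  rw [grid]; field_simp; ring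

theorem grid_succ (s t : ℝ) (N k : ℕ) : grid s t N (k + 1) = grid s t N k + (t - s) / N := by
  simp only [grid]; push_cast; ring

theorem grid_mono {s t : ℝ} (hst : s ≤ t) (N : ℕ) : Monotone (grid s t N) := by
  refine monotone_nat_of_le_succ fun k => ?_
  rw [grid_succ]
  have : 0 ≤ (t - s) / N := div_nonneg (by linarith) (by positivity)
  linarith

theorem grid_mem {s t : ℝ} (hst : s ≤ t) {N k : ℕ} (hN : N ≠ 0) (hk : k ≤ N) :
    grid s t N k ∈ Set.Icc s t := by
  constructor
  · simpa [grid_zero] using grid_mono hst N (Nat.zero_le k)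
  · simpa [grid_self s t hN] using grid_mono hst N hk

theorem cell_subset {s t : ℝ} (hst : s ≤ t) {N k : ℕ} (hk : k < N) :
    Set.Icc (grid s t N k) (grid s t N (k + 1)) ⊆ Set.Icc s t :=
  Set.Icc_subset_Icc (grid_mem hst (by omega) hk.le).1 (grid_mem hst (by omega) hk).2

/-- Uniform continuity: the oscillation of `f` on every cell of a fine grid is small. -/
theorem eventually_dist_cell_lt {α : Type*} [PseudoMetricSpace α] {s t : ℝ} (hst : s ≤ t)
    {f : ℝ → α} (hf : ContinuousOn f (Set.Icc s t)) {ε : ℝ} (hε : 0 < ε) :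
    ∀ᶠ N : ℕ in atTop, ∀ k < N, ∀ u ∈ Set.Icc (grid s t N k) (grid s t N (k + 1)),
      ∀ w ∈ Set.Icc (grid s t N k) (grid s t N (k + 1)), dist (f u) (f w) < ε := by
  have hu := isCompact_Icc.uniformContinuousOn_of_continuous hf
  obtain ⟨δ, hδ, h⟩ := Metric.uniformContinuousOn_iff.1 hu ε hε
  have hlim : Tendsto (fun N : ℕ => (t - s) / N) atTop (𝓝 0) :=
    tendsto_const_div_atTop_nhds_zero_nat _
  filter_upwards [hlim.eventually (gt_mem_nhds hδ)] with N hN k hk u hu w hw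
  refine h u (cell_subset hst hk hu) w (cell_subset hst hk hw) ?_
  have := grid_succ s t N k
  rw [Real.dist_eq, abs_lt]
  constructor <;> linarith [hu.1, hu.2, hw.1, hw.2]

/-- If `e N k` is small on the cell `k` of the grid with `N` cells, uniformly in `k`, then the
integrals over the cells sum up to a small quantity. -/
theorem tendsto_sum_integral_zero {E : Type*} [NormedAddCommGroup E] [NormedSpace ℝ E] {s t : ℝ}
    (hst : s ≤ t) (e : ℕ → ℕ → ℝ → E)
    (he : ∀ ε : ℝ, 0 < ε → ∀ᶠ N : ℕ in atTop, ∀ k < N,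
      ∀ u ∈ Set.Icc (grid s t N k) (grid s t N (k + 1)), ‖e N k u‖ ≤ ε) :
    Tendsto (fun N => ∑ k ∈ Finset.range N, ∫ u in grid s t N k..grid s t N (k + 1), e N k u)
      atTop (𝓝 0) := by
  rw [Metric.tendsto_nhds]
  intro ε hε
  have hpos : 0 < t - s + 1 := by linarith
  filter_upwards [he (ε / (t - s + 1)) (by positivity), eventually_gt_atTop 0] with N hN hN0
  rw [dist_zero_right]
  have hN0' : (0 : ℝ) < N := by exact_mod_cast hN0
  calc _ ≤ ∑ k ∈ Finset.range N, ε / (t - s + 1) * ((t - s) / N) := by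
        refine norm_sum_le_of_le _ fun k hk => ?_
        have hk' := Finset.mem_range.1 hk
        have hle : grid s t N k ≤ grid s t N (k + 1) := grid_mono hst N k.le_succ
        refine (intervalIntegral.norm_integral_le_of_norm_le_const (C := ε / (t - s + 1))
          fun u hu => ?_).trans_eq ?_
        · rw [Set.uIoc_of_le hle] at hu
          exact hN k hk' u ⟨hu.1.le, hu.2⟩
        · rw [grid_succ, add_sub_cancel_left, abs_of_nonneg]
          exact div_nonneg (by linarith) hN0'.le
    _ = ε * ((t - s) / (t - s + 1)) := by
        rw [Finset.sum_const, Finset.card_range, nsmul_eq_mul]; field_simp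
    _ < ε * 1 := by
        gcongr
        rw [div_lt_one hpos]; linarith
    _ = ε := mul_one ε

theorem sum_grid_telescope {E : Type*} [AddCommGroup E] (f : ℝ → E) (s t : ℝ) {N : ℕ}
    (hN : N ≠ 0) :
    ∑ k ∈ Finset.range N, (f (grid s t N (k + 1)) - f (grid s t N k)) = f t - f s := by
  rw [Finset.sum_range_sub (fun k => f (grid s t N k)), grid_zero, grid_self s t hN]

theorem tendsto_riemann_sum {E : Type*} [NormedAddCommGroup E] [NormedSpace ℝ E] [CompleteSpace E]
    {s t : ℝ} (hst : s ≤ t) {f : ℝ → E} (hf : ContinuousOn f (Set.Icc s t)) :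
    Tendsto (fun N : ℕ => ∑ k ∈ Finset.range N, ((t - s) / N) • f (grid s t N k)) atTop
      (𝓝 (∫ u in s..t, f u)) := by
  have h := tendsto_sum_integral_zero hst (fun N k u => f (grid s t N k) - f u) (by
    intro ε hε
    filter_upwards [eventually_dist_cell_lt hst hf hε] with N hN k hk u hu
    rw [← dist_eq_norm]
    exact (hN k hk _ ⟨le_rfl, grid_mono hst N k.le_succ⟩ u hu).le)
  have h2 := h.add_const (∫ u in s..t, f u)
  rw [zero_add] at h2
  refine h2.congr' ?_
  filter_upwards [eventually_gt_atTop 0] with N hN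
  have hi : ∀ k < N, IntervalIntegrable f volume (grid s t N k) (grid s t N (k + 1)) := fun k hk =>
    (hf.mono ((Set.uIcc_of_le (grid_mono hst N k.le_succ)).trans_subset
      (cell_subset hst hk))).intervalIntegrable
  have e := intervalIntegral.sum_integral_adjacent_intervals hi
  rw [grid_zero, grid_self s t hN.ne'] at e
  rw [← e, ← Finset.sum_add_distrib]
  refine Finset.sum_congr rfl fun k hk => ?_
  rw [intervalIntegral.integral_sub intervalIntegrable_const (hi k (Finset.mem_range.1 hk)),
    intervalIntegral.integral_const, grid_succ]
  simp

/-- Variation of constants along a continuous path: if `Ψ' = -Ψ M` and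
`F_u = X_u - ∫_s^u M X`, then `∑ Ψ ΔF` converges to `Ψ_t X_t - Ψ_s X_s`. Only the increments of
`F` occur, so no regularity of `F` beyond that of `X` is used. -/
theorem tendsto_sum_act_increment {r : ℕ} {s t : ℝ} (hst : s ≤ t) {X : ℝ → Vec r}
    (hX : ContinuousOn X (Set.Icc s t)) {M Ψ : ℝ → Mat r} (hM : ContinuousOn M (Set.Icc s t))
    (hΨ : ∀ u, HasDerivAt Ψ (-(Ψ u * M u)) u) :
    Tendsto (fun N : ℕ => ∑ k ∈ Finset.range N, act (Ψ (grid s t N k))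
        (X (grid s t N (k + 1)) - X (grid s t N k)
          - ∫ u in grid s t N k..grid s t N (k + 1), act (M u) (X u))) atTop
      (𝓝 (act (Ψ t) (X t) - act (Ψ s) (X s))) := by
  have hΨc : Continuous Ψ := continuous_iff_continuousAt.2 fun u => (hΨ u).continuousAt
  obtain ⟨CΨ, hCΨ⟩ := isCompact_Icc.exists_bound_of_continuousOn
    (hΨc.continuousOn (s := Set.Icc s t))
  obtain ⟨CM, hCM⟩ := isCompact_Icc.exists_bound_of_continuousOn hM
  obtain ⟨CX, hCX⟩ := isCompact_Icc.exists_bound_of_continuousOn hX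
  have hs : s ∈ Set.Icc s t := ⟨le_rfl, hst⟩
  have hCΨ0 := (norm_nonneg _).trans (hCΨ s hs)
  have hCM0 := (norm_nonneg _).trans (hCM s hs)
  have hCX0 := (norm_nonneg _).trans (hCX s hs)
  have hMX : ContinuousOn (fun u => act (M u) (X u)) (Set.Icc s t) :=
    ((actL r r).continuous.comp_continuousOn hM).clm_apply hX
  have hΨM : ContinuousOn (fun u => Ψ u * M u) (Set.Icc s t) := hΨc.continuousOn.mul hM
  -- summation by parts: the difference between the sum and the telescoping sum of `Ψ X` is the
  -- integral over the cells of `Ψ_{u_k} M_u X_u - Ψ_u M_u X_{u_{k+1}}`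
  have h := tendsto_sum_integral_zero hst (fun N k u =>
    act (Ψ (grid s t N k)) (act (M u) (X u)) - act (Ψ u * M u) (X (grid s t N (k + 1)))) (by
    intro ε hε
    have hp : 0 < CM * CX + CΨ * CM + 1 := by positivity
    set δ := ε / (CM * CX + CΨ * CM + 1) with hδ
    have hδ0 : 0 < δ := by positivity
    filter_upwards [eventually_dist_cell_lt hst (hΨc.continuousOn (s := Set.Icc s t)) hδ0,
      eventually_dist_cell_lt hst hX hδ0] with N h1 h2 k hk u hu
    have hle := grid_mono hst N k.le_succ
    have hu' := cell_subset hst hk hu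
    have e1 := (h1 k hk _ ⟨le_rfl, hle⟩ u hu).le
    have e2 := (h2 k hk u hu _ ⟨hle, le_rfl⟩).le
    rw [dist_eq_norm] at e1 e2
    have e : act (Ψ (grid s t N k)) (act (M u) (X u)) - act (Ψ u * M u) (X (grid s t N (k + 1)))
        = act (Ψ (grid s t N k) - Ψ u) (act (M u) (X u))
          + act (Ψ u) (act (M u) (X u - X (grid s t N (k + 1)))) := by
      rw [sub_act, act_sub, act_sub, act_mul]; abel
    rw [e]
    calc _ ≤ δ * (CM * CX) + CΨ * (CM * δ) := by
          refine (norm_add_le _ _).trans (add_le_add ?_ ?_)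
          · refine (norm_act_le _ _).trans (mul_le_mul e1 ?_ (norm_nonneg _) hδ0.le)
            exact (norm_act_le _ _).trans
              (mul_le_mul (hCM u hu') (hCX u hu') (norm_nonneg _) hCM0)
          · refine (norm_act_le _ _).trans (mul_le_mul (hCΨ u hu') ?_ (norm_nonneg _) hCΨ0)
            exact (norm_act_le _ _).trans (mul_le_mul (hCM u hu') e2 (norm_nonneg _) hCM0)
      _ ≤ δ * (CM * CX + CΨ * CM + 1) := by nlinarith
      _ = ε := by rw [hδ]; field_simp)
  have h2 := (h.const_sub (act (Ψ t) (X t) - act (Ψ s) (X s)))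
  rw [sub_zero] at h2
  refine h2.congr' ?_
  filter_upwards [eventually_gt_atTop 0] with N hN
  rw [← sum_grid_telescope (fun u => act (Ψ u) (X u)) s t hN.ne', ← Finset.sum_sub_distrib]
  refine Finset.sum_congr rfl fun k hk => ?_
  have hk := Finset.mem_range.1 hk
  have hsub : Set.uIcc (grid s t N k) (grid s t N (k + 1)) ⊆ Set.Icc s t :=
    (Set.uIcc_of_le (grid_mono hst N k.le_succ)).trans_subset (cell_subset hst hk)
  have i1 : IntervalIntegrable (fun u => act (M u) (X u)) volume (grid s t N k)
      (grid s t N (k + 1)) := (hMX.mono hsub).intervalIntegrable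
  have i2 : IntervalIntegrable (fun u => Ψ u * M u) volume (grid s t N k)
      (grid s t N (k + 1)) := (hΨM.mono hsub).intervalIntegrable
  have e1 : ∫ u in grid s t N k..grid s t N (k + 1), act (Ψ (grid s t N k)) (act (M u) (X u))
      = act (Ψ (grid s t N k)) (∫ u in grid s t N k..grid s t N (k + 1), act (M u) (X u)) :=
    (actL r r (Ψ (grid s t N k))).intervalIntegral_comp_comm i1
  have e2 : ∫ u in grid s t N k..grid s t N (k + 1), act (Ψ u * M u) (X (grid s t N (k + 1)))
      = act (Ψ (grid s t N k) - Ψ (grid s t N (k + 1))) (X (grid s t N (k + 1))) := by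
    have e3 := ((actL r r).flip (X (grid s t N (k + 1)))).intervalIntegral_comp_comm i2
    simp only [ContinuousLinearMap.flip_apply, actL_apply] at e3
    rw [e3]
    have e4 := intervalIntegral.integral_eq_sub_of_hasDerivAt
      (fun u _ => hΨ u) i2.neg
    rw [intervalIntegral.integral_neg] at e4
    rw [← neg_sub (Ψ (grid s t N (k + 1))), ← e4, neg_neg]
  rw [intervalIntegral.integral_sub, e1, e2, sub_act, act_sub, act_sub]
  · abel
  · exact ((actL r r (Ψ (grid s t N k))).continuous.comp_continuousOn
      (hMX.mono hsub)).intervalIntegrable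
  · exact (((actL r r).flip (X (grid s t N (k + 1)))).continuous.comp_continuousOn
      (hΨM.mono hsub)).intervalIntegrable

/-! ### Convergence in measure -/

section ConvergenceInMeasure

variable {Ω : Type*} {mΩ : MeasurableSpace Ω} {μ : Measure Ω}

theorem tendstoInMeasure_of_norm_le {E F : Type*} [NormedAddCommGroup E] [NormedAddCommGroup F]
    {f : ℕ → Ω → E} {f' : Ω → E} {g : ℕ → Ω → F} {g' : Ω → F} (C : ℝ)
    (h : TendstoInMeasure μ g atTop g')
    (hle : ∀ n ω, ‖f n ω - f' ω‖ ≤ C * ‖g n ω - g' ω‖) : TendstoInMeasure μ f atTop f' := by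
  rw [tendstoInMeasure_iff_norm] at h ⊢
  intro ε hε
  have hC : 0 < |C| + 1 := by positivity
  refine tendsto_of_tendsto_of_tendsto_of_le_of_le tendsto_const_nhds
    (h (ε / (|C| + 1)) (by positivity)) (fun _ => zero_le) fun n => measure_mono fun ω hω => ?_
  simp only [Set.mem_ofPred_eq] at hω ⊢
  rw [div_le_iff₀ hC]
  have h1 := hω.trans (hle n ω)
  have h2 : C ≤ |C| := le_abs_self C
  nlinarith [norm_nonneg (g n ω - g' ω)]

theorem tendstoInMeasure_add {E : Type*} [NormedAddCommGroup E]
    {f g : ℕ → Ω → E} {f' g' : Ω → E} (hf : TendstoInMeasure μ f atTop f')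
    (hg : TendstoInMeasure μ g atTop g') :
    TendstoInMeasure μ (fun n ω => f n ω + g n ω) atTop (fun ω => f' ω + g' ω) := by
  rw [tendstoInMeasure_iff_norm] at hf hg ⊢
  intro ε hε
  have h := (hf (ε / 2) (by positivity)).add (hg (ε / 2) (by positivity))
  rw [add_zero] at h
  refine tendsto_of_tendsto_of_tendsto_of_le_of_le tendsto_const_nhds h (fun _ => zero_le)
    fun n => (measure_mono fun ω hω => ?_).trans (measure_union_le _ _)
  simp only [Set.mem_ofPred_eq, Set.mem_union] at hω ⊢
  by_contra! hc
  have : f n ω + g n ω - (f' ω + g' ω) = (f n ω - f' ω) + (g n ω - g' ω) := by abel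
  rw [this] at hω
  linarith [norm_add_le (f n ω - f' ω) (g n ω - g' ω), hc.1, hc.2]

theorem tendstoInMeasure_sub {E : Type*} [NormedAddCommGroup E]
    {f g : ℕ → Ω → E} {f' g' : Ω → E} (hf : TendstoInMeasure μ f atTop f')
    (hg : TendstoInMeasure μ g atTop g') :
    TendstoInMeasure μ (fun n ω => f n ω - g n ω) atTop (fun ω => f' ω - g' ω) := by
  have hg' : TendstoInMeasure μ (fun n ω => -g n ω) atTop (fun ω => -g' ω) :=
    tendstoInMeasure_of_norm_le 1 hg fun n ω => by
      rw [one_mul, ← norm_neg (g n ω - g' ω)]; exact le_of_eq (congrArg _ (by abel))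
  simpa only [sub_eq_add_neg] using tendstoInMeasure_add hf hg'

theorem tendsto_integral_cexp_of_tendstoInMeasure [IsFiniteMeasure μ] {f : ℕ → Ω → ℝ} {f' : Ω → ℝ}
    (hm : ∀ n, AEStronglyMeasurable (f n) μ) (hf : TendstoInMeasure μ f atTop f') (θ : ℝ) :
    Tendsto (fun n => ∫ ω, Complex.exp (θ * f n ω * Complex.I) ∂μ) atTop
      (𝓝 (∫ ω, Complex.exp (θ * f' ω * Complex.I) ∂μ)) := by
  refine tendsto_of_subseq_tendsto fun ns hns => ?_
  obtain ⟨ms, -, hms⟩ := (hf.comp hns).exists_seq_tendsto_ae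
  refine ⟨ms, ?_⟩
  refine tendsto_integral_of_dominated_convergence (fun _ => (1 : ℝ)) (fun n => ?_)
    (integrable_const _) (fun n => ?_) ?_
  · have hc : Continuous fun x : ℝ => Complex.exp (θ * x * Complex.I) := by fun_prop
    exact hc.comp_aestronglyMeasurable (hm _)
  · refine Eventually.of_forall fun ω => le_of_eq ?_
    rw [← Complex.ofReal_mul, Complex.norm_exp_ofReal_mul_I]
  · filter_upwards [hms] with ω hω
    have hc : Continuous fun x : ℝ => Complex.exp (θ * x * Complex.I) := by fun_prop
    exact (hc.tendsto _).comp hω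

/-- Limits in measure inherit measurability, up to null sets, with respect to a sub-σ-algebra. -/
theorem tendstoInMeasure_aestronglyMeasurable {m : MeasurableSpace Ω} {E : Type*}
    [NormedAddCommGroup E] [CompleteSpace E] {f : ℕ → Ω → E} {f' : Ω → E}
    (hm : ∀ n, AEStronglyMeasurable[m] (f n) μ) (hf : TendstoInMeasure μ f atTop f') :
    AEStronglyMeasurable[m] f' μ := by
  obtain ⟨ns, -, hns⟩ := hf.exists_seq_tendsto_ae
  choose g hg hfg using fun n => hm (ns n)
  refine ⟨_, StronglyMeasurable.limUnder (l := atTop) hg, ?_⟩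
  filter_upwards [hns, ae_all_iff.2 hfg] with ω h1 h2
  exact (Tendsto.limUnder_eq (h1.congr h2)).symm

end ConvergenceInMeasure

/-! ### Wiener integrals of deterministic functions -/

section Wiener

variable {Ω : Type*} {mΩ : MeasurableSpace Ω} {μ : Measure Ω}

/-- The graph of the Wiener integral `L²(ℝ) → L²(μ)` with respect to the scalar process `β`: the
closed linear span of the pairs `(1_{(0, t]}, β_t)`. -/
def wienerGraph (μ : Measure Ω) (β : ℝ → Ω → ℝ) :
    Submodule ℝ (Lp ℝ 2 (volume : Measure ℝ) × Lp ℝ 2 μ) :=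
  (Submodule.span ℝ {q | ∃ t : ℝ≥0, (q.1 =ᵐ[volume] (Set.Ioc (0 : ℝ) t).indicator 1) ∧
    q.2 =ᵐ[μ] β t}).topologicalClosure

theorem mem_wienerGraph_iff_seq {β : ℝ → Ω → ℝ}
    {q : Lp ℝ 2 (volume : Measure ℝ) × Lp ℝ 2 μ} :
    q ∈ wienerGraph μ β ↔ ∃ u : ℕ → Lp ℝ 2 (volume : Measure ℝ) × Lp ℝ 2 μ,
      (∀ n, u n ∈ Submodule.span ℝ {q : Lp ℝ 2 (volume : Measure ℝ) × Lp ℝ 2 μ | ∃ t : ℝ≥0,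
        (q.1 =ᵐ[volume] (Set.Ioc (0 : ℝ) t).indicator 1) ∧ q.2 =ᵐ[μ] β t}) ∧
      Tendsto u atTop (𝓝 q) := by
  change q ∈ closure _ ↔ _
  exact mem_closure_iff_seq_limit

/-- On step functions the Wiener integral is isometric, by `E β_t β_u = min t u`, and takes centered
Gaussian values. -/
theorem isometry_gaussian_of_mem_span {β : ℝ → Ω → ℝ}
    (hβ : IsPreBrownianReal (fun t : ℝ≥0 => β t) μ)
    {q : Lp ℝ 2 (volume : Measure ℝ) × Lp ℝ 2 μ}
    (hq : q ∈ Submodule.span ℝ {q : Lp ℝ 2 (volume : Measure ℝ) × Lp ℝ 2 μ | ∃ t : ℝ≥0,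
      (q.1 =ᵐ[volume] (Set.Ioc (0 : ℝ) t).indicator 1) ∧ q.2 =ᵐ[μ] β t}) :
    ‖q.2‖ = ‖q.1‖ ∧ ∫ ω, q.2 ω ∂μ = 0 ∧ HasGaussianLaw q.2 μ := by
  have hprob : IsProbabilityMeasure μ := hβ.isGaussianProcess.isProbabilityMeasure
  have hmem : ∀ t : ℝ≥0, MemLp (β t) 2 μ := fun t =>
    (hβ.isGaussianProcess.hasGaussianLaw_eval t).memLp_two
  let e : ℝ≥0 → Lp ℝ 2 (volume : Measure ℝ) × Lp ℝ 2 μ := fun t =>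
    (indicatorConstLp 2 (measurableSet_Ioc (a := (0 : ℝ)) (b := t)) (by simp) 1,
      (hmem t).toLp (β t))
  have he1 : ∀ t, (e t).1 =ᵐ[volume] (Set.Ioc (0 : ℝ) t).indicator 1 := fun t =>
    indicatorConstLp_coeFn (hs := measurableSet_Ioc) (hμs := by simp) (c := (1 : ℝ))
  have he2 : ∀ t, (e t).2 =ᵐ[μ] β t := fun t => (hmem t).coeFn_toLp
  have hset : {q : Lp ℝ 2 (volume : Measure ℝ) × Lp ℝ 2 μ | ∃ t : ℝ≥0,
      (q.1 =ᵐ[volume] (Set.Ioc (0 : ℝ) t).indicator 1) ∧ q.2 =ᵐ[μ] β t} = Set.range e := by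
    ext q
    constructor
    · rintro ⟨t, h1, h2⟩
      exact ⟨t, Prod.ext (Lp.ext ((he1 t).trans h1.symm)) (Lp.ext ((he2 t).trans h2.symm))⟩
    · rintro ⟨t, rfl⟩
      exact ⟨t, he1 t, he2 t⟩
  rw [hset, Finsupp.mem_span_range_iff_exists_finsupp] at hq
  obtain ⟨c, rfl⟩ := hq
  have hs1 : (c.sum fun i a => a • e i).1 = ∑ t ∈ c.support, c t • (e t).1 := by
    simp [Finsupp.sum, Prod.fst_sum]
  have hs2 : (c.sum fun i a => a • e i).2 = ∑ t ∈ c.support, c t • (e t).2 := by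
    simp [Finsupp.sum, Prod.snd_sum]
  have hgram : ∀ t u, inner ℝ (e t).2 (e u).2 = inner ℝ (e t).1 (e u).1 := by
    intro t u
    have h1 : inner ℝ (e t).1 (e u).1 = min (t : ℝ) u := by
      rw [L2.real_inner_indicatorConstLp_one_indicatorConstLp_one measurableSet_Ioc
        measurableSet_Ioc (by simp) (by simp), Set.Ioc_inter_Ioc]
      simp
    rw [h1, L2.inner_def]
    have h2 := hβ.covariance_fun_eval t u
    rw [covariance_eq_sub (hmem t) (hmem u), hβ.integral_eval t, zero_mul, sub_zero] at h2
    rw [NNReal.coe_min] at h2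
    rw [← h2]
    refine integral_congr_ae ?_
    filter_upwards [he2 t, he2 u] with ω h3 h4
    rw [h3, h4]
    simp [mul_comm]
  have hfun : (c.sum fun i a => a • e i).2 =ᵐ[μ] fun ω => ∑ t ∈ c.support, c t • β t ω := by
    rw [hs2]
    have : ∀ s : Finset ℝ≥0, (∑ t ∈ s, c t • (e t).2 : Lp ℝ 2 μ) =ᵐ[μ]
        fun ω => ∑ t ∈ s, c t • β t ω := by
      intro s
      induction s using Finset.induction_on with
      | empty => exact Lp.coeFn_zero ℝ 2 μ
      | insert t s ht ih =>
        rw [Finset.sum_insert ht]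
        filter_upwards [Lp.coeFn_add (c t • (e t).2) (∑ t ∈ s, c t • (e t).2),
          Lp.coeFn_smul (c t) (e t).2, ih, he2 t] with ω h1 h2 h3 h4
        rw [h1, Pi.add_apply, h2, h3, Pi.smul_apply, h4, Finset.sum_insert ht]
    exact this _
  refine ⟨?_, ?_, ?_⟩
  · have : ‖(c.sum fun i a => a • e i).2‖ ^ 2 = ‖(c.sum fun i a => a • e i).1‖ ^ 2 := by
      rw [← real_inner_self_eq_norm_sq, ← real_inner_self_eq_norm_sq, hs1, hs2]
      simp only [sum_inner, inner_sum, real_inner_smul_left, real_inner_smul_right, hgram]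
    exact (sq_eq_sq₀ (norm_nonneg _) (norm_nonneg _)).1 this
  · rw [integral_congr_ae hfun, integral_finsetSum]
    · refine Finset.sum_eq_zero fun t _ => ?_
      rw [integral_smul, hβ.integral_eval t, smul_zero]
    · intro t _
      exact (hβ.integrable_eval t).const_mul _
  · refine HasGaussianLaw.congr ?_ hfun.symm
    exact (hβ.isGaussianProcess.smul (fun t => c t)).hasGaussianLaw_fun_sum

theorem norm_eq_of_mem_wienerGraph {β : ℝ → Ω → ℝ}
    (hβ : IsPreBrownianReal (fun t : ℝ≥0 => β t) μ)
    {q : Lp ℝ 2 (volume : Measure ℝ) × Lp ℝ 2 μ} (hq : q ∈ wienerGraph μ β) : ‖q.2‖ = ‖q.1‖ := by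
  obtain ⟨u, hu, hlim⟩ := mem_wienerGraph_iff_seq.1 hq
  refine tendsto_nhds_unique ((continuous_snd.norm.tendsto q).comp hlim) ?_
  refine ((continuous_fst.norm.tendsto q).comp hlim).congr fun n => ?_
  exact (isometry_gaussian_of_mem_span hβ (hu n)).1.symm

/-- The characteristic function of a Wiener integral: the value on step functions passes to the
limit, since both sides are continuous. -/
theorem integral_cexp_of_mem_wienerGraph {β : ℝ → Ω → ℝ}
    (hβ : IsPreBrownianReal (fun t : ℝ≥0 => β t) μ)
    {q : Lp ℝ 2 (volume : Measure ℝ) × Lp ℝ 2 μ} (hq : q ∈ wienerGraph μ β) (θ : ℝ) :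
    ∫ ω, Complex.exp (θ * q.2 ω * Complex.I) ∂μ = Complex.exp (-(θ ^ 2 * ‖q.1‖ ^ 2 : ℝ) / 2) := by
  have hprob : IsProbabilityMeasure μ := hβ.isGaussianProcess.isProbabilityMeasure
  obtain ⟨u, hu, hlim⟩ := mem_wienerGraph_iff_seq.1 hq
  have h1 : TendstoInMeasure μ (fun n => ((u n).2 : Ω → ℝ)) atTop q.2 :=
    tendstoInMeasure_of_tendsto_Lp ((continuous_snd.tendsto q).comp hlim)
  refine tendsto_nhds_unique (tendsto_integral_cexp_of_tendstoInMeasure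
    (fun n => (Lp.memLp (u n).2).1) h1 θ) ?_
  have hc : Continuous fun q : Lp ℝ 2 (volume : Measure ℝ) × Lp ℝ 2 μ =>
      Complex.exp (-(θ ^ 2 * ‖q.1‖ ^ 2 : ℝ) / 2) := by fun_prop
  refine ((hc.tendsto q).comp hlim).congr fun n => ?_
  obtain ⟨hn, hmean, hG⟩ := isometry_gaussian_of_mem_span hβ (hu n)
  have hm : AEMeasurable ((u n).2 : Ω → ℝ) μ := hG.aemeasurable
  have h2 : Var[((u n).2 : Ω → ℝ); μ] = ‖(u n).1‖ ^ 2 := by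
    rw [← hn, variance_of_integral_eq_zero hm hmean, ← real_inner_self_eq_norm_sq, L2.inner_def]
    refine integral_congr_ae (Eventually.of_forall fun ω => ?_)
    simp [sq]
  have h3 := charFun_gaussianReal (μ := ∫ ω, (u n).2 ω ∂μ)
    (v := Var[((u n).2 : Ω → ℝ); μ].toNNReal) θ
  rw [← hG.map_eq_gaussianReal, charFun_apply_real,
    integral_map hm (by fun_prop), hmean, h2] at h3
  rw [h3, Function.comp_apply]
  congr 1
  rw [Real.coe_toNNReal _ (sq_nonneg _)]
  push_cast
  ring

/-- Up to null sets, a Wiener integral is measurable for the σ-algebra of the process. -/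
theorem aestronglyMeasurable_of_mem_wienerGraph {β : ℝ → Ω → ℝ} {m : MeasurableSpace Ω}
    (hβ : ∀ t : ℝ≥0, Measurable[m] (β t))
    {q : Lp ℝ 2 (volume : Measure ℝ) × Lp ℝ 2 μ} (hq : q ∈ wienerGraph μ β) :
    AEStronglyMeasurable[m] q.2 μ := by
  obtain ⟨u, hu, hlim⟩ := mem_wienerGraph_iff_seq.1 hq
  have h1 : TendstoInMeasure μ (fun n => ((u n).2 : Ω → ℝ)) atTop q.2 :=
    tendstoInMeasure_of_tendsto_Lp ((continuous_snd.tendsto q).comp hlim)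
  refine tendstoInMeasure_aestronglyMeasurable (fun n => ?_) h1
  have hun := hu n
  generalize u n = p at hun
  induction hun using Submodule.span_induction with
  | mem q hq =>
    obtain ⟨t, -, h2⟩ := hq
    exact ⟨β t, (hβ t).stronglyMeasurable, h2⟩
  | zero => exact ⟨fun _ => 0, stronglyMeasurable_const, Lp.coeFn_zero ℝ 2 μ⟩
  | add p q _ _ hp hq => exact (hp.add hq).congr (Lp.coeFn_add _ _).symm
  | smul c q _ hq => exact (hq.const_smul c).congr (Lp.coeFn_smul _ _).symm

/-- The graph is closed over convergent integrands: by the isometry the integrals form a Cauchy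
sequence. -/
theorem exists_wienerGraph_lim {β : ℝ → Ω → ℝ}
    (hβ : IsPreBrownianReal (fun t : ℝ≥0 => β t) μ)
    {q : ℕ → Lp ℝ 2 (volume : Measure ℝ) × Lp ℝ 2 μ} (hq : ∀ n, q n ∈ wienerGraph μ β)
    {h : Lp ℝ 2 (volume : Measure ℝ)} (hlim : Tendsto (fun n => (q n).1) atTop (𝓝 h)) :
    ∃ Z : Lp ℝ 2 μ, (h, Z) ∈ wienerGraph μ β ∧ Tendsto (fun n => (q n).2) atTop (𝓝 Z) := by
  have hc : CauchySeq fun n => (q n).2 := by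
    have h1 := hlim.cauchySeq
    rw [Metric.cauchySeq_iff] at h1 ⊢
    intro ε hε
    obtain ⟨N, hN⟩ := h1 ε hε
    refine ⟨N, fun m hm n hn => ?_⟩
    have := norm_eq_of_mem_wienerGraph hβ (Submodule.sub_mem _ (hq m) (hq n))
    rw [dist_eq_norm, ← Prod.snd_sub, this, Prod.fst_sub, ← dist_eq_norm]
    exact hN m hm n hn
  obtain ⟨Z, hZ⟩ := cauchySeq_tendsto_of_complete hc
  refine ⟨Z, ?_, hZ⟩
  exact (Submodule.isClosed_topologicalClosure _).mem_of_tendsto (hlim.prodMk_nhds hZ)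
    (Eventually.of_forall hq)

end Wiener

section VectorWiener

variable {Ω : Type*} {mΩ : MeasurableSpace Ω} {μ : Measure Ω}

/-- `V` is the Wiener integral `∫ ⟪h_u, dW_u⟫` of the deterministic vector function `h` with respect
to the vector-valued process `W`: a sum of scalar Wiener integrals over the coordinates. The
integral is a relation, so `V` is determined up to null sets only. -/
def IsWienerInt (μ : Measure Ω) {n : ℕ} (W : ℝ → Ω → Vec n) (h : ℝ → Vec n) (V : Ω → ℝ) : Prop :=
  ∃ (H : Fin n → Lp ℝ 2 (volume : Measure ℝ)) (Z : Fin n → Lp ℝ 2 μ),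
    (∀ i, (H i, Z i) ∈ wienerGraph μ (fun t ω => W t ω i) ∧ H i =ᵐ[volume] fun u => h u i) ∧
    V =ᵐ[μ] fun ω => ∑ i, Z i ω

namespace IsWienerInt

variable {n : ℕ} {W : ℝ → Ω → Vec n}

theorem congr {h h' : ℝ → Vec n} {V V' : Ω → ℝ} (hV : IsWienerInt μ W h V) (hh : h = h')
    (hVV : V =ᵐ[μ] V') : IsWienerInt μ W h' V' := by
  obtain ⟨H, Z, h1, h2⟩ := hV
  exact ⟨H, Z, hh ▸ h1, hVV.symm.trans h2⟩

theorem zero : IsWienerInt μ W (fun _ => 0) (fun _ => 0) := by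
  refine ⟨fun _ => 0, fun _ => 0, fun i => ⟨Submodule.zero_mem _, Lp.coeFn_zero ℝ 2 volume⟩, ?_⟩
  filter_upwards [Lp.coeFn_zero ℝ 2 μ] with ω hω
  exact (Finset.sum_eq_zero fun i _ => hω).symm

theorem add {h h' : ℝ → Vec n} {V V' : Ω → ℝ} (hV : IsWienerInt μ W h V)
    (hV' : IsWienerInt μ W h' V') :
    IsWienerInt μ W (fun u => h u + h' u) (fun ω => V ω + V' ω) := by
  obtain ⟨H, Z, h1, h2⟩ := hV
  obtain ⟨H', Z', h1', h2'⟩ := hV'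
  refine ⟨fun i => H i + H' i, fun i => Z i + Z' i, fun i =>
    ⟨Submodule.add_mem _ (h1 i).1 (h1' i).1, ?_⟩, ?_⟩
  · filter_upwards [Lp.coeFn_add (H i) (H' i), (h1 i).2, (h1' i).2] with u e1 e2 e3
    rw [e1, Pi.add_apply, e2, e3]; rfl
  · filter_upwards [h2, h2', ae_all_iff.2 fun i => Lp.coeFn_add (Z i) (Z' i)] with ω e1 e2 e3
    rw [e1, e2, ← Finset.sum_add_distrib]
    exact Finset.sum_congr rfl fun i _ => (e3 i).symm

theorem const_mul {h : ℝ → Vec n} {V : Ω → ℝ} (hV : IsWienerInt μ W h V) (c : ℝ) :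
    IsWienerInt μ W (fun u => c • h u) (fun ω => c * V ω) := by
  obtain ⟨H, Z, h1, h2⟩ := hV
  refine ⟨fun i => c • H i, fun i => c • Z i, fun i =>
    ⟨Submodule.smul_mem _ c (h1 i).1, ?_⟩, ?_⟩
  · filter_upwards [Lp.coeFn_smul c (H i), (h1 i).2] with u e1 e2
    rw [e1, Pi.smul_apply, e2]; rfl
  · filter_upwards [h2, ae_all_iff.2 fun i => Lp.coeFn_smul c (Z i)] with ω e1 e3
    simp [e1, e3, Finset.mul_sum]

theorem neg {h : ℝ → Vec n} {V : Ω → ℝ} (hV : IsWienerInt μ W h V) :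
    IsWienerInt μ W (fun u => -h u) (fun ω => -V ω) :=
  (hV.const_mul (-1)).congr (by ext; simp) (by simp)

theorem sub {h h' : ℝ → Vec n} {V V' : Ω → ℝ} (hV : IsWienerInt μ W h V)
    (hV' : IsWienerInt μ W h' V') :
    IsWienerInt μ W (fun u => h u - h' u) (fun ω => V ω - V' ω) := by
  simpa only [sub_eq_add_neg] using hV.add hV'.neg

theorem sum {ι : Type*} (s : Finset ι) {h : ι → ℝ → Vec n} {V : ι → Ω → ℝ}
    (hV : ∀ k ∈ s, IsWienerInt μ W (h k) (V k)) :
    IsWienerInt μ W (fun u => ∑ k ∈ s, h k u) (fun ω => ∑ k ∈ s, V k ω) := by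
  classical
  induction s using Finset.induction_on with
  | empty => simpa using zero
  | insert k s hk ih =>
    simp only [Finset.sum_insert hk]
    exact (hV k (by simp)).add (ih fun j hj => hV j (by simp [hj]))

theorem aestronglyMeasurable {m : MeasurableSpace Ω} (hW : ∀ t : ℝ≥0, Measurable[m] (W t))
    {h : ℝ → Vec n} {V : Ω → ℝ} (hV : IsWienerInt μ W h V) : AEStronglyMeasurable[m] V μ := by
  obtain ⟨H, Z, h1, h2⟩ := hV
  refine AEStronglyMeasurable.congr ?_ h2.symm
  have hWi : ∀ i, AEStronglyMeasurable[m] (Z i) μ := fun i =>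
    aestronglyMeasurable_of_mem_wienerGraph
      (fun t => ((EuclideanSpace.proj (𝕜 := ℝ) i).continuous.measurable.comp (hW t))) (h1 i).1
  choose g hg hfg using hWi
  refine ⟨fun ω => ∑ i, g i ω, Finset.stronglyMeasurable_fun_sum _ fun i _ => hg i, ?_⟩
  filter_upwards [ae_all_iff.2 hfg] with ω e
  simp [e]

/-- The Wiener integral of a step function is the corresponding increment. -/
theorem increment (hW : IsStdBrownian μ W) {a b : ℝ} (ha : 0 ≤ a) (hab : a ≤ b) (l : Vec n) :
    IsWienerInt μ W ((Set.Ioc a b).indicator fun _ => l) (fun ω => inner ℝ l (W b ω - W a ω)) := by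
  have hmem : ∀ i (t : ℝ≥0), MemLp (fun ω => W t ω i) 2 μ := fun i t =>
    ((hW.brownian i).hasLaw_eval t).hasGaussianLaw.memLp_two
  let I : ℝ≥0 → Lp ℝ 2 (volume : Measure ℝ) := fun t =>
    indicatorConstLp 2 (measurableSet_Ioc (a := (0 : ℝ)) (b := t)) (by simp) 1
  have hI : ∀ t, I t =ᵐ[volume] (Set.Ioc (0 : ℝ) t).indicator 1 := fun t =>
    indicatorConstLp_coeFn (hs := measurableSet_Ioc) (hμs := by simp) (c := (1 : ℝ))
  let Wl : Fin n → ℝ≥0 → Lp ℝ 2 μ := fun i t => (hmem i t).toLp _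
  have hWl : ∀ i t, Wl i t =ᵐ[μ] fun ω => W t ω i := fun i t => (hmem i t).coeFn_toLp
  have hgen : ∀ i t, (I t, Wl i t) ∈ wienerGraph μ (fun t ω => W t ω i) := fun i t =>
    Submodule.le_topologicalClosure _ (Submodule.subset_span ⟨t, hI t, hWl i t⟩)
  let a' : ℝ≥0 := ⟨a, ha⟩
  let b' : ℝ≥0 := ⟨b, ha.trans hab⟩
  refine ⟨fun i => l i • (I b' - I a'), fun i => l i • (Wl i b' - Wl i a'), fun i =>
    ⟨Submodule.smul_mem _ _ (Submodule.sub_mem _ (hgen i b') (hgen i a')), ?_⟩, ?_⟩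
  · filter_upwards [Lp.coeFn_smul (l i) (I b' - I a'), Lp.coeFn_sub (I b') (I a'), hI a', hI b']
      with u e1 e2 e3 e4
    rw [e1, Pi.smul_apply, e2, Pi.sub_apply, e3, e4]
    change l i • ((Set.Ioc 0 b).indicator 1 u - (Set.Ioc 0 a).indicator 1 u) = _
    by_cases h1 : u ∈ Set.Ioc a b
    · have h2 : u ∈ Set.Ioc 0 b := ⟨ha.trans_lt h1.1, h1.2⟩
      have h3 : u ∉ Set.Ioc 0 a := fun h => absurd h.2 (not_le.2 h1.1)
      simp [Set.indicator_of_mem h1, Set.indicator_of_mem h2, Set.indicator_of_notMem h3]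
    · rw [Set.indicator_of_notMem h1]
      by_cases h3 : u ∈ Set.Ioc 0 a
      · have h2 : u ∈ Set.Ioc 0 b := ⟨h3.1, h3.2.trans hab⟩
        simp [Set.indicator_of_mem h2, Set.indicator_of_mem h3]
      · have h2 : u ∉ Set.Ioc 0 b := fun h => by
          by_cases h4 : u ≤ a
          · exact h3 ⟨h.1, h4⟩
          · exact h1 ⟨not_le.1 h4, h.2⟩
        simp [Set.indicator_of_notMem h2, Set.indicator_of_notMem h3]
  · filter_upwards [ae_all_iff.2 fun i => Lp.coeFn_smul (l i) (Wl i b' - Wl i a'),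
      ae_all_iff.2 fun i => Lp.coeFn_sub (Wl i b') (Wl i a'), ae_all_iff.2 fun i => hWl i a',
      ae_all_iff.2 fun i => hWl i b'] with ω e1 e2 e3 e4
    rw [PiLp.inner_apply]
    refine Finset.sum_congr rfl fun i _ => ?_
    rw [e1, Pi.smul_apply, e2, Pi.sub_apply, e3, e4]
    change inner ℝ (l i) ((W b ω - W a ω) i) = l i • (W b ω i - W a ω i)
    simp [mul_comm]

/-- Wiener integrals converge when their integrands converge in `L²`. -/
theorem exists_lim (hW : IsStdBrownian μ W) {h : ℕ → ℝ → Vec n} {V : ℕ → Ω → ℝ}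
    (hV : ∀ N, IsWienerInt μ W (h N) (V N)) {h' : ℝ → Vec n}
    (hh' : ∀ i, MemLp (fun u => h' u i) 2 volume)
    (hlim : ∀ i, Tendsto (fun N => eLpNorm (fun u => h N u i - h' u i) 2 volume) atTop (𝓝 0)) :
    ∃ V', IsWienerInt μ W h' V' ∧ TendstoInMeasure μ V atTop V' := by
  choose H Z h1 h2 using hV
  have hH : ∀ i, Tendsto (fun N => H N i) atTop (𝓝 ((hh' i).toLp _)) := by
    intro i
    rw [Lp.tendsto_Lp_iff_tendsto_eLpNorm']
    refine (hlim i).congr fun N => eLpNorm_congr_ae ?_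
    filter_upwards [(h1 N i).2, (hh' i).coeFn_toLp] with u e1 e2
    rw [Pi.sub_apply, e1, e2]
  have hex : ∀ i, ∃ Y : Lp ℝ 2 μ, ((hh' i).toLp _, Y) ∈ wienerGraph μ (fun t ω => W t ω i) ∧
      Tendsto (fun N => Z N i) atTop (𝓝 Y) := fun i =>
    exists_wienerGraph_lim (hW.brownian i).toIsPreBrownianReal
      (q := fun N => (H N i, Z N i)) (fun N => (h1 N i).1) (hH i)
  choose Y hY hYlim using hex
  refine ⟨fun ω => ∑ i, Y i ω, ⟨_, Y, fun i => ⟨hY i, (hh' i).coeFn_toLp⟩, EventuallyEq.rfl⟩, ?_⟩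
  refine TendstoInMeasure.congr_left (fun N => (h2 N).symm) ?_
  have : ∀ s : Finset (Fin n), TendstoInMeasure μ (fun N ω => ∑ i ∈ s, Z N i ω) atTop
      (fun ω => ∑ i ∈ s, Y i ω) := by
    intro s
    induction s using Finset.induction_on with
    | empty =>
      intro ε hε
      simp [hε.not_ge]
    | insert k s hk ih =>
      simp only [Finset.sum_insert hk]
      exact tendstoInMeasure_add (tendstoInMeasure_of_tendsto_Lp (hYlim k)) ih
  exact this _

/-- A Wiener integral is a centered Gaussian variable of variance `∫ ‖h‖²`. -/
theorem integral_cexp (hW : IsStdBrownian μ W) {h : ℝ → Vec n} {V : Ω → ℝ}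
    (hV : IsWienerInt μ W h V) (θ : ℝ) :
    ∫ ω, Complex.exp (θ * V ω * Complex.I) ∂μ
      = Complex.exp (-(θ ^ 2 * ∫ u, ‖h u‖ ^ 2 : ℝ) / 2) := by
  obtain ⟨H, Z, h1, h2⟩ := hV
  have hm : ∀ i, AEStronglyMeasurable[MeasurableSpace.comap (fun ω (t : ℝ≥0) => W t ω i)
      inferInstance] (Z i) μ := fun i =>
    aestronglyMeasurable_of_mem_wienerGraph
      (fun t => (measurable_pi_apply t).comp (comap_measurable (fun ω (t : ℝ≥0) => W t ω i)))
      (h1 i).1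
  choose g hg hfg using hm
  have hle : ∀ i, MeasurableSpace.comap (fun ω (t : ℝ≥0) => W t ω i) inferInstance
      ≤ mΩ := fun i =>
    (show Measurable fun ω (t : ℝ≥0) => W t ω i from measurable_pi_lambda _ fun t =>
      (EuclideanSpace.proj (𝕜 := ℝ) i).continuous.measurable.comp (hW.measurable t)).comap_le
  have hgm : ∀ i, Measurable (g i) := fun i => (hg i).measurable.mono (hle i) le_rfl
  have hind : iIndepFun g μ := by
    rw [iIndepFun_iff_iIndep]
    exact iIndep_of_iIndep_of_le hW.indep.iIndep fun i => (hg i).measurable.comap_le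
  have e1 : ∫ ω, Complex.exp (θ * V ω * Complex.I) ∂μ
      = charFun (μ.map fun ω => ∑ i, g i ω) θ := by
    rw [charFun_apply_real, integral_map (by fun_prop) (by fun_prop)]
    refine integral_congr_ae ?_
    filter_upwards [h2, ae_all_iff.2 hfg] with ω a1 a2
    rw [a1]; simp [a2]
  have e2 : ∀ i, charFun (μ.map (g i)) θ = Complex.exp (-(θ ^ 2 * ∫ u, (h u i) ^ 2 : ℝ) / 2) := by
    intro i
    rw [charFun_apply_real, integral_map (by fun_prop) (by fun_prop)]
    have e3 := integral_cexp_of_mem_wienerGraph (hW.brownian i).toIsPreBrownianReal (h1 i).1 θ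
    have e4 : ‖H i‖ ^ 2 = ∫ u, (h u i) ^ 2 := by
      rw [← real_inner_self_eq_norm_sq, L2.inner_def]
      refine integral_congr_ae ?_
      filter_upwards [(h1 i).2] with u hu
      rw [hu]; simp [sq]
    rw [← e4, ← e3]
    refine integral_congr_ae ?_
    filter_upwards [hfg i] with ω a1
    rw [a1]
  have e5 : ∫ u, ‖h u‖ ^ 2 = ∑ i, ∫ u, (h u i) ^ 2 := by
    rw [← integral_finsetSum]
    · refine integral_congr_ae (Eventually.of_forall fun u => ?_)
      simp [EuclideanSpace.real_norm_sq_eq]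
    · intro i _
      exact ((memLp_congr_ae (h1 i).2).1 (Lp.memLp (H i))).integrable_sq
  rw [e1, hind.charFun_map_fun_sum_eq_prod (fun i => (hgm i).aemeasurable), Finset.prod_apply]
  simp_rw [e2]
  rw [← Complex.exp_sum, e5]
  congr 1
  push_cast
  rw [Finset.mul_sum, ← Finset.sum_neg_distrib, Finset.sum_div]

end IsWienerInt

/-- The half-open cells of the grid partition `(s, t]`. -/
theorem sum_indicator_cells {E : Type*} [AddCommGroup E] {s t : ℝ} (hst : s ≤ t) {N : ℕ}
    (hN : N ≠ 0) (g : ℝ → E) (u : ℝ) :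
    ∑ k ∈ Finset.range N, (Set.Ioc (grid s t N k) (grid s t N (k + 1))).indicator g u
      = (Set.Ioc s t).indicator g u := by
  have h := sum_grid_telescope (fun x => (Set.Ioc s x).indicator g u) s t hN
  simp only [Set.Ioc_self, Set.indicator_empty, sub_zero] at h
  rw [← h]
  refine Finset.sum_congr rfl fun k hk => ?_
  have h1 : s ≤ grid s t N k := (grid_mem hst hN (Finset.mem_range.1 hk).le).1
  have h2 : grid s t N k ≤ grid s t N (k + 1) := grid_mono hst N k.le_succ
  rw [eq_sub_iff_add_eq', ← Set.Ioc_union_Ioc_eq_Ioc h1 h2,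
    Set.indicator_union_of_disjoint (Set.Ioc_disjoint_Ioc_of_le le_rfl)]

/-- Functions defined cell by cell, and uniformly close to `g` on the cells, converge to `g` in
`L²(s, t)`. -/
theorem tendsto_eLpNorm_cells {s t : ℝ} (hst : s ≤ t) (f : ℕ → ℕ → ℝ → ℝ) (g : ℝ → ℝ)
    (hfg : ∀ ε : ℝ, 0 < ε → ∀ᶠ N : ℕ in atTop, ∀ k < N,
      ∀ u ∈ Set.Icc (grid s t N k) (grid s t N (k + 1)), |f N k u - g u| ≤ ε) :
    Tendsto (fun N => eLpNorm (fun u =>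
      (∑ k ∈ Finset.range N, (Set.Ioc (grid s t N k) (grid s t N (k + 1))).indicator (f N k) u)
        - (Set.Ioc s t).indicator g u) 2 volume) atTop (𝓝 0) := by
  rw [ENNReal.tendsto_nhds_zero]
  intro ε hε
  have hC : volume (Set.Ioc s t) ^ (1 / (2 : ℝ≥0∞).toReal) ≠ ⊤ := by
    rw [Real.volume_Ioc]; finiteness
  obtain ⟨δ, hδ, hδε⟩ := ENNReal.exists_nnreal_pos_mul_lt hC hε.ne'
  filter_upwards [hfg δ (by exact_mod_cast hδ), eventually_gt_atTop 0] with N hN hN0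
  refine le_trans (eLpNorm_mono_real (g := (Set.Ioc s t).indicator fun _ => (δ : ℝ)) fun u => ?_) ?_
  · rw [← sum_indicator_cells hst hN0.ne' g u, ← sum_indicator_cells hst hN0.ne' _ u,
      ← Finset.sum_sub_distrib]
    refine norm_sum_le_of_le _ fun k hk => ?_
    by_cases hu : u ∈ Set.Ioc (grid s t N k) (grid s t N (k + 1))
    · simp only [Set.indicator_of_mem hu]
      exact hN k (Finset.mem_range.1 hk) u ⟨hu.1.le, hu.2⟩
    · simp [Set.indicator_of_notMem hu]
  · rw [eLpNorm_indicator_const measurableSet_Ioc (by simp) (by simp)]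
    simpa using hδε.le

end VectorWiener

/-! ### Square roots of positive matrices -/

theorem inner_act_eq_dotProduct {n : ℕ} (M : Mat n) (z : Vec n) :
    inner ℝ z (act M z) = z.ofLp ⬝ᵥ (M *ᵥ z.ofLp) := by
  simp [act, EuclideanSpace.inner_eq_star_dotProduct, dotProduct_comm]

theorem inner_act_nonneg {n : ℕ} {M : Mat n} (hM : M.PosSemidef) (z : Vec n) :
    0 ≤ inner ℝ z (act M z) := by
  rw [inner_act_eq_dotProduct]
  simpa using hM.dotProduct_mulVec_nonneg z.ofLp

theorem posSemidef_of_inner_act_nonneg {n : ℕ} {M : Mat n} (hs : M.IsHermitian)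
    (h : ∀ z, 0 ≤ inner ℝ z (act M z)) : M.PosSemidef := by
  refine .of_dotProduct_mulVec_nonneg hs fun x => ?_
  have := h (WithLp.toLp 2 x)
  rw [inner_act_eq_dotProduct] at this
  simpa using this

theorem inner_act_le_of_le {n : ℕ} {M N : Mat n} (h : M ≤ N) (z : Vec n) :
    inner ℝ z (act M z) ≤ inner ℝ z (act N z) := by
  have := inner_act_nonneg (Matrix.le_iff.1 h) z
  rw [sub_act, inner_sub_right] at this
  linarith

theorem smul_one_act {n : ℕ} (c : ℝ) (z : Vec n) : act (c • (1 : Mat n)) z = c • z := by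
  rw [← actL_apply, map_smul]; simp [one_act]

theorem inner_smul_one_act {n : ℕ} (c : ℝ) (z : Vec n) :
    inner ℝ z (act (c • (1 : Mat n)) z) = c * ‖z‖ ^ 2 := by
  rw [smul_one_act, real_inner_smul_right, real_inner_self_eq_norm_sq]

theorem isHermitian_smul_one {n : ℕ} (c : ℝ) : (c • (1 : Mat n)).IsHermitian := by
  simp [Matrix.IsHermitian]

theorem transpose_eq_of_isHermitian {n : ℕ} {M : Mat n} (h : M.IsHermitian) : Mᵀ = M := by
  simpa using h.eq

theorem act_eigenvectorBasis {n : ℕ} {A : Mat n} (hA : A.IsHermitian) (i : Fin n) :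
    act A (hA.eigenvectorBasis i) = hA.eigenvalues i • hA.eigenvectorBasis i := by
  ext j
  exact congrFun (hA.mulVec_eigenvectorBasis i) j

theorem norm_le_of_eigenvalues {n : ℕ} {A : Mat n} (hA : A.IsHermitian) {K : ℝ} (hK : 0 ≤ K)
    (h : ∀ i, |hA.eigenvalues i| ≤ K) : ‖A‖ ≤ K := by
  rw [hA.spectral_theorem, Unitary.conjStarAlgAut_apply, ← Unitary.coe_star,
    CStarRing.norm_mul_coe_unitary, CStarRing.norm_coe_unitary_mul, Matrix.l2_opNorm_diagonal]
  exact (pi_norm_le_iff_of_nonneg hK).2 fun i => by simpa using h i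

theorem norm_le_of_posSemidef_le {n : ℕ} {A : Mat n} (hA : A.PosSemidef) {K : ℝ} (hK : 0 ≤ K)
    (h : A ≤ K • 1) : ‖A‖ ≤ K := by
  refine norm_le_of_eigenvalues hA.1 hK fun i => ?_
  rw [abs_of_nonneg (hA.eigenvalues_nonneg i)]
  have h1 := inner_act_le_of_le h (hA.1.eigenvectorBasis i)
  rw [act_eigenvectorBasis, real_inner_smul_right, real_inner_self_eq_norm_sq,
    inner_smul_one_act, (hA.1.eigenvectorBasis).orthonormal.1 i] at h1
  simpa using h1

/-- Square roots preserve lower bounds: an eigenvalue `μ + √c` of `a`, with `-√c ≤ μ < 0`, would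
give the eigenvalue `(μ + √c)² < c` of `a²`. -/
theorem le_inner_act_of_sq {n : ℕ} {a : Mat n} (ha : a.PosSemidef) {c : ℝ} (hc : 0 ≤ c)
    (h : c • (1 : Mat n) ≤ a * a) (z : Vec n) : √c * ‖z‖ ^ 2 ≤ inner ℝ z (act a z) := by
  have hH : (a - √c • (1 : Mat n)).IsHermitian := ha.1.sub (isHermitian_smul_one _)
  have hp : (a - √c • (1 : Mat n)).PosSemidef := by
    rw [hH.posSemidef_iff_eigenvalues_nonneg]
    intro i
    have h1 := act_eigenvectorBasis hH i
    set x := hH.eigenvectorBasis i with hx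
    set μ := hH.eigenvalues i with hμ
    have hxn : ‖x‖ = 1 := (hH.eigenvectorBasis).orthonormal.1 i
    rw [sub_act, smul_one_act, sub_eq_iff_eq_add, ← add_smul] at h1
    have h2 := inner_act_nonneg ha x
    rw [h1, real_inner_smul_right, real_inner_self_eq_norm_sq, hxn] at h2
    have h3 := inner_act_le_of_le h x
    have e : act a ((μ + √c) • x) = (μ + √c) • act a x := (actL n n a).map_smul _ _
    rw [inner_smul_one_act, act_mul, h1, e, h1, real_inner_smul_right, real_inner_smul_right,
      real_inner_self_eq_norm_sq, hxn] at h3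
    by_contra hneg
    have hneg : μ < 0 := not_le.1 hneg
    have h4 : 0 ≤ √c := Real.sqrt_nonneg c
    have h5 : √c * √c = c := Real.mul_self_sqrt hc
    nlinarith
  have := inner_act_nonneg hp z
  rw [sub_act, inner_sub_right, inner_smul_one_act] at this
  linarith

theorem posSemidef_sqrt {n : ℕ} (P : Mat n) : (CFC.sqrt P).PosSemidef :=
  Matrix.nonneg_iff_posSemidef.1 (CFC.sqrt_nonneg P)

theorem sqrt_mul_sqrt {n : ℕ} {P : Mat n} (hP : P.PosSemidef) : CFC.sqrt P * CFC.sqrt P = P :=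
  CFC.sqrt_mul_sqrt_self P hP.nonneg

/-- The square root is Lipschitz around a matrix bounded from below: if `λ` is an eigenvalue of
`D = √P - √Q` with unit eigenvector `x`, then `⟨x, (P - Q) x⟩ = λ ⟨x, (√P + √Q) x⟩`. -/
theorem norm_sqrt_sub_sqrt_le {n : ℕ} {P Q : Mat n} (hP : P.PosSemidef) (hQ : Q.PosSemidef)
    {c : ℝ} (hc : 0 < c) (h : c • (1 : Mat n) ≤ P) :
    ‖CFC.sqrt P - CFC.sqrt Q‖ ≤ ‖P - Q‖ * √(c⁻¹) := by
  set a := CFC.sqrt P with ha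
  set b := CFC.sqrt Q with hb
  have hap : a.PosSemidef := posSemidef_sqrt P
  have hbp : b.PosSemidef := posSemidef_sqrt Q
  have hD : (a - b).IsHermitian := hap.1.sub hbp.1
  refine norm_le_of_eigenvalues hD (by positivity) fun i => ?_
  have h1 := act_eigenvectorBasis hD i
  set x := hD.eigenvectorBasis i with hx
  set μ := hD.eigenvalues i with hμ
  have hxn : ‖x‖ = 1 := (hD.eigenvectorBasis).orthonormal.1 i
  have e1 : P - Q = a * (a - b) + (a - b) * b := by
    rw [← sqrt_mul_sqrt hP, ← sqrt_mul_sqrt hQ, ← ha, ← hb, mul_sub, sub_mul]; abel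
  have e2 : inner ℝ x (act (P - Q) x) = μ * (inner ℝ x (act a x) + inner ℝ x (act b x)) := by
    have e4 : act (P - Q) x = act a (act (a - b) x) + act (a - b) (act b x) := by
      rw [e1, ← act_mul, ← act_mul]; simp only [← actL_apply, map_add, add_apply]
    have e5 : act a (μ • x) = μ • act a x := (actL n n a).map_smul _ _
    rw [e4, inner_add_right, inner_act (a - b), transpose_eq_of_isHermitian hD, h1, e5,
      real_inner_smul_right, real_inner_smul_left]
    ring
  have h2 := le_inner_act_of_sq hap hc.le (by rwa [sqrt_mul_sqrt hP]) x
  have h3 := inner_act_nonneg hbp x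
  have h4 : |inner ℝ x (act (P - Q) x)| ≤ ‖P - Q‖ := by
    refine (abs_real_inner_le_norm _ _).trans ?_
    rw [hxn, one_mul]
    simpa [hxn] using norm_act_le (P - Q) x
  have hsc : 0 < √c := Real.sqrt_pos.2 hc
  rw [hxn, one_pow, mul_one] at h2
  rw [e2, abs_mul, abs_of_nonneg (show 0 ≤ inner ℝ x (act a x) + inner ℝ x (act b x) by linarith)]
    at h4
  rw [Real.sqrt_inv, ← div_eq_mul_inv, le_div_iff₀ hsc]
  exact (mul_le_mul_of_nonneg_left (by linarith) (abs_nonneg _)).trans h4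

theorem abs_apply_le_norm {n : ℕ} (M : Mat n) (i j : Fin n) : |M i j| ≤ ‖M‖ := by
  have h1 : |(act M (EuclideanSpace.single j 1)) i| ≤ ‖act M (EuclideanSpace.single j 1)‖ :=
    PiLp.norm_apply_le (act M (EuclideanSpace.single j (1 : ℝ))) i
  have h2 := h1.trans (norm_act_le M (EuclideanSpace.single j 1))
  simpa [act] using h2

theorem trace_le_norm {n : ℕ} (M : Mat n) : M.trace ≤ n * ‖M‖ := by
  calc M.trace ≤ ∑ _i : Fin n, ‖M‖ :=
        Finset.sum_le_sum fun i _ => (le_abs_self _).trans (abs_apply_le_norm M i i)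
    _ = n * ‖M‖ := by simp

/-! ### Couplings of Gaussian measures -/

/-- The synchronous coupling `(m₁ + √P₁ ξ, m₂ + √P₂ ξ)`, with `ξ` standard Gaussian. -/
theorem wasserstein_gaussian_le {n : ℕ} (k : ℕ) (m₁ m₂ : Vec n) (P₁ P₂ : Mat n) :
    wasserstein k (multivariateGaussian m₁ P₁) (multivariateGaussian m₂ P₂)
      ≤ eLpNorm (fun x => m₁ - m₂ + act (CFC.sqrt P₁ - CFC.sqrt P₂) x) k (stdGaussian (Vec n)) := by
  let f : Vec n → Vec n × Vec n := fun x =>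
    (m₁ + act (CFC.sqrt P₁) x, m₂ + act (CFC.sqrt P₂) x)
  have hact : ∀ M : Mat n, Measurable fun x : Vec n => act M x := fun M =>
    (actL n n M).continuous.measurable
  have hf : Measurable f := ((hact _).const_add _).prodMk ((hact _).const_add _)
  refine (iInf₂_le ((stdGaussian (Vec n)).map f) ⟨?_, ?_⟩).trans ?_
  rotate_left
  · rw [Measure.map_map measurable_fst hf]; rfl
  · rw [Measure.map_map measurable_snd hf]; rfl
  · rw [eLpNorm_map_measure (by fun_prop) hf.aemeasurable]
    refine le_of_eq (congrArg (fun g => eLpNorm g k _) ?_)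
    funext x
    simp only [f, Function.comp_apply, sub_act]
    abel

theorem memLp_affine_stdGaussian {n : ℕ} (k : ℕ) (d : Vec n) (D : Mat n) :
    MemLp (fun x => d + act D x) k (stdGaussian (Vec n)) := by
  have h : MemLp (fun x : Vec n => x) k (stdGaussian (Vec n)) :=
    IsGaussian.memLp_id _ k (by simp)
  exact (memLp_const d).add ((actL n n D).comp_memLp' h)

theorem integral_inner_sq_stdGaussian {n : ℕ} (l : Vec n) :
    ∫ x, (inner ℝ l x) ^ 2 ∂(stdGaussian (Vec n)) = ‖l‖ ^ 2 := by
  have h := variance_dual_stdGaussian (innerSL ℝ l : StrongDual ℝ (Vec n))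
  rw [variance_of_integral_eq_zero (by fun_prop) (integral_strongDual_stdGaussian _)] at h
  simpa using h

theorem integral_norm_affine_sq_stdGaussian {n : ℕ} (d : Vec n) (D : Mat n) :
    ∫ x, ‖d + act D x‖ ^ 2 ∂(stdGaussian (Vec n)) = ‖d‖ ^ 2 + (D * Dᵀ).trace := by
  have hid : MemLp (fun x : Vec n => x) 2 (stdGaussian (Vec n)) :=
    IsGaussian.memLp_id _ 2 (by simp)
  have hin : ∀ l : Vec n, MemLp (fun x => inner ℝ l x) 2 (stdGaussian (Vec n)) := fun l =>
    (innerSL ℝ l).comp_memLp' hid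
  have e : ∀ x, ‖d + act D x‖ ^ 2 = ‖d‖ ^ 2 + 2 * inner ℝ (act Dᵀ d) x
      + ∑ i, (inner ℝ (WithLp.toLp 2 (D i) : Vec n) x) ^ 2 := by
    intro x
    rw [norm_add_sq_real, inner_act, EuclideanSpace.real_norm_sq_eq (act D x)]
    congr 1
    refine Finset.sum_congr rfl fun i _ => ?_
    simp [act, Matrix.mulVec, EuclideanSpace.inner_eq_star_dotProduct, dotProduct_comm]
  simp_rw [e]
  rw [integral_add, integral_add, integral_const, integral_const_mul, integral_finsetSum]
  · have h0 : ∫ x, inner ℝ (act Dᵀ d) x ∂(stdGaussian (Vec n)) = 0 :=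
      integral_strongDual_stdGaussian (innerSL ℝ (act Dᵀ d))
    simp only [h0, integral_inner_sq_stdGaussian, mul_zero, add_zero, probReal_univ, one_smul]
    congr 1
    rw [Matrix.trace]
    refine Finset.sum_congr rfl fun i _ => ?_
    rw [EuclideanSpace.real_norm_sq_eq]
    simp [Matrix.mul_apply, sq]
  · exact fun i _ => (hin _).integrable_sq
  · exact integrable_const _
  · exact ((hin _).integrable (by norm_num)).const_mul 2
  · exact (integrable_const _).add (((hin _).integrable (by norm_num)).const_mul 2)
  · exact integrable_finsetSum _ fun i _ => (hin _).integrable_sq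

theorem toReal_eLpNorm_sq {Ω E : Type*} {mΩ : MeasurableSpace Ω} {μ : Measure Ω}
    [NormedAddCommGroup E] {f : Ω → E} (hf : MemLp f 2 μ) :
    (eLpNorm f 2 μ).toReal ^ 2 = ∫ x, ‖f x‖ ^ 2 ∂μ := by
  rw [hf.eLpNorm_eq_integral_rpow_norm (by norm_num) (by norm_num)]
  have h0 : 0 ≤ ∫ x, ‖f x‖ ^ 2 ∂μ := integral_nonneg fun x => by positivity
  simp only [ENNReal.toReal_ofNat, Real.rpow_ofNat]
  rw [ENNReal.toReal_ofReal (by positivity), ← Real.rpow_natCast, ← Real.rpow_mul h0]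
  norm_num

/-- The trace bound for the quadratic Wasserstein distance, from the coupling
`(m₁ + √P₁ ξ, m₂ + √P₂ ξ)` with `ξ` standard Gaussian. -/
theorem wasserstein_two_gaussian {n : ℕ} (m₁ m₂ : Vec n) {P₁ P₂ : Mat n} (h₁ : P₁.PosSemidef)
    (h₂ : P₂.PosSemidef) {b U : ℝ} (hb : 0 < b) (hU : 0 < U) (hlow : b⁻¹ • (1 : Mat n) ≤ P₂)
    (hup : P₂ ≤ U • 1) :
    wasserstein 2 (multivariateGaussian m₁ P₁) (multivariateGaussian m₂ P₂) ≠ ⊤ ∧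
    (wasserstein 2 (multivariateGaussian m₁ P₁) (multivariateGaussian m₂ P₂)).toReal ^ 2
      ≤ ‖m₁ - m₂‖ ^ 2 + (P₁ - P₂).trace + 4 * n * U * b * ‖P₁ - P₂‖ := by
  have hmem : MemLp (fun x => m₁ - m₂ + act (CFC.sqrt P₁ - CFC.sqrt P₂) x) 2
      (stdGaussian (Vec n)) := by
    exact_mod_cast memLp_affine_stdGaussian 2 (m₁ - m₂) (CFC.sqrt P₁ - CFC.sqrt P₂)
  have hle := wasserstein_gaussian_le 2 m₁ m₂ P₁ P₂
  rw [Nat.cast_ofNat] at hle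
  refine ⟨ne_top_of_le_ne_top hmem.2.ne hle, ?_⟩
  have h3 := ENNReal.toReal_mono hmem.2.ne hle
  refine (pow_le_pow_left₀ ENNReal.toReal_nonneg h3 2).trans ?_
  rw [toReal_eLpNorm_sq hmem, integral_norm_affine_sq_stdGaussian, add_assoc]
  refine add_le_add le_rfl ?_
  set p := CFC.sqrt P₁ with hp
  set q := CFC.sqrt P₂ with hq
  have hps : pᵀ = p := transpose_eq_of_isHermitian (posSemidef_sqrt P₁).1
  have hqs : qᵀ = q := transpose_eq_of_isHermitian (posSemidef_sqrt P₂).1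
  have e : ((p - q) * (p - q)ᵀ).trace = (P₁ - P₂).trace + 2 * ((q - p) * q).trace := by
    rw [Matrix.transpose_sub, hps, hqs, ← sqrt_mul_sqrt h₁, ← sqrt_mul_sqrt h₂, ← hp, ← hq]
    have := Matrix.trace_mul_comm p q
    simp only [sub_mul, mul_sub, Matrix.trace_sub]
    linarith
  rw [e]
  refine add_le_add le_rfl ?_
  rcases Nat.eq_zero_or_pos n with hn | hn
  · subst hn
    simp [Matrix.trace]
  · have hq2 : ‖q‖ ≤ √U := by
      have h4 : ‖q‖ * ‖q‖ = ‖P₂‖ := by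
        rw [← Matrix.l2_opNorm_conjTranspose_mul_self, (posSemidef_sqrt P₂).1.eq, sqrt_mul_sqrt h₂]
      refine Real.le_sqrt_of_sq_le ?_
      rw [sq, h4]
      exact norm_le_of_posSemidef_le h₂ hU.le hup
    have hd : ‖q - p‖ ≤ ‖P₁ - P₂‖ * √b := by
      have := norm_sqrt_sub_sqrt_le h₂ h₁ (inv_pos.2 hb) hlow
      rwa [inv_inv, norm_sub_rev P₂] at this
    -- the bounds `b⁻¹ ≤ P₂ ≤ U` on a nonzero space force `U b ≥ 1`, so that `√(U b) ≤ 2 U b`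
    have hUb : 1 ≤ √U * √b := by
      rw [← Real.sqrt_mul hU.le]
      refine Real.one_le_sqrt.2 ?_
      let z : Vec n := EuclideanSpace.single ⟨0, hn⟩ 1
      have h5 := inner_act_le_of_le (hlow.trans hup) z
      rw [inner_smul_one_act, inner_smul_one_act] at h5
      have hz : ‖z‖ = 1 := by simp [z]
      rw [hz] at h5
      have h6 := mul_le_mul_of_nonneg_right h5 hb.le
      rw [one_pow, mul_one, mul_one, inv_mul_cancel₀ hb.ne'] at h6
      exact h6
    have hUb2 : U * b = (√U * √b) * (√U * √b) := by
      rw [mul_mul_mul_comm, Real.mul_self_sqrt hU.le, Real.mul_self_sqrt hb.le]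
    calc 2 * ((q - p) * q).trace ≤ 2 * (n * ((‖P₁ - P₂‖ * √b) * √U)) := by
          gcongr
          refine (trace_le_norm _).trans ?_
          gcongr
          exact (norm_mul_le _ _).trans (by gcongr)
      _ = 2 * n * ‖P₁ - P₂‖ * (√U * √b) := by ring
      _ ≤ 2 * n * ‖P₁ - P₂‖ * (2 * ((√U * √b) * (√U * √b))) := by
          refine mul_le_mul_of_nonneg_left ?_ (by positivity)
          nlinarith
      _ = 4 * n * U * b * ‖P₁ - P₂‖ := by rw [mul_assoc (4 * (n : ℝ)), hUb2]; ring

/-- Even moments of the standard Gaussian law, from `y ^ k ≤ (k / (c e)) ^ k e ^ (c y)` with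
`c = 3 / 8`, for which `E e ^ (c ξ²) = 2`. -/
theorem integral_pow_gaussianReal_le (k : ℕ) (hk : 1 ≤ k) :
    ∫ x, (x ^ 2) ^ k ∂(gaussianReal 0 1) ≤ (k / 2 : ℝ) ^ k * Real.exp (k + 3 / 2) := by
  have hkpos : (0 : ℝ) < k := by exact_mod_cast hk
  have hexp : ∫ x, Real.exp (3 / 8 * x ^ 2) ∂(gaussianReal 0 1) = 2 := by
    rw [integral_gaussianReal_eq_integral_smul one_ne_zero]
    have : ∀ x : ℝ, gaussianPDFReal 0 1 x • Real.exp (3 / 8 * x ^ 2)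
        = (√(2 * Real.pi))⁻¹ * Real.exp (-(1 / 8) * x ^ 2) := by
      intro x
      rw [gaussianPDFReal, smul_eq_mul, mul_assoc, ← Real.exp_add]
      simp only [NNReal.coe_one, mul_one, sub_zero]
      congr 2
      ring
    simp_rw [this]
    rw [integral_const_mul, integral_gaussian,
      show Real.pi / (1 / 8) = 2 ^ 2 * (2 * Real.pi) by ring,
      Real.sqrt_mul (show (0 : ℝ) ≤ 2 ^ 2 by norm_num), Real.sqrt_sq (by norm_num)]
    have : √(2 * Real.pi) ≠ 0 := by positivity
    field_simp
  have hint : Integrable (fun x : ℝ => Real.exp (3 / 8 * x ^ 2)) (gaussianReal 0 1) := by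
    by_contra h
    rw [integral_undef h] at hexp
    norm_num at hexp
  have hpt : ∀ x : ℝ, (x ^ 2) ^ k
      ≤ (8 * k / 3 * Real.exp (-1)) ^ k * Real.exp (3 / 8 * x ^ 2) := by
    intro x
    have h1 : 3 / 8 * x ^ 2 / k ≤ Real.exp (3 / 8 * x ^ 2 / k - 1) := by
      have := Real.add_one_le_exp (3 / 8 * x ^ 2 / k - 1)
      linarith
    have h2 := pow_le_pow_left₀ (by positivity) h1 k
    rw [← Real.exp_nat_mul, mul_sub, mul_one, mul_div_cancel₀ _ hkpos.ne', sub_eq_neg_add,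
      Real.exp_add] at h2
    have h3 : (x ^ 2) ^ k = (8 * k / 3) ^ k * (3 / 8 * x ^ 2 / k) ^ k := by
      rw [← mul_pow]; congr 1; field_simp
    rw [h3, mul_pow, mul_assoc, ← Real.exp_nat_mul, mul_neg_one]
    gcongr
  calc ∫ x, (x ^ 2) ^ k ∂(gaussianReal 0 1)
      ≤ ∫ x, (8 * k / 3 * Real.exp (-1)) ^ k * Real.exp (3 / 8 * x ^ 2) ∂(gaussianReal 0 1) := by
        refine integral_mono_of_nonneg (Eventually.of_forall fun x => by positivity)
          (hint.const_mul _) (Eventually.of_forall hpt)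
    _ = (8 * k / 3 * Real.exp (-1)) ^ k * 2 := by rw [integral_const_mul, hexp]
    _ ≤ (k / 2 * Real.exp 1) ^ k * Real.exp (3 / 2) := by
        have he := Real.exp_one_gt_d9
        have e1 : Real.exp (-1) * Real.exp 1 = 1 := by rw [← Real.exp_add]; simp
        refine mul_le_mul (pow_le_pow_left₀ (by positivity) ?_ k) ?_ (by norm_num) (by positivity)
        · have h4 : 16 / 3 * Real.exp (-1) ≤ Real.exp 1 := by
            have : Real.exp (-1) ≤ 2 / 5 := by nlinarith [Real.exp_pos (-1)]
            linarith
          nlinarith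
        · have := Real.add_one_le_exp (3 / 2 : ℝ)
          linarith
    _ = (k / 2 : ℝ) ^ k * Real.exp (k + 3 / 2) := by
        rw [mul_pow, ← Real.exp_nat_mul, mul_one, mul_assoc, ← Real.exp_add]

/-- Even moments of the norm, from the one-dimensional ones by the power mean inequality. -/
theorem integral_norm_pow_stdGaussian_le {n : ℕ} (k : ℕ) (hk : 1 ≤ k) :
    ∫ x, ‖x‖ ^ (2 * k) ∂(stdGaussian (Vec n))
      ≤ (n : ℝ) ^ k * ((k / 2 : ℝ) ^ k * Real.exp (k + 3 / 2)) := by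
  obtain ⟨j, rfl⟩ := Nat.exists_eq_add_of_le' hk
  have hcoord : ∀ i : Fin n, MeasurePreserving (fun x : Vec n => x i) (stdGaussian (Vec n))
      (gaussianReal 0 1) := by
    intro i
    have := measurePreserving_eval_multivariateGaussian (μ := (0 : Vec n)) (S := (1 : Mat n))
      Matrix.PosSemidef.one (i := i)
    rw [multivariateGaussian_zero_one] at this
    simpa using this
  have hint1 : Integrable (fun x : ℝ => (x ^ 2) ^ (j + 1)) (gaussianReal 0 1) := by
    have h : MemLp (id : ℝ → ℝ) (2 * (j + 1) : ℕ) (gaussianReal 0 1) :=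
      IsGaussian.memLp_id _ _ (by finiteness)
    have := h.integrable_norm_pow (by omega)
    refine this.congr (Eventually.of_forall fun x => ?_)
    simp only [id, Real.norm_eq_abs, pow_mul, sq_abs]
  have hint : ∀ i : Fin n, Integrable (fun x : Vec n => ((x i) ^ 2) ^ (j + 1))
      (stdGaussian (Vec n)) := fun i => (hcoord i).integrable_comp_of_integrable hint1
  have hval : ∀ i : Fin n, ∫ x, ((x i) ^ 2) ^ (j + 1) ∂(stdGaussian (Vec n))
      = ∫ x, (x ^ 2) ^ (j + 1) ∂(gaussianReal 0 1) := by
    intro i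
    rw [← (hcoord i).map_eq, integral_map (hcoord i).measurable.aemeasurable (by fun_prop)]
  rcases Nat.eq_zero_or_pos n with hn | hn
  · subst hn
    have : ∀ x : Vec 0, ‖x‖ ^ (2 * (j + 1)) = 0 := fun x => by
      rw [Subsingleton.elim x 0]; simp
    simp [this]
  have hnpos : (0 : ℝ) < n := by exact_mod_cast hn
  calc ∫ x, ‖x‖ ^ (2 * (j + 1)) ∂(stdGaussian (Vec n))
      ≤ ∫ x, (n : ℝ) ^ j * ∑ i, ((x i) ^ 2) ^ (j + 1) ∂(stdGaussian (Vec n)) := by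
        refine integral_mono_of_nonneg (Eventually.of_forall fun x => by positivity)
          ((integrable_finsetSum _ fun i _ => hint i).const_mul _)
          (Eventually.of_forall fun x => ?_)
        have h := pow_sum_div_card_le_sum_pow (s := Finset.univ) (f := fun i => (x i) ^ 2)
          (fun i _ => sq_nonneg _) j
        rw [Finset.card_univ, Fintype.card_fin, div_le_iff₀' (by positivity)] at h
        simp only [pow_mul, EuclideanSpace.real_norm_sq_eq]
        exact h
    _ = (n : ℝ) ^ (j + 1) * ∫ x, (x ^ 2) ^ (j + 1) ∂(gaussianReal 0 1) := by
        rw [integral_const_mul, integral_finsetSum _ fun i _ => hint i]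
        simp only [hval, Finset.sum_const, Finset.card_univ, Fintype.card_fin, nsmul_eq_mul]
        ring
    _ ≤ _ := by
        gcongr
        exact integral_pow_gaussianReal_le _ hk

/-- The bound for Wasserstein distances of even order, from the synchronous coupling, Minkowski's
inequality and the Lipschitz estimate of the square root. -/
theorem wasserstein_even_gaussian {n : ℕ} (k : ℕ) (hk : 1 ≤ k) (m₁ m₂ : Vec n) {P₁ P₂ : Mat n}
    (h₁ : P₁.PosSemidef) (h₂ : P₂.PosSemidef) {b : ℝ} (hb : 0 < b)
    (hlow : b⁻¹ • (1 : Mat n) ≤ P₁) :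
    wasserstein (2 * k) (multivariateGaussian m₁ P₁) (multivariateGaussian m₂ P₂) ≠ ⊤ ∧
    (wasserstein (2 * k) (multivariateGaussian m₁ P₁) (multivariateGaussian m₂ P₂)).toReal
      ≤ ‖m₁ - m₂‖ + √(n * k / 2) * √b * ‖P₁ - P₂‖ * Real.exp (1 / 2 + 3 / (4 * k)) := by
  have hkpos : (0 : ℝ) < k := by exact_mod_cast hk
  have hle := wasserstein_gaussian_le (2 * k) m₁ m₂ P₁ P₂
  set D := CFC.sqrt P₁ - CFC.sqrt P₂ with hD
  have hid : MemLp (fun x : Vec n => x) (2 * k : ℕ) (stdGaussian (Vec n)) :=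
    IsGaussian.memLp_id _ _ (by finiteness)
  have hmem := memLp_affine_stdGaussian (2 * k) (m₁ - m₂) D
  refine ⟨ne_top_of_le_ne_top hmem.2.ne hle, ?_⟩
  have hp1 : (1 : ℝ≥0∞) ≤ (2 * k : ℕ) := by exact_mod_cast (by omega : 1 ≤ 2 * k)
  have hDmem : MemLp (fun x : Vec n => act D x) (2 * k : ℕ) (stdGaussian (Vec n)) :=
    (actL n n D).comp_memLp' hid
  have hmom : (eLpNorm (fun x : Vec n => x) (2 * k : ℕ) (stdGaussian (Vec n))).toReal
      ≤ √(n * k / 2) * Real.exp (1 / 2 + 3 / (4 * k)) := by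
    rw [hid.eLpNorm_eq_integral_rpow_norm (by positivity) (by finiteness),
      ENNReal.toReal_ofReal (by positivity)]
    simp only [ENNReal.toReal_natCast, Real.rpow_natCast]
    refine (Real.rpow_le_rpow (integral_nonneg fun x => by positivity)
      (integral_norm_pow_stdGaussian_le k hk) (by positivity)).trans (le_of_eq ?_)
    rw [← mul_assoc, ← mul_pow, Real.mul_rpow (by positivity) (by positivity), ← Real.exp_mul,
      Real.sqrt_eq_rpow, ← Real.rpow_natCast, ← Real.rpow_mul (by positivity)]
    push_cast
    congr 2
    · ring
    · field_simp
    · field_simp; ring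
  have hfin : eLpNorm (fun _ : Vec n => m₁ - m₂) (2 * k : ℕ) (stdGaussian (Vec n)) ≠ ⊤ :=
    (memLp_const _).2.ne
  calc (wasserstein (2 * k) (multivariateGaussian m₁ P₁) (multivariateGaussian m₂ P₂)).toReal
      ≤ (eLpNorm (fun _ : Vec n => m₁ - m₂) (2 * k : ℕ) (stdGaussian (Vec n))
          + eLpNorm (fun x : Vec n => act D x) (2 * k : ℕ) (stdGaussian (Vec n))).toReal := by
        refine ENNReal.toReal_mono (ENNReal.add_ne_top.2 ⟨hfin, hDmem.2.ne⟩) (hle.trans ?_)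
        exact eLpNorm_add_le (by fun_prop) hDmem.1 hp1
    _ = ‖m₁ - m₂‖
        + (eLpNorm (fun x : Vec n => act D x) (2 * k : ℕ) (stdGaussian (Vec n))).toReal := by
        rw [ENNReal.toReal_add hfin hDmem.2.ne, eLpNorm_const _ (by positivity) (NeZero.ne _)]
        simp
    _ ≤ ‖m₁ - m₂‖ + ‖P₁ - P₂‖ * √b * (√(n * k / 2) * Real.exp (1 / 2 + 3 / (4 * k))) := by
        gcongr
        have h3 : eLpNorm (fun x : Vec n => act D x) (2 * k : ℕ) (stdGaussian (Vec n))
            ≤ ENNReal.ofReal ‖D‖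
              * eLpNorm (fun x : Vec n => x) (2 * k : ℕ) (stdGaussian (Vec n)) :=
          eLpNorm_le_mul_eLpNorm_of_ae_le_mul (Eventually.of_forall fun x => norm_act_le D x) _
        have h4 := ENNReal.toReal_mono (ENNReal.mul_ne_top ENNReal.ofReal_ne_top hid.2.ne) h3
        rw [ENNReal.toReal_mul, ENNReal.toReal_ofReal (norm_nonneg _)] at h4
        refine h4.trans ?_
        have h5 := norm_sqrt_sub_sqrt_le h₁ h₂ (inv_pos.2 hb) hlow
        rw [inv_inv] at h5
        gcongr
    _ = _ := by ring

/-! ### Gramians and uniform Riccati bounds -/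

theorem add_act {m n : ℕ} (M N : Matrix (Fin m) (Fin n) ℝ) (z : Vec n) :
    act (M + N) z = act M z + act N z := by
  simp [← actL_apply]

/-- Transposition as a continuous linear map. -/
def transposeL (m n : ℕ) :
    Matrix (Fin m) (Fin n) ℝ →L[ℝ] Matrix (Fin n) (Fin m) ℝ :=
  LinearMap.toContinuousLinearMap (Matrix.transposeLinearEquiv (Fin m) (Fin n) ℝ ℝ).toLinearMap

/-- The quadratic form of a matrix at a vector, as a linear functional of the matrix. -/
def quadL {n : ℕ} (z : Vec n) : Mat n →L[ℝ] ℝ := (innerSL ℝ z).comp ((actL n n).flip z)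

theorem quadL_apply {n : ℕ} (z : Vec n) (M : Mat n) : quadL z M = inner ℝ z (act M z) := rfl

theorem continuous_exp_smul {n : ℕ} (A : Mat n) {f : ℝ → ℝ} (hf : Continuous f) :
    Continuous fun u => NormedSpace.exp (f u • A) :=
  (continuous_iff_continuousAt.2 fun u =>
    (hasDerivAt_exp_smul_const (𝕂 := ℝ) A u).continuousAt).comp hf

theorem hasDerivAt_exp_neg_smul {n : ℕ} (A : Mat n) (u : ℝ) :
    HasDerivAt (fun u : ℝ => NormedSpace.exp (-u • A)) (-(NormedSpace.exp (-u • A) * A)) u := by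
  have h := (hasDerivAt_exp_smul_const (𝕂 := ℝ) A (-u)).scomp u (hasDerivAt_neg u)
  simpa [Function.comp_def] using h

theorem hasDerivAt_exp_neg_smul' {n : ℕ} (A : Mat n) (u : ℝ) :
    HasDerivAt (fun u : ℝ => NormedSpace.exp (-u • A)) (-(A * NormedSpace.exp (-u • A))) u := by
  have h := (hasDerivAt_exp_smul_const' (𝕂 := ℝ) A (-u)).scomp u (hasDerivAt_neg u)
  simpa [Function.comp_def] using h

theorem continuous_obsIntegrand {n : ℕ} (A S : Mat n) :
    Continuous fun u : ℝ => NormedSpace.exp (-u • Aᵀ) * S * NormedSpace.exp (-u • A) :=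
  ((continuous_exp_smul _ continuous_neg).mul continuous_const).mul
    (continuous_exp_smul _ continuous_neg)

theorem obsGramian_zero {n : ℕ} (A S : Mat n) : obsGramian A S 0 = 0 := by
  simp [obsGramian]

/-- The integrand of the Gramian is expressed by the Lyapunov equation. -/
theorem obsIntegrand_eq {n : ℕ} (A S : Mat n) (t : ℝ) :
    NormedSpace.exp (-t • Aᵀ) * S * NormedSpace.exp (-t • A)
      = S - Aᵀ * obsGramian A S t - obsGramian A S t * A := by
  have hd : ∀ u, HasDerivAt
      (fun u : ℝ => NormedSpace.exp (-u • Aᵀ) * S * NormedSpace.exp (-u • A))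
      (-(Aᵀ * (NormedSpace.exp (-u • Aᵀ) * S * NormedSpace.exp (-u • A)))
        - (NormedSpace.exp (-u • Aᵀ) * S * NormedSpace.exp (-u • A)) * A) u := by
    intro u
    refine (((hasDerivAt_exp_neg_smul' Aᵀ u).mul_const S).mul
      (hasDerivAt_exp_neg_smul A u)).congr_deriv ?_
    simp only [mul_neg, neg_mul, mul_assoc, sub_eq_add_neg]
  have hc := continuous_obsIntegrand A S
  have h := intervalIntegral.integral_eq_sub_of_hasDerivAt (fun u _ => hd u)
    ((((continuous_const.mul hc).neg).sub (hc.mul continuous_const)).intervalIntegrable 0 t)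
  have e1 : ∫ u in (0 : ℝ)..t, Aᵀ * (NormedSpace.exp (-u • Aᵀ) * S * NormedSpace.exp (-u • A))
      = Aᵀ * obsGramian A S t :=
    (ContinuousLinearMap.mul ℝ (Mat n) Aᵀ).intervalIntegral_comp_comm (hc.intervalIntegrable 0 t)
  have e2 : ∫ u in (0 : ℝ)..t, (NormedSpace.exp (-u • Aᵀ) * S * NormedSpace.exp (-u • A)) * A
      = obsGramian A S t * A :=
    ((ContinuousLinearMap.mul ℝ (Mat n)).flip A).intervalIntegral_comp_comm
      (hc.intervalIntegrable 0 t)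
  have c1 : Continuous fun u : ℝ =>
      -(Aᵀ * (NormedSpace.exp (-u • Aᵀ) * S * NormedSpace.exp (-u • A))) :=
    (continuous_const.mul hc).neg
  have c2 : Continuous fun u : ℝ =>
      (NormedSpace.exp (-u • Aᵀ) * S * NormedSpace.exp (-u • A)) * A := hc.mul continuous_const
  rw [intervalIntegral.integral_sub (c1.intervalIntegrable _ _) (c2.intervalIntegrable _ _),
    intervalIntegral.integral_neg, e1, e2] at h
  simp only [neg_zero, zero_smul, NormedSpace.exp_zero, one_mul, mul_one] at h
  rw [eq_sub_iff_add_eq] at h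
  rw [← h]
  abel

theorem hasDerivAt_obsGramian {n : ℕ} (A S : Mat n) (t : ℝ) :
    HasDerivAt (obsGramian A S) (S - Aᵀ * obsGramian A S t - obsGramian A S t * A) t := by
  have hc := continuous_obsIntegrand A S
  rw [← obsIntegrand_eq]
  exact intervalIntegral.integral_hasDerivAt_right (hc.intervalIntegrable _ _)
    (hc.stronglyMeasurableAtFilter _ _) hc.continuousAt

theorem transpose_obsGramian {n : ℕ} (A : Mat n) {S : Mat n} (hS : Sᵀ = S) (t : ℝ) :
    (obsGramian A S t)ᵀ = obsGramian A S t := by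
  have h : ∫ u in (0 : ℝ)..t, (NormedSpace.exp (-u • Aᵀ) * S * NormedSpace.exp (-u • A))ᵀ
      = (∫ u in (0 : ℝ)..t, NormedSpace.exp (-u • Aᵀ) * S * NormedSpace.exp (-u • A))ᵀ :=
    (transposeL n n).intervalIntegral_comp_comm
      ((continuous_obsIntegrand A S).intervalIntegrable 0 t)
  rw [obsGramian, ← h]
  refine intervalIntegral.integral_congr fun u _ => ?_
  simp only [Matrix.transpose_mul, hS, ← Matrix.exp_transpose, Matrix.transpose_smul,
    Matrix.transpose_transpose, mul_assoc]

/-- Upper bound for solutions of the Riccati equation, by comparison with the suboptimal estimator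
associated with the observability Gramian: with `w_u = e^{-(v-u)A} O_v⁻¹ z` and `q_u = O_u w_u` the
function `⟨q, P q⟩ - ⟨w, O w⟩` has derivative `⟨q, R q⟩ - ⟨w - P q, S (w - P q)⟩`, and `q` runs
from `0` to `z`. -/
theorem riccati_upper {n : ℕ} {A R S : Mat n} (hS : S.PosSemidef) {v : ℝ} (hv : 0 ≤ v)
    (hO : IsUnit (obsGramian A S v).det) {P : ℝ → Mat n} (hPs : ∀ u, (P u)ᵀ = P u)
    (hPc : ContinuousOn P (Set.Icc 0 v))
    (hP : ∀ u ∈ Set.Ioo 0 v,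
      HasDerivAt P (A * P u + P u * Aᵀ - P u * S * P u + R) u) (z : Vec n) :
    inner ℝ z (act (P v) z)
      ≤ inner ℝ z (act (ctrOfObs A R S v) z) + inner ℝ z (act (obsGramian A S v)⁻¹ z) := by
  have hSt : Sᵀ = S := transpose_eq_of_isHermitian hS.1
  have hOt := transpose_obsGramian A hSt
  set O := obsGramian A S with hOdef
  set y := act (O v)⁻¹ z with hy
  let E : ℝ → Mat n := fun u => NormedSpace.exp (-(v - u) • A)
  have hE : ∀ u, HasDerivAt E (A * E u) u := fun u => by
    have := (hasDerivAt_exp_smul_const' (𝕂 := ℝ) A (-(v - u))).scomp u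
      (((hasDerivAt_id u).const_sub v).neg)
    simpa [E, Function.comp_def] using this
  let w : ℝ → Vec n := fun u => act (E u) y
  let q : ℝ → Vec n := fun u => act (O u) (w u)
  have hact : ∀ {M : ℝ → Mat n} {M' : Mat n} {f : ℝ → Vec n} {f' : Vec n} {u : ℝ},
      HasDerivAt M M' u → HasDerivAt f f' u →
      HasDerivAt (fun u => act (M u) (f u)) (act M' (f u) + act (M u) f') u :=
    fun hM hf => ((actL n n).hasFDerivAt.comp_hasDerivAt _ hM).clm_apply hf
  have hw : ∀ u, HasDerivAt w (act A (w u)) u := fun u => by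
    refine (hact (hE u) (hasDerivAt_const u y)).congr_deriv ?_
    rw [act_mul, show act (E u) (0 : Vec n) = 0 from (actL n n (E u)).map_zero, add_zero]
  have hq : ∀ u, HasDerivAt q (act S (w u) - act Aᵀ (q u)) u := fun u => by
    refine (hact (hasDerivAt_obsGramian A S u) (hw u)).congr_deriv ?_
    rw [sub_act, sub_act, act_mul, act_mul]
    simp only [q]
    abel
  have hwc : Continuous w := continuous_iff_continuousAt.2 fun u => (hw u).continuousAt
  have hqc : Continuous q := continuous_iff_continuousAt.2 fun u => (hq u).continuousAt
  have hOc : Continuous O := continuous_iff_continuousAt.2 fun u =>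
    (hasDerivAt_obsGramian A S u).continuousAt
  have hq0 : q 0 = 0 := by
    simp only [q, hOdef, obsGramian_zero]
    exact congrFun (congrArg DFunLike.coe (actL n n).map_zero) (w 0)
  have hwv : w v = y := by simp [w, E, one_act]
  have hqv : q v = z := by
    simp only [q, hwv, hy]
    rw [← act_mul, Matrix.mul_nonsing_inv _ hO, one_act]
  let f : ℝ → ℝ := fun u => inner ℝ (q u) (act (P u) (q u)) - inner ℝ (w u) (act (O u) (w u))
  have key := intervalIntegral.sub_le_integral_of_hasDeriv_right_of_le (g := f)
    (g' := fun u => inner ℝ (q u) (act R (q u))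
      - inner ℝ (w u - act (P u) (q u)) (act S (w u - act (P u) (q u))))
    (φ := fun u => inner ℝ (q u) (act R (q u))) hv ?_ ?_ ?_ ?_
  · have e1 : ∫ u in (0 : ℝ)..v, inner ℝ (q u) (act R (q u))
        = inner ℝ z (act (ctrOfObs A R S v) z) := by
      have hEt : ∀ u, NormedSpace.exp (-(v - u) • Aᵀ) = (E u)ᵀ := fun u => by
        simp only [E]
        rw [← Matrix.exp_transpose, Matrix.transpose_smul]
      have hcI : Continuous fun u => (E u)ᵀ * O u * R * O u * E u := by
        have hEc : Continuous E := continuous_iff_continuousAt.2 fun u => (hE u).continuousAt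
        have hEtc : Continuous fun u => (E u)ᵀ := (transposeL n n).continuous.comp hEc
        exact (((hEtc.mul hOc).mul continuous_const).mul hOc).mul hEc
      have h1 : ∫ u in (0 : ℝ)..v, quadL y ((E u)ᵀ * O u * R * O u * E u)
          = quadL y (∫ u in (0 : ℝ)..v, (E u)ᵀ * O u * R * O u * E u) :=
        (quadL y).intervalIntegral_comp_comm (hcI.intervalIntegrable 0 v)
      have h2 : ctrOfObs A R S v
          = (O v)⁻¹ * (∫ u in (0 : ℝ)..v, (E u)ᵀ * O u * R * O u * E u) * (O v)⁻¹ := by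
        simp only [ctrOfObs, ← hOdef, hEt, E]
      rw [h2, act_mul, act_mul, inner_act, Matrix.transpose_nonsing_inv, hOt, ← hy,
        ← quadL_apply, ← h1]
      refine intervalIntegral.integral_congr fun u _ => ?_
      simp only [quadL_apply, act_mul, q, w]
      rw [inner_act (E u)ᵀ, Matrix.transpose_transpose, inner_act (O u), hOt]
    rw [e1] at key
    have hfv : f v = inner ℝ z (act (P v) z) - inner ℝ z y := by
      simp only [f, hqv, hwv]
      congr 1
      have : act (O v) y = z := by rw [← hqv]; simp only [q, hwv]
      rw [this, real_inner_comm]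
    have hf0 : f 0 = 0 := by
      have h0 : act (O 0) (w 0) = 0 := hq0
      simp only [f, hq0, h0, inner_zero_left, inner_zero_right, sub_zero]
    rw [hfv, hf0] at key
    linarith
  · have h1 : ContinuousOn (fun u => act (P u) (q u)) (Set.Icc 0 v) :=
      ((actL n n).continuous.comp_continuousOn hPc).clm_apply hqc.continuousOn
    have h2 : Continuous fun u => act (O u) (w u) := hqc
    exact (hqc.continuousOn.inner h1).sub (hwc.inner h2).continuousOn
  · intro u hu
    have h1 := (hq u).inner ℝ (hact (hP u hu) (hq u))
    have h2 := (hw u).inner ℝ (hq u)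
    refine ((h1.sub h2).congr_deriv ?_).hasDerivWithinAt
    set W := w u with hW
    set p := act (P u) (q u) with hp
    have a1 : act (A * P u + P u * Aᵀ - P u * S * P u + R) (q u)
        = act A p + act (P u) (act Aᵀ (q u)) - act (P u) (act S p) + act R (q u) := by
      rw [add_act, sub_act, add_act]
      simp only [act_mul, ← hp]
    have a2 : ∀ l : Vec n, inner ℝ (q u) (act (P u) l) = inner ℝ p l := fun l => by
      rw [inner_act, hPs, ← hp]
    have a3 : q u = act (O u) W := rfl
    have a4 : ∀ k l : Vec n, inner ℝ (act S k) l = inner ℝ k (act S l) := fun k l => by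
      rw [inner_act, hSt]
    rw [a1]
    simp only [act_sub, inner_add_right, inner_sub_right, inner_sub_left, a2,
      inner_act A, a4]
    have b1 : inner ℝ W (act Aᵀ (q u)) = inner ℝ (act A W) (q u) := by
      rw [inner_act, Matrix.transpose_transpose]
    rw [b1, real_inner_comm p (act Aᵀ (q u))]
    ring
  · have : Continuous fun u => act R (q u) := (actL n n R).continuous.comp hqc
    exact ((hqc.inner this).continuousOn).integrableOn_Icc
  · intro u _
    have := inner_act_nonneg hS (w u - act (P u) (q u))
    linarith

theorem Model.transpose_S {r r' : ℕ} (m : Model r r') : m.Sᵀ = m.S := by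
  have h : (m.Sig⁻¹)ᵀ = m.Sig⁻¹ := by
    rw [Matrix.transpose_nonsing_inv, transpose_eq_of_isHermitian m.posDef_Sig.1]
  simp only [Model.S, Matrix.transpose_mul, h, Matrix.transpose_transpose, Matrix.mul_assoc]

theorem Model.posSemidef_S {r r' : ℕ} (m : Model r r') : m.S.PosSemidef := by
  simpa [Model.S] using m.posDef_Sig.inv.posSemidef.conjTranspose_mul_mul_same m.C

theorem posDef_of_smul_one_le {n : ℕ} {O : Mat n} {c : ℝ} (hc : 0 < c)
    (h : c • (1 : Mat n) ≤ O) : O.PosDef := by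
  have h1 : (c • (1 : Mat n)).PosDef := Matrix.PosDef.one.smul hc
  simpa using h1.add_posSemidef (Matrix.le_iff.1 h)

theorem inner_act_inv_le {n : ℕ} {O : Mat n} {c : ℝ} (hc : 0 < c) (h : c • (1 : Mat n) ≤ O)
    (z : Vec n) : inner ℝ z (act O⁻¹ z) ≤ 1 / c * ‖z‖ ^ 2 := by
  have hO : IsUnit O.det := (posDef_of_smul_one_le hc h).det_pos.ne'.isUnit
  set y := act O⁻¹ z with hy
  have hz : act O y = z := by rw [hy, ← act_mul, Matrix.mul_nonsing_inv _ hO, one_act]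
  have h1 : c * ‖y‖ ^ 2 ≤ inner ℝ z y := by
    have := inner_act_le_of_le h y
    rwa [inner_smul_one_act, hz, real_inner_comm] at this
  have h2 : inner ℝ z y ≤ ‖z‖ * ‖y‖ := real_inner_le_norm _ _
  have h3 : c * ‖y‖ ≤ ‖z‖ := by
    rcases (norm_nonneg y).eq_or_lt with h0 | h0
    · simp [← h0]
    · nlinarith
  have h4 : ‖y‖ ≤ 1 / c * ‖z‖ := by
    rw [one_div, inv_mul_eq_div, le_div_iff₀ hc]; linarith
  calc _ ≤ ‖z‖ * ‖y‖ := h2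
    _ ≤ ‖z‖ * (1 / c * ‖z‖) := mul_le_mul_of_nonneg_left h4 (norm_nonneg _)
    _ = _ := by ring

/-- The upper bound of the Riccati equation in terms of the Gramian parameters, over any time
interval of length `v`. -/
theorem riccati_le {n : ℕ} {A R S : Mat n} (hS : S.PosSemidef) {a v c U : ℝ} (hv : 0 ≤ v)
    (hc : 0 < c) (hO : c • (1 : Mat n) ≤ obsGramian A S v)
    (hU : ctrOfObs A R S v ≤ U • (1 : Mat n)) {P : ℝ → Mat n} (hPs : ∀ u, (P u)ᵀ = P u)
    (hPc : ContinuousOn P (Set.Icc a (a + v)))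
    (hP : ∀ u ∈ Set.Ioo a (a + v),
      HasDerivAt P (A * P u + P u * Aᵀ - P u * S * P u + R) u) (z : Vec n) :
    inner ℝ z (act (P (a + v)) z) ≤ (U + 1 / c) * ‖z‖ ^ 2 := by
  have h := riccati_upper (R := R) hS hv (posDef_of_smul_one_le hc hO).det_pos.ne'.isUnit
    (P := fun u => P (a + u)) (fun u => hPs _)
    (hPc.comp (by fun_prop) fun u hu => ⟨by linarith [hu.1], by linarith [hu.2]⟩)
    (fun u hu => (hP (a + u) ⟨by linarith [hu.1], by linarith [hu.2]⟩).comp_const_add a u) z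
  have h1 := inner_act_le_of_le hU z
  rw [inner_smul_one_act] at h1
  have h2 := inner_act_inv_le hc hO z
  linarith

/-- A positive semidefinite solution becomes positive definite immediately: a null vector `z` of
`P τ` would make `⟨z, P z⟩` minimal at `τ`, although its derivative there is `⟨z, R z⟩ > 0`. -/
theorem posDef_of_riccati {n : ℕ} {A R S : Mat n} (hR : R.PosDef) {P : ℝ → Mat n} {τ : ℝ}
    (hPs : ∀ u, (P u).PosSemidef)
    (hP : HasDerivAt P (A * P τ + P τ * Aᵀ - P τ * S * P τ + R) τ) : (P τ).PosDef := by
  refine Matrix.PosDef.of_dotProduct_mulVec_pos (hPs τ).1 fun x hx => ?_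
  refine lt_of_le_of_ne ((hPs τ).dotProduct_mulVec_nonneg x) fun h0 => ?_
  have hz : P τ *ᵥ x = 0 := ((hPs τ).dotProduct_mulVec_zero_iff x).1 h0.symm
  set z : Vec n := WithLp.toLp 2 x with hzdef
  have hz' : act (P τ) z = 0 := by
    rw [act, hzdef]; simp [hz]
  have hd : HasDerivAt (fun u => quadL z (P u))
      (quadL z (A * P τ + P τ * Aᵀ - P τ * S * P τ + R)) τ :=
    (quadL z).hasFDerivAt.comp_hasDerivAt _ hP
  have hmin : IsLocalMin (fun u => quadL z (P u)) τ := by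
    refine Filter.Eventually.of_forall fun u => ?_
    simp only [quadL_apply, hz', inner_zero_right]
    exact inner_act_nonneg (hPs u) z
  have h1 := hmin.hasDerivAt_eq_zero hd
  have hst : (P τ)ᵀ = P τ := transpose_eq_of_isHermitian (hPs τ).1
  have hA0 : act A (0 : Vec n) = 0 := (actL n n A).map_zero
  rw [quadL_apply, add_act, sub_act, add_act, act_mul, act_mul, act_mul, hz', hA0,
    show act (P τ * S) (0 : Vec n) = 0 from (actL n n _).map_zero] at h1
  simp only [zero_add, sub_zero, inner_add_right, inner_act (P τ), hst, hz', inner_zero_left] at h1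
  rw [inner_act_eq_dotProduct] at h1
  have h2 := hR.dotProduct_mulVec_pos hx
  simp only [hzdef, star_trivial] at h1 h2
  linarith

/-- The inverse of a solution solves the Riccati equation of the dual system, in which `A` becomes
`-A'` and the roles of `R` and `S` are exchanged. -/
theorem hasDerivAt_inv_riccati {n : ℕ} {A R S : Mat n} {P : ℝ → Mat n} {τ : ℝ}
    (hPd : IsUnit (P τ).det)
    (hP : HasDerivAt P (A * P τ + P τ * Aᵀ - P τ * S * P τ + R) τ) :
    HasDerivAt (fun u => (P u)⁻¹) ((-Aᵀ) * (P τ)⁻¹ + (P τ)⁻¹ * (-Aᵀ)ᵀ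
      - (P τ)⁻¹ * R * (P τ)⁻¹ + S) τ := by
  have hu : IsUnit (P τ) := (Matrix.isUnit_iff_isUnit_det _).2 hPd
  obtain ⟨x, hx⟩ := hu
  have h1 := hasFDerivAt_ringInverse (𝕜 := ℝ) x
  rw [hx] at h1
  have h2 := h1.comp_hasDerivAt τ hP
  have hinv : ((x⁻¹ : (Mat n)ˣ) : Mat n) = (P τ)⁻¹ := by
    rw [← hx, Matrix.coe_units_inv]
  have e1 : (P τ)⁻¹ * P τ = 1 := Matrix.nonsing_inv_mul _ hPd
  have e2 : P τ * (P τ)⁻¹ = 1 := Matrix.mul_nonsing_inv _ hPd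
  have h3 : (fun u => (P u)⁻¹) = Ring.inverse ∘ P := by
    funext u
    exact Matrix.nonsing_inv_eq_ringInverse (P u)
  rw [h3]
  refine h2.congr_deriv ?_
  simp only [neg_apply, ContinuousLinearMap.mulLeftRight_apply, hinv]
  generalize (P τ)⁻¹ = N at *
  generalize P τ = p at *
  rw [Matrix.transpose_neg, Matrix.transpose_transpose]
  have : N * (A * p + p * Aᵀ - p * S * p + R) * N
      = N * A * (p * N) + (N * p) * Aᵀ * N - (N * p) * S * (p * N) + N * R * N := by
    noncomm_ring
  rw [this, e1, e2]
  noncomm_ring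

/-- The controllability Gramian is the observability Gramian of the dual system. -/
theorem ctrGramian_eq_obsGramian {n : ℕ} (A R : Mat n) (t : ℝ) :
    ctrGramian A R t = obsGramian (-Aᵀ) R t := by
  simp [ctrGramian, obsGramian]

theorem obsOfCtr_eq_ctrOfObs {n : ℕ} (A R S : Mat n) (t : ℝ) :
    obsOfCtr A R S t = ctrOfObs (-Aᵀ) S R t := by
  simp only [obsOfCtr, ctrOfObs, ctrGramian_eq_obsGramian, Matrix.transpose_neg,
    Matrix.transpose_transpose, smul_neg, neg_smul, neg_neg]

/-- An upper bound of `P⁻¹` is a lower bound of `P`: evaluate the form `P` at `z - K⁻¹ P⁻¹ z`. -/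
theorem inv_mul_norm_sq_le_of_inner_inv_le {n : ℕ} {P : Mat n} (hP : P.PosDef) {K : ℝ}
    (hK : 0 < K) (h : ∀ z : Vec n, inner ℝ z (act P⁻¹ z) ≤ K * ‖z‖ ^ 2) (z : Vec n) :
    K⁻¹ * ‖z‖ ^ 2 ≤ inner ℝ z (act P z) := by
  have e2 : P⁻¹ * P = 1 := Matrix.nonsing_inv_mul _ hP.det_pos.ne'.isUnit
  have hst : Pᵀ = P := transpose_eq_of_isHermitian hP.1
  have e3 : P * P⁻¹ = 1 := Matrix.mul_nonsing_inv _ hP.det_pos.ne'.isUnit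
  have h0 := inner_act_nonneg hP.posSemidef (z - K⁻¹ • act P⁻¹ z)
  have hs : act P (z - K⁻¹ • act P⁻¹ z) = act P z - K⁻¹ • z := by
    rw [act_sub, show act P (K⁻¹ • act P⁻¹ z) = K⁻¹ • act P (act P⁻¹ z) from
      (actL n n P).map_smul _ _, ← act_mul, e3, one_act]
  have h5 : inner ℝ (act P⁻¹ z) (act P z) = ‖z‖ ^ 2 := by
    rw [inner_act, hst, ← act_mul, e3, one_act, real_inner_self_eq_norm_sq]
  rw [hs] at h0
  simp only [inner_sub_left, inner_sub_right, real_inner_smul_left, real_inner_smul_right, h5,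
    real_inner_self_eq_norm_sq] at h0
  rw [real_inner_comm] at h0
  have h1 := mul_le_mul_of_nonneg_left (h z) (by positivity : 0 ≤ K⁻¹ * K⁻¹)
  have h2 : K⁻¹ * K⁻¹ * (K * ‖z‖ ^ 2) = K⁻¹ * ‖z‖ ^ 2 := by field_simp
  rw [real_inner_comm] at h1
  have h6 : inner ℝ (act P z) z = inner ℝ z (act P z) := real_inner_comm _ _
  nlinarith

theorem le_of_inner_act_le {n : ℕ} {M N : Mat n} (hM : M.IsHermitian) (hN : N.IsHermitian)
    (h : ∀ z, inner ℝ z (act M z) ≤ inner ℝ z (act N z)) : M ≤ N := by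
  refine Matrix.le_iff.2 (posSemidef_of_inner_act_nonneg (hN.sub hM) fun z => ?_)
  rw [sub_act, inner_sub_right]
  linarith [h z]

/-- After one observability-controllability interval, the solutions of the Riccati equation are
bounded above and below, uniformly in the initial state. -/
theorem riccati_bounds {r r' : ℕ} {m : Model r r'} {v obsLow ctrLow ctrObsUp obsCtrUp : ℝ}
    (hG : GramianBounds m v obsLow ctrLow ctrObsUp obsCtrUp) {Q : Psd r} {P : ℝ → Psd r}
    (h : IsRiccatiSol (ricc m) Q P) {τ : ℝ} (hτ : v ≤ τ) :
    (obsCtrUp + 1 / ctrLow)⁻¹ • (1 : Mat r) ≤ (P τ).1 ∧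
      (P τ).1 ≤ (ctrObsUp + 1 / obsLow) • (1 : Mat r) := by
  have hv := hG.v_pos
  have hder : ∀ u, 0 < u → HasDerivAt (fun u => (P u).1)
      (m.A * (P u).1 + (P u).1 * m.Aᵀ - (P u).1 * m.S * (P u).1 + m.R) u := fun u hu =>
    (h.2 u hu.le).hasDerivAt (Ici_mem_nhds hu)
  have hcont : ContinuousOn (fun u => (P u).1) (Set.Ici 0) := fun u hu =>
    (h.2 u hu).continuousWithinAt
  have hst : ∀ u, ((P u).1)ᵀ = (P u).1 := fun u => transpose_eq_of_isHermitian (P u).2.1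
  have hpd : ∀ u, 0 < u → (P u).1.PosDef := fun u hu =>
    posDef_of_riccati (P := fun u => (P u).1) m.posDef_R (fun u => (P u).2) (hder u hu)
  constructor
  · set K := obsCtrUp + 1 / ctrLow with hKdef
    have hK : 0 < K := add_pos hG.obsCtrUp_pos (one_div_pos.2 hG.ctrLow_pos)
    refine le_of_inner_act_le (isHermitian_smul_one _) (P τ).2.1 fun z => ?_
    rw [inner_smul_one_act]
    -- the inverse is differentiable at positive times only, whereas the interval `[τ - v, τ]` may
    -- start at `0`: the bound is proved at later times, and passes to the limit
    have hlater : ∀ u, τ < u → K⁻¹ * ‖z‖ ^ 2 ≤ inner ℝ z (act (P u).1 z) := by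
      intro u hu
      have hpos : 0 < u := by linarith
      refine inv_mul_norm_sq_le_of_inner_inv_le (hpd u hpos) hK (fun y => ?_) z
      have hd : ∀ w, 0 < w → HasDerivAt (fun u => ((P u).1)⁻¹)
          ((-m.Aᵀ) * ((P w).1)⁻¹ + ((P w).1)⁻¹ * (-m.Aᵀ)ᵀ
            - ((P w).1)⁻¹ * m.R * ((P w).1)⁻¹ + m.S) w := fun w hw =>
        hasDerivAt_inv_riccati (P := fun u => (P u).1) (hpd w hw).det_pos.ne'.isUnit (hder w hw)
      have := riccati_le (A := -m.Aᵀ) (R := m.S) (S := m.R) (a := u - v)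
        (P := fun u => ((P u).1)⁻¹) m.posDef_R.posSemidef hv.le hG.ctrLow_pos
        (by rw [← ctrGramian_eq_obsGramian]; exact hG.ctr_ge)
        (by rw [← obsOfCtr_eq_ctrOfObs]; exact hG.obsOfCtr_le)
        (fun w => by rw [Matrix.transpose_nonsing_inv, hst])
        (fun w hw => (hd w (by linarith [hw.1])).continuousAt.continuousWithinAt)
        (fun w hw => hd w (by linarith [hw.1])) y
      rw [hKdef]
      simpa using this
    have hc : ContinuousAt (fun u => quadL z (P u).1) τ :=
      (quadL z).continuous.continuousAt.comp (hder τ (by linarith)).continuousAt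
    exact ge_of_tendsto (hc.tendsto.mono_left nhdsWithin_le_nhds : Tendsto _ (𝓝[>] τ) _)
      (eventually_mem_nhdsWithin.mono fun u hu => hlater u hu)
  · refine le_of_inner_act_le (P τ).2.1 (isHermitian_smul_one _) fun z => ?_
    rw [inner_smul_one_act]
    have := riccati_le (A := m.A) (R := m.R) (S := m.S) (a := τ - v) (P := fun u => (P u).1)
      m.posSemidef_S hv.le hG.obsLow_pos hG.obs_ge hG.ctrOfObs_le hst
      (hcont.mono fun u hu => Set.mem_Ici.2 (by linarith [hu.1]))
      (fun u hu => hder u (by linarith [hu.1])) z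
    simpa using this

/-! ### Matrix-valued Wiener integrals -/

section WienerVec

variable {Ω : Type*} {mΩ : MeasurableSpace Ω} {μ : Measure Ω}

theorem sum_apply_smul_single {n : ℕ} (z : Vec n) :
    z = ∑ i, z i • EuclideanSpace.single i (1 : ℝ) := by
  ext j
  simp [Pi.single_apply]

theorem tendstoInMeasure_finsetSum {ι E : Type*} [NormedAddCommGroup E] (s : Finset ι)
    {f : ι → ℕ → Ω → E} {f' : ι → Ω → E}
    (h : ∀ i ∈ s, TendstoInMeasure μ (f i) atTop (f' i)) :
    TendstoInMeasure μ (fun N ω => ∑ i ∈ s, f i N ω) atTop (fun ω => ∑ i ∈ s, f' i ω) := by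
  classical
  induction s using Finset.induction_on with
  | empty =>
    intro ε hε
    simp [hε.ne']
  | insert k s hk ih =>
    simp only [Finset.sum_insert hk]
    exact tendstoInMeasure_add (h k (Finset.mem_insert_self _ _))
      (ih fun i hi => h i (Finset.mem_insert_of_mem hi))

theorem tendstoInMeasure_of_apply {n : ℕ} {f : ℕ → Ω → Vec n} {f' : Ω → Vec n}
    (h : ∀ i, TendstoInMeasure μ (fun N ω => f N ω i) atTop (fun ω => f' ω i)) :
    TendstoInMeasure μ f atTop f' := by
  have h1 := tendstoInMeasure_finsetSum Finset.univ
    (f := fun i N ω => f N ω i • (EuclideanSpace.single i (1 : ℝ) : Vec n))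
    (f' := fun i ω => f' ω i • (EuclideanSpace.single i (1 : ℝ) : Vec n)) fun i _ =>
      tendstoInMeasure_of_norm_le 1 (h i) fun N ω => by
        rw [← sub_smul, norm_smul, PiLp.norm_single]; simp
  have e1 : ∀ (N : ℕ) ω, ∑ i, f N ω i • (EuclideanSpace.single i (1 : ℝ) : Vec n) = f N ω :=
    fun N ω => (sum_apply_smul_single _).symm
  have e2 : ∀ ω, ∑ i, f' ω i • (EuclideanSpace.single i (1 : ℝ) : Vec n) = f' ω :=
    fun ω => (sum_apply_smul_single _).symm
  simpa only [e1, e2] using h1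

theorem aestronglyMeasurable_of_apply {m : MeasurableSpace Ω} {n : ℕ} {f : Ω → Vec n}
    (h : ∀ i, AEStronglyMeasurable[m] (fun ω => f ω i) μ) : AEStronglyMeasurable[m] f μ := by
  have e2 : f = fun ω => ∑ i, f ω i • (EuclideanSpace.single i (1 : ℝ) : Vec n) :=
    funext fun ω => sum_apply_smul_single _
  rw [e2]
  choose g hg hfg using h
  refine ⟨_, Finset.stronglyMeasurable_fun_sum Finset.univ fun i _ =>
    (hg i).smul_const (EuclideanSpace.single i (1 : ℝ) : Vec n), ?_⟩
  filter_upwards [ae_all_iff.2 hfg] with ω hω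
  exact Finset.sum_congr rfl fun i _ => by rw [hω i]

/-- `I = ∫ₛᵗ K_u dW_u` as a Wiener integral with matrix-valued integrand, characterised by
its scalar projections `⟪l, I⟫ = ∫ ⟪K_u' l, dW_u⟫`. -/
def IsWienerVec (μ : Measure Ω) {k n : ℕ} (W : ℝ → Ω → Vec n) (K : ℝ → Matrix (Fin k) (Fin n) ℝ)
    (s t : ℝ) (I : Ω → Vec k) : Prop :=
  ∀ l : Vec k, IsWienerInt μ W ((Set.Ioc s t).indicator fun u => act (K u)ᵀ l)
    (fun ω => inner ℝ l (I ω))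

theorem IsWienerVec.const {k n : ℕ} {W : ℝ → Ω → Vec n} (hW : IsStdBrownian μ W)
    (K : Matrix (Fin k) (Fin n) ℝ) {s t : ℝ} (hs : 0 ≤ s) (hst : s ≤ t) :
    IsWienerVec μ W (fun _ => K) s t (fun ω => act K (W t ω - W s ω)) := fun l =>
  (IsWienerInt.increment hW hs hst (act Kᵀ l)).congr rfl
    (Eventually.of_forall fun _ => (inner_act K l _).symm)

theorem IsWienerVec.aestronglyMeasurable {m : MeasurableSpace Ω} {k n : ℕ} {W : ℝ → Ω → Vec n}
    (hW : ∀ t : ℝ≥0, Measurable[m] (W t)) {K : ℝ → Matrix (Fin k) (Fin n) ℝ} {s t : ℝ}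
    {I : Ω → Vec k} (hI : IsWienerVec μ W K s t I) : AEStronglyMeasurable[m] I μ :=
  aestronglyMeasurable_of_apply fun i => by
    have := IsWienerInt.aestronglyMeasurable hW (hI (EuclideanSpace.single i 1))
    simpa [EuclideanSpace.inner_single_left] using this

theorem continuousOn_transpose {α : Type*} [TopologicalSpace α] {k n : ℕ} {s : Set α}
    {K : α → Matrix (Fin k) (Fin n) ℝ} (hK : ContinuousOn K s) :
    ContinuousOn (fun u => (K u)ᵀ) s :=
  (transposeL k n).continuous.comp_continuousOn hK

theorem continuousOn_matrix_mul {α : Type*} [TopologicalSpace α] {j k n : ℕ} {s : Set α}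
    {L : α → Matrix (Fin j) (Fin k) ℝ} {K : α → Matrix (Fin k) (Fin n) ℝ} (hL : ContinuousOn L s)
    (hK : ContinuousOn K s) : ContinuousOn (fun u => L u * K u) s := by
  rw [continuousOn_iff_continuous_domRestrict] at *
  exact hL.matrix_mul hK

theorem continuousOn_act {α : Type*} [TopologicalSpace α] {k n : ℕ} {s : Set α}
    {K : α → Matrix (Fin k) (Fin n) ℝ} {z : α → Vec n} (hK : ContinuousOn K s)
    (hz : ContinuousOn z s) : ContinuousOn (fun u => act (K u) (z u)) s :=
  ((actL k n).continuous.comp_continuousOn hK).clm_apply hz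

theorem integral_norm_indicator_act {k n : ℕ} {K : ℝ → Matrix (Fin k) (Fin n) ℝ} {s t : ℝ}
    (hst : s ≤ t) (hK : ContinuousOn K (Set.Icc s t)) (l : Vec k) :
    ∫ u, ‖(Set.Ioc s t).indicator (fun u => act (K u)ᵀ l) u‖ ^ 2
      = inner ℝ l (act (∫ u in s..t, K u * (K u)ᵀ) l) := by
  have e : (fun u => ‖(Set.Ioc s t).indicator (fun u => act (K u)ᵀ l) u‖ ^ 2)
      = (Set.Ioc s t).indicator fun u => quadL l (K u * (K u)ᵀ) := by
    funext u
    by_cases hu : u ∈ Set.Ioc s t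
    · simp only [Set.indicator_of_mem hu]
      rw [quadL_apply, act_mul, inner_act, real_inner_self_eq_norm_sq]
    · simp [Set.indicator_of_notMem hu]
  have hint : IntervalIntegrable (fun u => K u * (K u)ᵀ) volume s t := by
    refine ContinuousOn.intervalIntegrable ?_
    rw [Set.uIcc_of_le hst]
    exact continuousOn_matrix_mul hK (continuousOn_transpose hK)
  have h1 : ∫ u in s..t, quadL l (K u * (K u)ᵀ) = quadL l (∫ u in s..t, K u * (K u)ᵀ) :=
    (quadL l).intervalIntegral_comp_comm hint
  rw [e, integral_indicator measurableSet_Ioc, ← intervalIntegral.integral_of_le hst, h1,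
    quadL_apply]

/-- The characteristic function of `∫ K dW`: it is a centered Gaussian vector of covariance
`∫ K K'`. -/
theorem IsWienerVec.integral_cexp {k n : ℕ} {W : ℝ → Ω → Vec n} (hW : IsStdBrownian μ W)
    {K : ℝ → Matrix (Fin k) (Fin n) ℝ} {s t : ℝ} (hst : s ≤ t)
    (hK : ContinuousOn K (Set.Icc s t)) {I : Ω → Vec k} (hI : IsWienerVec μ W K s t I)
    (l : Vec k) :
    ∫ ω, Complex.exp ((inner ℝ (I ω) l : ℝ) * Complex.I) ∂μ
      = Complex.exp (-(inner ℝ l (act (∫ u in s..t, K u * (K u)ᵀ) l) : ℝ) / 2) := by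
  have h := IsWienerInt.integral_cexp hW (hI l) 1
  rw [integral_norm_indicator_act hst hK] at h
  simpa [real_inner_comm] using h

/-- The sums `∑ Ψ_{u_k} (N_{u_{k+1}} - N_{u_k})` of a process `N = ∫ K dW` converge to
`∫ Ψ K dW`. -/
theorem exists_weighted_wienerVec {j k n : ℕ} {W : ℝ → Ω → Vec n} (hW : IsStdBrownian μ W)
    {K : ℝ → Matrix (Fin k) (Fin n) ℝ} {Ψ : ℝ → Matrix (Fin j) (Fin k) ℝ} {s t : ℝ}
    (hst : s ≤ t) (hK : ContinuousOn K (Set.Icc s t)) (hΨ : ContinuousOn Ψ (Set.Icc s t))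
    {N : ℝ → Ω → Vec k} (hN : ∀ u ∈ Set.Icc s t, IsWienerVec μ W K s u (N u)) :
    ∃ I, IsWienerVec μ W (fun u => Ψ u * K u) s t I ∧
      TendstoInMeasure μ (fun (n : ℕ) ω => ∑ k ∈ Finset.range n,
        act (Ψ (grid s t n k)) (N (grid s t n (k + 1)) ω - N (grid s t n k) ω)) atTop I := by
  have hKt := continuousOn_transpose hK
  have hΨt := continuousOn_transpose hΨ
  let h : Vec j → ℕ → ℝ → Vec n := fun l M u => ∑ i ∈ Finset.range M,
    (Set.Ioc (grid s t M i) (grid s t M (i + 1))).indicator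
      (fun u => act (K u)ᵀ (act (Ψ (grid s t M i))ᵀ l)) u
  let V : Vec j → ℕ → Ω → ℝ := fun l M ω => inner ℝ l (∑ i ∈ Finset.range M,
    act (Ψ (grid s t M i)) (N (grid s t M (i + 1)) ω - N (grid s t M i) ω))
  have hV : ∀ l M, IsWienerInt μ W (h l M) (V l M) := by
    intro l M
    have h1 : IsWienerInt μ W (h l M) (fun ω => ∑ i ∈ Finset.range M,
        (inner ℝ (act (Ψ (grid s t M i))ᵀ l) (N (grid s t M (i + 1)) ω)
          - inner ℝ (act (Ψ (grid s t M i))ᵀ l) (N (grid s t M i) ω))) := by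
      refine IsWienerInt.sum _ fun i hi => ?_
      have hi' := Finset.mem_range.1 hi
      have hM : M ≠ 0 := by omega
      have m1 := grid_mem hst hM (k := i) (by omega)
      have m2 := grid_mem hst hM (k := i + 1) (by omega)
      have m3 := grid_mono hst M (Nat.le_succ i)
      refine ((hN _ m2 (act (Ψ (grid s t M i))ᵀ l)).sub
        (hN _ m1 (act (Ψ (grid s t M i))ᵀ l))).congr ?_ (ae_eq_refl _)
      funext u
      have hun := Set.Ioc_union_Ioc_eq_Ioc m1.1 m3
      by_cases hu1 : u ∈ Set.Ioc s (grid s t M i)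
      · have hu2 : u ∉ Set.Ioc (grid s t M i) (grid s t M (i + 1)) := fun h => by
          linarith [h.1, hu1.2]
        have hu3 : u ∈ Set.Ioc s (grid s t M (i + 1)) := hun ▸ Or.inl hu1
        simp [Set.indicator_of_mem hu1, Set.indicator_of_notMem hu2, Set.indicator_of_mem hu3]
      · by_cases hu2 : u ∈ Set.Ioc (grid s t M i) (grid s t M (i + 1))
        · have hu3 : u ∈ Set.Ioc s (grid s t M (i + 1)) := hun ▸ Or.inr hu2
          simp [Set.indicator_of_notMem hu1, Set.indicator_of_mem hu2, Set.indicator_of_mem hu3]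
        · have hu3 : u ∉ Set.Ioc s (grid s t M (i + 1)) := fun h => by
            rw [← hun] at h
            exact h.elim hu1 hu2
          simp [Set.indicator_of_notMem hu1, Set.indicator_of_notMem hu2,
            Set.indicator_of_notMem hu3]
    refine h1.congr rfl (Eventually.of_forall fun ω => ?_)
    simp only [V, inner_sum]
    refine Finset.sum_congr rfl fun i _ => ?_
    rw [inner_act, inner_sub_right]
  obtain ⟨B, hB⟩ := isCompact_Icc.exists_bound_of_continuousOn hKt
  have hlim : ∀ l i, Tendsto (fun M => eLpNorm (fun u => h l M u i
      - (Set.Ioc s t).indicator (fun u => act (Ψ u * K u)ᵀ l) u i) 2 volume) atTop (𝓝 0) := by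
    intro l i
    have := tendsto_eLpNorm_cells hst
      (fun M c u => act (K u)ᵀ (act (Ψ (grid s t M c))ᵀ l) i)
      (fun u => act (Ψ u * K u)ᵀ l i) ?_
    · refine this.congr fun M => ?_
      congr 1
      funext u
      simp only [h, WithLp.ofLp_sum, Finset.sum_apply]
      congr 1
      · refine Finset.sum_congr rfl fun c _ => ?_
        by_cases hu : u ∈ Set.Ioc (grid s t M c) (grid s t M (c + 1))
        · simp [Set.indicator_of_mem hu]
        · simp [Set.indicator_of_notMem hu]
      · by_cases hu : u ∈ Set.Ioc s t
        · simp [Set.indicator_of_mem hu]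
        · simp [Set.indicator_of_notMem hu]
    · intro ε hε
      have hpos : 0 < (|B| + 1) * (‖l‖ + 1) := by positivity
      filter_upwards [eventually_dist_cell_lt hst hΨt (div_pos hε hpos)] with M hM c hc u hu
      have hd := hM c hc (grid s t M c)
        ⟨le_rfl, grid_mono hst M (Nat.le_succ c)⟩ u hu
      rw [dist_eq_norm] at hd
      have e1 : act (K u)ᵀ (act (Ψ (grid s t M c))ᵀ l) i - act (Ψ u * K u)ᵀ l i
          = (act (K u)ᵀ (act ((Ψ (grid s t M c))ᵀ - (Ψ u)ᵀ) l)) i := by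
        rw [Matrix.transpose_mul, act_mul, sub_act, act_sub]; rfl
      rw [e1, ← Real.norm_eq_abs]
      calc _ ≤ ‖act (K u)ᵀ (act ((Ψ (grid s t M c))ᵀ - (Ψ u)ᵀ) l)‖ := PiLp.norm_apply_le _ i
        _ ≤ ‖(K u)ᵀ‖ * (‖(Ψ (grid s t M c))ᵀ - (Ψ u)ᵀ‖ * ‖l‖) :=
          (norm_act_le _ _).trans (mul_le_mul_of_nonneg_left (norm_act_le _ _) (norm_nonneg _))
        _ ≤ (|B| + 1) * (ε / ((|B| + 1) * (‖l‖ + 1)) * (‖l‖ + 1)) := by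
          refine mul_le_mul ?_ (mul_le_mul hd.le (by linarith) (norm_nonneg _) (by positivity))
            (by positivity) (by positivity)
          exact (hB u (cell_subset hst hc hu)).trans ((le_abs_self B).trans (by linarith))
        _ = ε := by field_simp
  have hmem : ∀ l i, MemLp (fun u =>
      (Set.Ioc s t).indicator (fun u => act (Ψ u * K u)ᵀ l) u i) 2 volume := by
    intro l i
    have e : (fun u => (Set.Ioc s t).indicator (fun u => act (Ψ u * K u)ᵀ l) u i)
        = (Set.Ioc s t).indicator (fun u => act (Ψ u * K u)ᵀ l i) := by
      funext u
      by_cases hu : u ∈ Set.Ioc s t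
      · simp [Set.indicator_of_mem hu]
      · simp [Set.indicator_of_notMem hu]
    have hc : ContinuousOn (fun u => act (Ψ u * K u)ᵀ l i) (Set.Icc s t) :=
      (PiLp.continuous_apply 2 _ i).comp_continuousOn
        (continuousOn_act (continuousOn_transpose (continuousOn_matrix_mul hΨ hK))
          continuousOn_const)
    obtain ⟨D, hD⟩ := isCompact_Icc.exists_bound_of_continuousOn hc
    rw [e, memLp_indicator_iff_restrict measurableSet_Ioc]
    refine MemLp.of_bound ((hc.mono Set.Ioc_subset_Icc_self).aestronglyMeasurable
      measurableSet_Ioc) D ?_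
    exact (ae_restrict_iff' measurableSet_Ioc).2
      (Eventually.of_forall fun u hu => hD u (Set.Ioc_subset_Icc_self hu))
  choose Z hZ1 hZ2 using fun i : Fin j => IsWienerInt.exists_lim hW
    (hV (EuclideanSpace.single i 1)) (hmem (EuclideanSpace.single i 1))
    (hlim (EuclideanSpace.single i 1))
  refine ⟨fun ω => WithLp.toLp 2 fun i => Z i ω, fun l => ?_, tendstoInMeasure_of_apply fun i => ?_⟩
  · have h1 := IsWienerInt.sum Finset.univ fun i _ => (hZ1 i).const_mul (l i)
    refine h1.congr ?_ (Eventually.of_forall fun ω => ?_)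
    · funext u
      by_cases hu : u ∈ Set.Ioc s t
      · simp only [Set.indicator_of_mem hu]
        have : ∀ (T : Matrix (Fin n) (Fin j) ℝ),
            ∑ i, l i • act T (EuclideanSpace.single i (1 : ℝ)) = act T l := by
          intro T
          conv_rhs => rw [sum_apply_smul_single l]
          simp only [← actL_apply, map_sum, map_smul]
        exact this _
      · simp [Set.indicator_of_notMem hu]
    · simp [PiLp.inner_apply, mul_comm]
  · refine (hZ2 i).congr' (Eventually.of_forall fun M => Eventually.of_forall fun ω => ?_)
      (Eventually.of_forall fun ω => ?_)
    · simp [V, EuclideanSpace.inner_single_left]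
    · simp

end WienerVec

/-! ### Linear equations driven by a process -/

section LinearEquations

variable {Ω : Type*} {mΩ : MeasurableSpace Ω} {μ : Measure Ω}

theorem aestronglyMeasurable_finsetSum {m : MeasurableSpace Ω} {E ι : Type*}
    [NormedAddCommGroup E] (s : Finset ι) {f : ι → Ω → E}
    (h : ∀ i ∈ s, AEStronglyMeasurable[m] (f i) μ) :
    AEStronglyMeasurable[m] (fun ω => ∑ i ∈ s, f i ω) μ := by
  classical
  induction s using Finset.induction_on with
  | empty => simpa using aestronglyMeasurable_const
  | insert k s hk ih =>
    simp only [Finset.sum_insert hk]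
    exact (h k (Finset.mem_insert_self _ _)).add
      (ih fun i hi => h i (Finset.mem_insert_of_mem hi))

theorem aestronglyMeasurable_act {m : MeasurableSpace Ω} {j k : ℕ} (M : Matrix (Fin j) (Fin k) ℝ)
    {f : Ω → Vec k} (hf : AEStronglyMeasurable[m] f μ) :
    AEStronglyMeasurable[m] (fun ω => act M (f ω)) μ :=
  (actL j k M).continuous.comp_aestronglyMeasurable hf

/-- The left-point Riemann sums of `K` against the process `Z` on `[s, t]`. -/
def riemannSum {j k : ℕ} (K : ℝ → Matrix (Fin j) (Fin k) ℝ) (Z : ℝ → Ω → Vec k) (s t : ℝ)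
    (N : ℕ) (ω : Ω) : Vec j :=
  ∑ i ∈ Finset.range N, act (K (grid s t N i)) (Z (grid s t N (i + 1)) ω - Z (grid s t N i) ω)

theorem isStochIntegral_iff {j k : ℕ} {K : ℝ → Matrix (Fin j) (Fin k) ℝ} {Z : ℝ → Ω → Vec k}
    {s t : ℝ} {I : Ω → Vec j} :
    IsStochIntegral μ K Z s t I ↔ TendstoInMeasure μ (riemannSum K Z s t) atTop I := by
  unfold IsStochIntegral riemannSum
  simp only [grid, Nat.cast_succ]

theorem aestronglyMeasurable_riemannSum {m : MeasurableSpace Ω} {j k : ℕ}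
    {K : ℝ → Matrix (Fin j) (Fin k) ℝ} {Z : ℝ → Ω → Vec k} {s t : ℝ} (hst : s ≤ t)
    (h : ∀ u ∈ Set.Icc s t, AEStronglyMeasurable[m] (Z u) μ) (N : ℕ) :
    AEStronglyMeasurable[m] (riemannSum K Z s t N) μ := by
  refine aestronglyMeasurable_finsetSum _ fun i hi => aestronglyMeasurable_act _ ?_
  have := Finset.mem_range.1 hi
  exact (h _ (grid_mem hst (by omega) (by omega))).sub (h _ (grid_mem hst (by omega) (by omega)))

/-- Variation of constants: if `X_u = F_u + ∫ₛᵘ M X`, the Riemann sums of the inverse fundamental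
matrix `Ψ` against `F` converge to `Ψ_t X_t - Ψ_s X_s`. -/
theorem tendsto_riemannSum_fundamental {r : ℕ} {s t : ℝ} (hst : s ≤ t) {X F : ℝ → Ω → Vec r}
    (hX : ∀ᵐ ω ∂μ, ContinuousOn (fun u => X u ω) (Set.Icc s t)) {M Ψ : ℝ → Mat r}
    (hM : ContinuousOn M (Set.Icc s t)) (hΨ : ∀ u, HasDerivAt Ψ (-(Ψ u * M u)) u)
    (hF : ∀ u ∈ Set.Icc s t, ∀ᵐ ω ∂μ, X u ω = F u ω + ∫ w in s..u, act (M w) (X w ω)) :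
    ∀ᵐ ω ∂μ, Tendsto (fun N => riemannSum Ψ F s t N ω) atTop
      (𝓝 (act (Ψ t) (X t ω) - act (Ψ s) (X s ω))) := by
  have h1 : ∀ N i : ℕ, ∀ᵐ ω ∂μ, i ≤ N → N ≠ 0 → X (grid s t N i) ω
      = F (grid s t N i) ω + ∫ w in s..grid s t N i, act (M w) (X w ω) := by
    intro N i
    by_cases hi : i ≤ N ∧ N ≠ 0
    · filter_upwards [hF _ (grid_mem hst hi.2 hi.1)] with ω hω _ _ using hω
    · exact Eventually.of_forall fun ω h1 h2 => (hi ⟨h1, h2⟩).elim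
  filter_upwards [hX, ae_all_iff.2 fun N => ae_all_iff.2 (h1 N)] with ω hω h
  refine (tendsto_sum_act_increment hst hω hM hΨ).congr fun N => ?_
  refine Finset.sum_congr rfl fun i hi => ?_
  have hi' := Finset.mem_range.1 hi
  have hN : N ≠ 0 := by omega
  have hc : ContinuousOn (fun w => act (M w) (X w ω)) (Set.Icc s t) := continuousOn_act hM hω
  have m0 : s ∈ Set.Icc s t := ⟨le_rfl, hst⟩
  have m1 := grid_mem hst hN (k := i) (by omega)
  have m2 := grid_mem hst hN (k := i + 1) (by omega)
  have hint : ∀ a ∈ Set.Icc s t, ∀ b ∈ Set.Icc s t,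
      IntervalIntegrable (fun w => act (M w) (X w ω)) volume a b := fun a ha b hb =>
    (hc.mono (Set.uIcc_subset_Icc ha hb)).intervalIntegrable
  rw [← intervalIntegral.integral_interval_sub_left (hint _ m0 _ m2) (hint _ m0 _ m1)]
  congr 1
  rw [h N i (by omega) hN, h N (i + 1) (by omega) hN]
  abel

theorem aestronglyMeasurable_of_ae_tendsto [IsFiniteMeasure μ] {m : MeasurableSpace Ω}
    (hm : m ≤ mΩ) {E : Type*} [NormedAddCommGroup E] [CompleteSpace E] {f : ℕ → Ω → E}
    {f' : Ω → E} (hf : ∀ n, AEStronglyMeasurable[m] (f n) μ)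
    (h : ∀ᵐ ω ∂μ, Tendsto (fun n => f n ω) atTop (𝓝 (f' ω))) : AEStronglyMeasurable[m] f' μ :=
  tendstoInMeasure_aestronglyMeasurable hf
    (tendstoInMeasure_of_tendsto_ae (fun n => (hf n).mono hm) h)

/-- The solution of a linear equation with deterministic coefficients is measurable with respect
to the (completed) σ-algebra of its driving process. -/
theorem aestronglyMeasurable_linear [IsFiniteMeasure μ] {m : MeasurableSpace Ω} (hm : m ≤ mΩ)
    {r : ℕ} {s t : ℝ} (hst : s ≤ t) {X F : ℝ → Ω → Vec r}
    (hX : ∀ᵐ ω ∂μ, ContinuousOn (fun u => X u ω) (Set.Icc s t)) (A : Mat r)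
    (hF : ∀ u ∈ Set.Icc s t, ∀ᵐ ω ∂μ, X u ω = F u ω + ∫ w in s..u, act A (X w ω))
    (hFm : ∀ u ∈ Set.Icc s t, AEStronglyMeasurable[m] (F u) μ) :
    AEStronglyMeasurable[m] (X t) μ := by
  obtain ⟨Φ, Ψ, -, hΨs, -, hΨ, hΦΨ⟩ :=
    exists_fundamental (fun _ => A) continuous_const ‖A‖ (fun _ => le_rfl) s
  have h1 := tendsto_riemannSum_fundamental hst hX (M := fun _ => A) continuousOn_const hΨ hF
  have h2 := aestronglyMeasurable_of_ae_tendsto hm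
    (fun N => aestronglyMeasurable_riemannSum hst hFm N) h1
  have h3 : X s =ᵐ[μ] F s := by
    filter_upwards [hF s ⟨le_rfl, hst⟩] with ω hω
    simpa using hω
  have h4 : AEStronglyMeasurable[m] (X s) μ := (hFm s ⟨le_rfl, hst⟩).congr h3.symm
  refine (aestronglyMeasurable_act (Φ t) (h2.add h4)).congr (Eventually.of_forall fun ω => ?_)
  simp only [Pi.add_apply, hΨs, one_act, sub_add_cancel]
  rw [← act_mul, hΦΨ, one_act]

section Representation

variable {r r' : ℕ} {A : Mat r} {C : Matrix (Fin r') (Fin r) ℝ} {σW : Mat r} {σV : Mat r'}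
  {G : ℝ → Matrix (Fin r) (Fin r') ℝ} {M Ψ : ℝ → Mat r} {s t : ℝ}

/-- The drift `A X - G (C X)` is `M X` for `M = A - G C`. -/
theorem act_drift (hMG : ∀ u ∈ Set.Icc s t, M u = A - G u * C) {u : ℝ} (hu : u ∈ Set.Icc s t)
    (X : ℝ → Vec r) :
    ∫ w in s..u, (act A (X w) - act (G w) (act C (X w))) = ∫ w in s..u, act (M w) (X w) := by
  refine intervalIntegral.integral_congr fun w hw => ?_
  rw [Set.uIcc_of_le hu.1] at hw
  simp only [hMG w ⟨hw.1, hw.2.trans hu.2⟩, sub_act, act_mul]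

/-- The diffusion is split into its initial value, the part driven by the observations (`J` is
the stochastic integral of the gain against `Y`, and `L` that of `Ψ` against `J`), and two Wiener
integrals. -/
theorem exists_representation [IsFiniteMeasure μ] (hs : 0 ≤ s)
    {Wb : ℝ → Ω → Vec r} {Vb Y : ℝ → Ω → Vec r'} (hWb : IsStdBrownian μ Wb)
    (hVb : IsStdBrownian μ Vb) (hG : ContinuousOn G (Set.Icc s t))
    (hM : ContinuousOn M (Set.Icc s t)) (hMG : ∀ u ∈ Set.Icc s t, M u = A - G u * C)
    (hΨ : ∀ u, HasDerivAt Ψ (-(Ψ u * M u)) u) (hΨs : Ψ s = 1)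
    (hY : ∀ u, Measurable (Y u)) {Xb : ℝ → Ω → Vec r} (hXm : Measurable (Xb s))
    (hXc : ∀ᵐ ω ∂μ, ContinuousOn (fun u => Xb u ω) (Set.Icc s t))
    (hX : ∀ u ∈ Set.Icc s t, IsStochIntegral μ G (fun u ω => Y u ω - act σV (Vb u ω)) s u
      (fun ω => Xb u ω - Xb s ω - (∫ w in s..u, (act A (Xb w ω) - act (G w) (act C (Xb w ω))))
        - act σW (Wb u ω - Wb s ω))) :
    ∃ J : ℝ → Ω → Vec r, (∀ u ∈ Set.Icc s t, IsStochIntegral μ G Y s u (J u)) ∧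
      ∀ τ ∈ Set.Icc s t, ∃ L I₁ I₂ : Ω → Vec r,
        IsStochIntegral μ Ψ J s τ L ∧
        IsWienerVec μ Wb (fun u => Ψ u * σW) s τ I₁ ∧
        IsWienerVec μ Vb (fun u => Ψ u * (G u * σV)) s τ I₂ ∧
        ∀ ω, act (Ψ τ) (Xb τ ω) = Xb s ω + L ω + I₁ ω - I₂ ω := by
  have hN : ∀ u, ∃ N : Ω → Vec r, u ∈ Set.Icc s t →
      IsWienerVec μ Vb (fun u => G u * σV) s u N ∧
      TendstoInMeasure μ (riemannSum G (fun u ω => act σV (Vb u ω)) s u) atTop N := by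
    intro u
    by_cases hu : u ∈ Set.Icc s t
    · obtain ⟨N, h1, h2⟩ := exists_weighted_wienerVec hVb hu.1 (K := fun _ => σV)
        continuousOn_const (hG.mono (Set.Icc_subset_Icc_right hu.2))
        (fun w hw => IsWienerVec.const hVb σV hs hw.1)
      refine ⟨N, fun _ => ⟨h1, h2.congr' (Eventually.of_forall fun n =>
        Eventually.of_forall fun ω => ?_) (ae_eq_refl _)⟩⟩
      refine Finset.sum_congr rfl fun i _ => ?_
      simp only [act_sub]
      abel
    · exact ⟨0, fun h => (hu h).elim⟩
  choose N hN using hN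
  let J : ℝ → Ω → Vec r := fun u ω => (Xb u ω - Xb s ω
    - (∫ w in s..u, (act A (Xb w ω) - act (G w) (act C (Xb w ω))))
        - act σW (Wb u ω - Wb s ω)) + N u ω
  have hJ : ∀ u ∈ Set.Icc s t, IsStochIntegral μ G Y s u (J u) := by
    intro u hu
    rw [isStochIntegral_iff]
    refine (tendstoInMeasure_add (isStochIntegral_iff.1 (hX u hu)) (hN u hu).2).congr'
      (Eventually.of_forall fun n => Eventually.of_forall fun ω => ?_) (ae_eq_refl _)
    simp only [riemannSum, ← Finset.sum_add_distrib, ← act_add]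
    refine Finset.sum_congr rfl fun i _ => ?_
    congr 1
    abel
  have hJm : ∀ u ∈ Set.Icc s t, AEStronglyMeasurable (J u) μ := fun u hu =>
    tendstoInMeasure_aestronglyMeasurable
      (fun n => aestronglyMeasurable_riemannSum hu.1
        (fun w _ => (hY w).aestronglyMeasurable) n) (isStochIntegral_iff.1 (hJ u hu))
  refine ⟨J, hJ, fun τ hτ => ?_⟩
  have hsub : Set.Icc s τ ⊆ Set.Icc s t := Set.Icc_subset_Icc_right hτ.2
  have hΨc : ContinuousOn Ψ (Set.Icc s τ) := fun u _ => (hΨ u).continuousAt.continuousWithinAt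
  obtain ⟨I₁, hI₁, hI₁'⟩ := exists_weighted_wienerVec hWb hτ.1 (K := fun _ => σW)
    continuousOn_const hΨc (fun w hw => IsWienerVec.const hWb σW hs hw.1)
  obtain ⟨I₂, hI₂, hI₂'⟩ := exists_weighted_wienerVec hVb hτ.1 (K := fun u => G u * σV)
    (continuousOn_matrix_mul (hG.mono hsub) continuousOn_const) hΨc
    (fun w hw => (hN w (hsub hw)).1)
  let F : ℝ → Ω → Vec r := fun u ω =>
    Xb s ω + J u ω + act σW (Wb u ω - Wb s ω) - N u ω
  have hNm : ∀ u ∈ Set.Icc s t, AEStronglyMeasurable (N u) μ := fun u hu =>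
    (hN u hu).1.aestronglyMeasurable fun w => hVb.measurable w
  have hFm : ∀ u ∈ Set.Icc s τ, AEStronglyMeasurable (F u) μ := fun u hu =>
    ((hXm.aestronglyMeasurable.add (hJm u (hsub hu))).add
      (aestronglyMeasurable_act σW
        ((hWb.measurable u).sub (hWb.measurable s)).aestronglyMeasurable)).sub (hNm u (hsub hu))
  have h1 := tendsto_riemannSum_fundamental (μ := μ) hτ.1 (X := Xb) (F := F)
    (hXc.mono fun ω hω => hω.mono hsub) (hM.mono hsub) hΨ (fun u hu =>
      Eventually.of_forall fun ω => by
        simp only [F, J, act_drift hMG (hsub hu) (fun w => Xb w ω)]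
        abel)
  have h2 := tendstoInMeasure_of_tendsto_ae
    (fun n => aestronglyMeasurable_riemannSum hτ.1 hFm n) h1
  refine ⟨fun ω => act (Ψ τ) (Xb τ ω) - act (Ψ s) (Xb s ω) - I₁ ω + I₂ ω, I₁, I₂, ?_, hI₁, hI₂,
    fun ω => ?_⟩
  · rw [isStochIntegral_iff]
    refine (tendstoInMeasure_add (tendstoInMeasure_sub h2 hI₁') hI₂').congr'
      (Eventually.of_forall fun n => Eventually.of_forall fun ω => ?_) (ae_eq_refl _)
    simp only [riemannSum, ← Finset.sum_add_distrib, ← Finset.sum_sub_distrib, ← act_add,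
      ← act_sub, F]
    refine Finset.sum_congr rfl fun i _ => ?_
    congr 1
    simp only [act_sub]
    abel
  · simp only [hΨs, one_act]
    abel

/-- A filter with gain `G` is the observation part of the representation: variation of constants
applies to it with the driving process `x + J`. -/
theorem filter_eq [IsFiniteMeasure μ] {Y : ℝ → Ω → Vec r'} {J : ℝ → Ω → Vec r} {τ : ℝ}
    (hτ : τ ∈ Set.Icc s t) (hM : ContinuousOn M (Set.Icc s t))
    (hMG : ∀ u ∈ Set.Icc s t, M u = A - G u * C)
    (hΨ : ∀ u, HasDerivAt Ψ (-(Ψ u * M u)) u) (hΨs : Ψ s = 1)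
    (hJ : ∀ u ∈ Set.Icc s t, IsStochIntegral μ G Y s u (J u)) {L : Ω → Vec r}
    (hL : IsStochIntegral μ Ψ J s τ L) (hY : ∀ u, Measurable (Y u)) {ψ : ℝ → Ω → Vec r}
    {x : Vec r} (hψ0 : ∀ᵐ ω ∂μ, ψ s ω = x)
    (hψc : ∀ᵐ ω ∂μ, ContinuousOn (fun u => ψ u ω) (Set.Icc s t))
    (hψ : ∀ u ∈ Set.Icc s t, IsStochIntegral μ G Y s u
      (fun ω => ψ u ω - x - ∫ w in s..u, (act A (ψ w ω) - act (G w) (act C (ψ w ω))))) :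
    ∀ᵐ ω ∂μ, act (Ψ τ) (ψ τ ω) = x + L ω := by
  have hsub : Set.Icc s τ ⊆ Set.Icc s t := Set.Icc_subset_Icc_right hτ.2
  have hJm : ∀ u ∈ Set.Icc s τ, AEStronglyMeasurable (J u) μ := fun u hu =>
    tendstoInMeasure_aestronglyMeasurable
      (fun n => aestronglyMeasurable_riemannSum hu.1
        (fun w _ => (hY w).aestronglyMeasurable) n) (isStochIntegral_iff.1 (hJ u (hsub hu)))
  have h1 := tendsto_riemannSum_fundamental (μ := μ) hτ.1 (X := ψ) (F := fun u ω => x + J u ω)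
    (hψc.mono fun ω hω => hω.mono hsub) (hM.mono hsub) hΨ (fun u hu => by
      filter_upwards [tendstoInMeasure_ae_unique (isStochIntegral_iff.1 (hψ u (hsub hu)))
        (isStochIntegral_iff.1 (hJ u (hsub hu)))] with ω hω
      rw [← hω, act_drift hMG (hsub hu) (fun w => ψ w ω)]
      abel)
  have h2 := tendstoInMeasure_of_tendsto_ae (fun n => aestronglyMeasurable_riemannSum hτ.1
    (fun u hu => aestronglyMeasurable_const.add (hJm u hu)) n) h1
  have h3 : TendstoInMeasure μ (riemannSum Ψ J s τ) atTop
      (fun ω => act (Ψ τ) (ψ τ ω) - act (Ψ s) (ψ s ω)) :=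
    h2.congr' (Eventually.of_forall fun n => Eventually.of_forall fun ω => by
      simp only [riemannSum, Pi.add_apply, add_sub_add_left_eq_sub]) (ae_eq_refl _)
  filter_upwards [hψ0, tendstoInMeasure_ae_unique h3 (isStochIntegral_iff.1 hL)] with ω e1 e2
  rw [← e2, e1, hΨs, one_act]
  abel

end Representation

end LinearEquations

/-! ### Independence and conditional laws -/

section Independence

variable {Ω : Type*} {mΩ : MeasurableSpace Ω} {μ : Measure Ω}

/-- A function that is almost everywhere equal to an `m`-measurable one is measurable for the
completion of `m`. -/
theorem measurable_completion {m : MeasurableSpace Ω} {E : Type*} [TopologicalSpace E]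
    [TopologicalSpace.PseudoMetrizableSpace E] [MeasurableSpace E] [BorelSpace E] {f : Ω → E}
    (hf : AEStronglyMeasurable[m] f μ) :
    Measurable[eventuallyMeasurableSpace m (ae μ)] f := by
  obtain ⟨g, hg, hfg⟩ := hf
  exact hg.measurable.eventuallyMeasurable_of_eventuallyEq hfg

theorem measurable_path_completion {m : MeasurableSpace Ω} {ι : Type*} {n : ℕ}
    {f : Ω → ι → Vec n} (hf : ∀ i, AEStronglyMeasurable[m] (fun ω => f ω i) μ) :
    Measurable[eventuallyMeasurableSpace m (ae μ)] f :=
  (@measurable_pi_iff _ _ _ (eventuallyMeasurableSpace m (ae μ)) _ _).2 fun i =>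
    measurable_completion (hf i)

/-- Independent σ-algebras remain independent after completion. -/
theorem indep_completion {m₁ m₂ : MeasurableSpace Ω} (h : Indep m₁ m₂ μ) :
    Indep (eventuallyMeasurableSpace m₁ (ae μ)) (eventuallyMeasurableSpace m₂ (ae μ)) μ := by
  rw [Indep_iff] at *
  rintro s t ⟨s', hs', hss⟩ ⟨t', ht', htt⟩
  rw [measure_congr hss, measure_congr htt, ← h s' t' hs' ht']
  exact measure_congr (hss.inter htt)

theorem indepFun_of_measurable_completion {α β : Type*} [MeasurableSpace α] [MeasurableSpace β]
    {m₁ m₂ : MeasurableSpace Ω} (h : Indep m₁ m₂ μ) {f : Ω → α} {g : Ω → β}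
    (hf : Measurable[eventuallyMeasurableSpace m₁ (ae μ)] f)
    (hg : Measurable[eventuallyMeasurableSpace m₂ (ae μ)] g) : IndepFun f g μ :=
  indep_of_indep_of_le_right (indep_of_indep_of_le_left (indep_completion h) hf.comap_le)
    hg.comap_le

/-- The conditional law of `f(Y) + D` given `Y`, when `D` is independent of `Y`. -/
theorem condDistrib_add_indep [IsProbabilityMeasure μ] {α : Type*} [MeasurableSpace α] {r : ℕ}
    {Y : Ω → α} (hY : Measurable Y) {f : α → Vec r} (hf : Measurable f) {D Z : Ω → Vec r}
    (hD : AEMeasurable D μ) (hYD : IndepFun Y D μ) (hZ : ∀ᵐ ω ∂μ, Z ω = f (Y ω) + D ω) :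
    ∀ᵐ ω ∂μ, condDistrib Z Y μ (Y ω) = (μ.map D).map (fun d => f (Y ω) + d) := by
  have : IsProbabilityMeasure (μ.map D) := Measure.isProbabilityMeasure_map hD
  let g : α × Vec r → Vec r := fun p => f p.1 + p.2
  have hg : Measurable g := (hf.comp measurable_fst).add measurable_snd
  let κ : Kernel α (Vec r) := (Kernel.id ×ₖ Kernel.const α (μ.map D)).map g
  have hκa : ∀ y, κ y = (μ.map D).map (fun d => f y + d) := by
    intro y
    simp only [κ]
    rw [Kernel.map_apply _ hg, Kernel.prod_apply, Kernel.id_apply, Kernel.const_apply,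
      Measure.dirac_prod, Measure.map_map hg measurable_prodMk_left]
    rfl
  have : IsMarkovKernel κ := Kernel.IsMarkovKernel.map _ hg
  have hmeas : Measurable fun p : α × Vec r => (p.1, g p) := measurable_fst.prodMk hg
  have hZm : AEMeasurable Z μ :=
    ((hf.comp hY).aemeasurable.add hD).congr (hZ.mono fun ω h => h.symm)
  have key : μ.map (fun ω => (Y ω, Z ω)) = μ.map Y ⊗ₘ κ := by
    have h1 : μ.map (fun ω => (Y ω, Z ω)) =
        (μ.map fun ω => (Y ω, D ω)).map (fun p => (p.1, g p)) := by
      rw [AEMeasurable.map_map_of_aemeasurable hmeas.aemeasurable (hY.aemeasurable.prodMk hD)]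
      exact Measure.map_congr (hZ.mono fun ω h => by simp [g, h])
    rw [h1, (indepFun_iff_map_prod_eq_prod_map_map hY.aemeasurable hD).1 hYD]
    ext s hs
    rw [Measure.map_apply hmeas hs, Measure.prod_apply (hmeas hs), Measure.compProd_apply hs]
    refine lintegral_congr fun y => ?_
    rw [hκa, Measure.map_apply (measurable_const_add _) (measurable_prodMk_left hs)]
    rfl
  have h2 := condDistrib_ae_eq_of_measure_eq_compProd (μ := μ) Y hZm key
  filter_upwards [ae_of_ae_map hY.aemeasurable h2] with ω hω
  rw [hω, hκa]

theorem multivariateGaussian_map_add {r : ℕ} (a : Vec r) (S : Mat r) :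
    (multivariateGaussian 0 S).map (fun d => a + d) = multivariateGaussian a S := by
  unfold multivariateGaussian
  rw [Measure.map_map (measurable_const_add a) (by fun_prop)]
  congr 1
  funext z
  simp

theorem charFun_multivariateGaussian_act {r : ℕ} (a : Vec r) {S : Mat r} (hS : S.PosSemidef)
    (l : Vec r) : charFun (multivariateGaussian a S) l
      = Complex.exp ((inner ℝ l a : ℝ) * Complex.I - (inner ℝ l (act S l) : ℝ) / 2) := by
  rw [charFun_multivariateGaussian hS, inner_act_eq_dotProduct]

theorem posSemidef_integral_mul_transpose {k n : ℕ} {K : ℝ → Matrix (Fin k) (Fin n) ℝ} {s t : ℝ}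
    (hst : s ≤ t) (hK : ContinuousOn K (Set.Icc s t)) :
    (∫ u in s..t, K u * (K u)ᵀ).PosSemidef := by
  have hint : IntervalIntegrable (fun u => K u * (K u)ᵀ) volume s t := by
    refine ContinuousOn.intervalIntegrable ?_
    rw [Set.uIcc_of_le hst]
    exact continuousOn_matrix_mul hK (continuousOn_transpose hK)
  refine posSemidef_of_inner_act_nonneg ?_ fun l => ?_
  · have h : ∫ u in s..t, (K u * (K u)ᵀ)ᵀ = (∫ u in s..t, K u * (K u)ᵀ)ᵀ :=
      (transposeL k k).intervalIntegral_comp_comm hint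
    simp only [Matrix.transpose_mul, Matrix.transpose_transpose] at h
    simpa [Matrix.IsHermitian] using h.symm
  · rw [← integral_norm_indicator_act hst hK]
    exact integral_nonneg fun u => by positivity

/-- The law of a linear image of a Gaussian vector and two Wiener integrals, all independent. -/
theorem map_gaussian_add_wiener [IsProbabilityMeasure μ] {r r' : ℕ} {Wb : ℝ → Ω → Vec r}
    {Vb : ℝ → Ω → Vec r'} (hWb : IsStdBrownian μ Wb) (hVb : IsStdBrownian μ Vb)
    (hWV : IndepFun (path Wb) (path Vb) μ) {X₀ : Ω → Vec r} (hX₀ : Measurable X₀)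
    (hXWV : IndepFun X₀ (fun ω => (path Wb ω, path Vb ω)) μ) {x : Vec r} {Q : Mat r}
    (hQ : Q.PosSemidef) (hlaw : μ.map X₀ = multivariateGaussian x Q)
    {K₁ : ℝ → Mat r} {K₂ : ℝ → Matrix (Fin r) (Fin r') ℝ} {s t : ℝ} (hst : s ≤ t)
    (hK₁ : ContinuousOn K₁ (Set.Icc s t)) (hK₂ : ContinuousOn K₂ (Set.Icc s t))
    {I₁ I₂ : Ω → Vec r} (hI₁ : IsWienerVec μ Wb K₁ s t I₁) (hI₂ : IsWienerVec μ Vb K₂ s t I₂)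
    (Φ : Mat r) :
    μ.map (fun ω => act Φ (X₀ ω - x + I₁ ω - I₂ ω)) = multivariateGaussian 0
      (Φ * (Q + (∫ u in s..t, K₁ u * (K₁ u)ᵀ) + ∫ u in s..t, K₂ u * (K₂ u)ᵀ) * Φᵀ) := by
  set Γ₁ := ∫ u in s..t, K₁ u * (K₁ u)ᵀ with hΓ₁
  set Γ₂ := ∫ u in s..t, K₂ u * (K₂ u)ᵀ with hΓ₂
  have hpsd : (Q + Γ₁ + Γ₂).PosSemidef := (hQ.add (posSemidef_integral_mul_transpose hst hK₁)).add
    (posSemidef_integral_mul_transpose hst hK₂)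
  have hpsd' : (Φ * (Q + Γ₁ + Γ₂) * Φᵀ).PosSemidef := by
    simpa using hpsd.mul_mul_conjTranspose_same Φ
  have ev : ∀ (n : ℕ) (t : ℝ≥0), Measurable fun p : ℝ≥0 → Vec n => p t :=
    fun n t => measurable_pi_apply t
  have mI₁ : AEStronglyMeasurable[MeasurableSpace.comap (path Wb) inferInstance] I₁ μ :=
    hI₁.aestronglyMeasurable fun t => (ev r t).comp (comap_measurable (path Wb))
  have mI₂ : AEStronglyMeasurable[MeasurableSpace.comap (path Vb) inferInstance] I₂ μ :=
    hI₂.aestronglyMeasurable fun t => (ev r' t).comp (comap_measurable (path Vb))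
  have mI₁' : AEStronglyMeasurable[MeasurableSpace.comap
      (fun ω => (path Wb ω, path Vb ω)) inferInstance] I₁ μ :=
    hI₁.aestronglyMeasurable fun t => ((ev r t).comp measurable_fst).comp
      (comap_measurable (fun ω => (path Wb ω, path Vb ω)))
  have mI₂' : AEStronglyMeasurable[MeasurableSpace.comap
      (fun ω => (path Wb ω, path Vb ω)) inferInstance] I₂ μ :=
    hI₂.aestronglyMeasurable fun t => ((ev r' t).comp measurable_snd).comp
      (comap_measurable (fun ω => (path Wb ω, path Vb ω)))
  have aI₁ : AEMeasurable I₁ μ := (hI₁.aestronglyMeasurable fun t => hWb.measurable t).aemeasurable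
  have aI₂ : AEMeasurable I₂ μ := (hI₂.aestronglyMeasurable fun t => hVb.measurable t).aemeasurable
  have aN : AEMeasurable (fun ω => -I₂ ω) μ := aI₂.neg
  have aS : AEMeasurable (fun ω => I₁ ω + -I₂ ω) μ := aI₁.add aN
  have aX : AEMeasurable (fun ω => X₀ ω + (I₁ ω + -I₂ ω)) μ := hX₀.aemeasurable.add aS
  have i12 : IndepFun I₁ (fun ω => -I₂ ω) μ := indepFun_of_measurable_completion hWV
    (measurable_completion mI₁) (measurable_completion mI₂.neg)
  have i0 : IndepFun X₀ (fun ω => I₁ ω + -I₂ ω) μ := indepFun_of_measurable_completion hXWV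
    (measurable_completion (comap_measurable X₀).stronglyMeasurable.aestronglyMeasurable)
    (measurable_completion (mI₁'.add mI₂'.neg))
  have c1 : ∀ l, charFun (μ.map I₁) l = Complex.exp (-(inner ℝ l (act Γ₁ l) : ℝ) / 2) := fun l => by
    rw [charFun_apply, integral_map aI₁ (by fun_prop)]
    exact hI₁.integral_cexp hWb hst hK₁ l
  have c2 : ∀ l, charFun (μ.map fun ω => -I₂ ω) l
      = Complex.exp (-(inner ℝ l (act Γ₂ l) : ℝ) / 2) := fun l => by
    rw [charFun_apply, integral_map aN (by fun_prop)]
    have := hI₂.integral_cexp hVb hst hK₂ (-l)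
    rw [act_neg, inner_neg_neg] at this
    simpa [inner_neg_left, inner_neg_right] using this
  have aD : AEMeasurable (fun ω => act Φ (X₀ ω - x + I₁ ω - I₂ ω)) μ :=
    (actL r r Φ).continuous.measurable.comp_aemeasurable
      (((hX₀.aemeasurable.sub aemeasurable_const).add aI₁).sub aI₂)
  have : IsProbabilityMeasure (μ.map (fun ω => act Φ (X₀ ω - x + I₁ ω - I₂ ω))) :=
    Measure.isProbabilityMeasure_map aD
  refine Measure.ext_of_charFun (funext fun l => ?_)
  rw [charFun_multivariateGaussian_act 0 hpsd', charFun_apply, integral_map aD (by fun_prop)]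
  set l' := act Φᵀ l with hl'
  have e1 : ∀ ω, Complex.exp ((inner ℝ (act Φ (X₀ ω - x + I₁ ω - I₂ ω)) l : ℝ) * Complex.I)
      = Complex.exp (-(inner ℝ l' x : ℝ) * Complex.I)
        * Complex.exp ((inner ℝ (X₀ ω + (I₁ ω + -I₂ ω)) l' : ℝ) * Complex.I) := by
    intro ω
    rw [← Complex.exp_add]
    congr 1
    rw [real_inner_comm, inner_act, ← hl', real_inner_comm l' (X₀ ω + _)]
    simp only [inner_sub_right, inner_add_right, inner_neg_right]
    push_cast
    ring
  simp only [e1]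
  rw [integral_const_mul]
  have e2 : ∫ ω, Complex.exp ((inner ℝ (X₀ ω + (I₁ ω + -I₂ ω)) l' : ℝ) * Complex.I) ∂μ
      = charFun (μ.map fun ω => X₀ ω + (I₁ ω + -I₂ ω)) l' := by
    rw [charFun_apply, integral_map aX (by fun_prop)]
  rw [e2, i0.charFun_map_fun_add_eq_mul hX₀.aemeasurable aS, Pi.mul_apply,
    i12.charFun_map_fun_add_eq_mul aI₁ aN, Pi.mul_apply, c1, c2, hlaw,
    charFun_multivariateGaussian_act x hQ, ← Complex.exp_add, ← Complex.exp_add, ← Complex.exp_add]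
  congr 1
  have e3 : inner ℝ l (act (Φ * (Q + Γ₁ + Γ₂) * Φᵀ) l)
      = inner ℝ l' (act Q l') + inner ℝ l' (act Γ₁ l') + inner ℝ l' (act Γ₂ l') := by
    rw [act_mul, act_mul, inner_act, ← hl', add_act, add_act, inner_add_right, inner_add_right]
  rw [e3, inner_zero_right]
  push_cast
  ring

end Independence

/-! ### Conditional laws of the nonlinear diffusion -/

section ConditionalLaws

variable {Ω : Type*} {mΩ : MeasurableSpace Ω} {μ : Measure Ω} {r r' : ℕ} {m : Model r r'}
  {W : ℝ → Ω → Vec r} {V : ℝ → Ω → Vec r'} {X : ℝ → Ω → Vec r} {Y : ℝ → Ω → Vec r'}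

theorem measurable_path {n : ℕ} {Z : ℝ → Ω → Vec n} (hZ : IsStdBrownian μ Z) :
    Measurable (path Z) := measurable_pi_iff.2 fun t => hZ.measurable t

/-- A σ-algebra that, up to null sets, carries the initial signal and the driving Brownian motions
also carries the observations: the signal solves a linear equation driven by `W`, and the integral
of its continuous paths is a limit of Riemann sums. -/
theorem IsSignalObs.aestronglyMeasurable_of {Ω : Type*} {𝓜 mΩ : MeasurableSpace Ω}
    {μ : Measure Ω} [IsProbabilityMeasure μ] {W : ℝ → Ω → Vec r} {V : ℝ → Ω → Vec r'}
    {X : ℝ → Ω → Vec r} {Y : ℝ → Ω → Vec r'} (h : IsSignalObs m μ W V X Y) (hle : 𝓜 ≤ mΩ)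
    (mX0 : AEStronglyMeasurable[𝓜] (X 0) μ)
    (mW : ∀ t, 0 ≤ t → AEStronglyMeasurable[𝓜] (W t) μ)
    (mV : ∀ t, 0 ≤ t → AEStronglyMeasurable[𝓜] (V t) μ) {u : ℝ} (hu : 0 ≤ u) :
    AEStronglyMeasurable[𝓜] (Y u) μ := by
  have mX : ∀ t, 0 ≤ t → AEStronglyMeasurable[𝓜] (X t) μ := fun t ht => by
    refine aestronglyMeasurable_linear hle ht
      (h.continuous_X.mono fun ω hω => hω.mono Set.Icc_subset_Ici_self) m.A
      (F := fun t ω => X 0 ω + act (CFC.sqrt m.R) (W t ω)) (fun w hw => ?_)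
      (fun w hw => mX0.add (aestronglyMeasurable_act _ (mW w hw.1)))
    filter_upwards [h.eq_X w hw.1] with ω hω
    rw [hω]
    abel
  have mI : AEStronglyMeasurable[𝓜] (fun ω => ∫ w in (0 : ℝ)..u, act m.C (X w ω)) μ := by
    refine aestronglyMeasurable_of_ae_tendsto hle (f := fun N ω => ∑ k ∈ Finset.range N,
      ((u - 0) / N) • act m.C (X (grid 0 u N k) ω)) (fun N => ?_) ?_
    · refine aestronglyMeasurable_finsetSum _ fun k hk => ?_
      have := Finset.mem_range.1 hk
      exact (continuous_const_smul ((u - 0) / N : ℝ)).comp_aestronglyMeasurable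
        (aestronglyMeasurable_act m.C
          (mX _ (grid_mem hu (by omega) (by omega : k ≤ N)).1))
    · filter_upwards [h.continuous_X] with ω hω
      exact tendsto_riemann_sum (f := fun w => act m.C (X w ω)) hu
        (continuousOn_act continuousOn_const (hω.mono Set.Icc_subset_Ici_self))
  refine (mI.add (aestronglyMeasurable_act (CFC.sqrt m.Sig) (mV u hu))).congr ?_
  filter_upwards [h.eq_Y u hu] with ω hω
  rw [hω]
  rfl

theorem IsSignalObs.aestronglyMeasurable_obs [IsProbabilityMeasure μ]
    (h : IsSignalObs m μ W V X Y) {u : ℝ} (hu : 0 ≤ u) :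
    AEStronglyMeasurable[MeasurableSpace.comap (fun ω => (X 0 ω, path W ω, path V ω))
      inferInstance] (Y u) μ := by
  have hfm : Measurable[MeasurableSpace.comap (fun ω => (X 0 ω, path W ω, path V ω))
      inferInstance] (fun ω => (X 0 ω, path W ω, path V ω)) := comap_measurable _
  refine h.aestronglyMeasurable_of ((h.measurable_X 0).prodMk
    ((measurable_path h.brownian_W).prodMk (measurable_path h.brownian_V))).comap_le
    (measurable_fst.comp hfm).stronglyMeasurable.aestronglyMeasurable
    (fun t ht => ?_) (fun t ht => ?_) hu
  · exact (((measurable_pi_apply (⟨t, ht⟩ : ℝ≥0)).comp (measurable_fst.comp measurable_snd)).comp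
      hfm).stronglyMeasurable.aestronglyMeasurable
  · exact (((measurable_pi_apply (⟨t, ht⟩ : ℝ≥0)).comp (measurable_snd.comp measurable_snd)).comp
      hfm).stronglyMeasurable.aestronglyMeasurable

/-- Only the values of the gain on `[s, u]` matter. -/
theorem isStochIntegral_congr_gain {A : Mat r} {C : Matrix (Fin r') (Fin r) ℝ}
    {G G' : ℝ → Matrix (Fin r) (Fin r') ℝ} {s u : ℝ} (hsu : s ≤ u)
    (hG : ∀ w ∈ Set.Icc s u, G w = G' w) {Z : ℝ → Ω → Vec r'} {X : ℝ → Ω → Vec r}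
    {a b : Ω → Vec r} (h : IsStochIntegral μ G Z s u
      (fun ω => a ω - (∫ w in s..u, (act A (X w ω) - act (G w) (act C (X w ω)))) - b ω)) :
    IsStochIntegral μ G' Z s u
      (fun ω => a ω - (∫ w in s..u, (act A (X w ω) - act (G' w) (act C (X w ω)))) - b ω) := by
  rw [isStochIntegral_iff] at *
  refine h.congr' (Eventually.of_forall fun N => Eventually.of_forall fun ω => ?_)
    (Eventually.of_forall fun ω => ?_)
  · refine Finset.sum_congr rfl fun i hi => ?_
    have := Finset.mem_range.1 hi
    rw [hG _ (grid_mem hsu (by omega) (by omega))]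
  · simp only
    congr 2
    refine intervalIntegral.integral_congr fun w hw => ?_
    rw [Set.uIcc_of_le hsu] at hw
    simp only [hG w hw]

/-- The sum `Q + ∫ₛᵗ (Ψ σ)(Ψ σ)' + ∫ₛᵗ (Ψ G σ')(Ψ G σ')'` which, conjugated by the fundamental
matrix, is the covariance of the diffusion. -/
def covInt (m : Model r r') (Ψ : ℝ → Mat r) (G : ℝ → Matrix (Fin r) (Fin r') ℝ) (Q : Mat r)
    (s t : ℝ) : Mat r :=
  Q + (∫ u in s..t, (Ψ u * CFC.sqrt m.R) * (Ψ u * CFC.sqrt m.R)ᵀ)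
    + ∫ u in s..t, (Ψ u * (G u * CFC.sqrt m.Sig)) * (Ψ u * (G u * CFC.sqrt m.Sig))ᵀ

theorem covInt_posSemidef {Ψ : ℝ → Mat r} {G : ℝ → Matrix (Fin r) (Fin r') ℝ} {Q : Mat r}
    (hQ : Q.PosSemidef) {s t : ℝ} (hst : s ≤ t) (hΨ : Continuous Ψ) (hG : Continuous G) :
    (covInt m Ψ G Q s t).PosSemidef :=
  (hQ.add (posSemidef_integral_mul_transpose hst (hΨ.matrix_mul continuous_const).continuousOn)).add
    (posSemidef_integral_mul_transpose hst
      (hΨ.matrix_mul (hG.matrix_mul continuous_const)).continuousOn)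

/-- The linear equation with deterministic gain `G`: the conditional law given the observations is
Gaussian, its mean is the solution of the filtering equation and its covariance is explicit. -/
theorem condLaw_of_gain [IsProbabilityMeasure μ] (hXY : IsSignalObs m μ W V X Y) {s T : ℝ}
    (hs : 0 ≤ s) {x : Vec r} {Q : Psd r} {Wb : ℝ → Ω → Vec r} {Vb : ℝ → Ω → Vec r'}
    {Xb : ℝ → Ω → Vec r} (hWb : IsStdBrownian μ Wb) (hVb : IsStdBrownian μ Vb)
    (hWV : IndepFun (path Wb) (path Vb) μ)
    (hXWV : IndepFun (Xb s) (fun ω => (path Wb ω, path Vb ω)) μ)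
    (hind : IndepFun (fun ω => (X 0 ω, path W ω, path V ω))
      (fun ω => (Xb s ω, path Wb ω, path Vb ω)) μ)
    (hlaw : HasLaw (Xb s) (multivariateGaussian x Q.1) μ) (hXm : Measurable (Xb s))
    (hXc : ∀ᵐ ω ∂μ, ContinuousOn (fun t => Xb t ω) (Set.Icc s T))
    {G : ℝ → Matrix (Fin r) (Fin r') ℝ} (hG : Continuous G) {M Φ Ψ : ℝ → Mat r}
    (hM : ∀ u, M u = m.A - G u * m.C) (hΨs : Ψ s = 1)
    (hΨ : ∀ u, HasDerivAt Ψ (-(Ψ u * M u)) u) (hΦΨ : ∀ u, Φ u * Ψ u = 1)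
    (hX : ∀ u ∈ Set.Icc s T, IsStochIntegral μ G
      (fun u ω => Y u ω - act (CFC.sqrt m.Sig) (Vb u ω)) s u
      (fun ω => Xb u ω - Xb s ω
        - (∫ w in s..u, (act m.A (Xb w ω) - act (G w) (act m.C (Xb w ω))))
        - act (CFC.sqrt m.R) (Wb u ω - Wb s ω))) :
    ∃ J : ℝ → Ω → Vec r, (∀ u ∈ Set.Icc s T, IsStochIntegral μ G Y s u (J u)) ∧
      ∀ τ ∈ Set.Icc s T, ∃ L : Ω → Vec r, IsStochIntegral μ Ψ J s τ L ∧
        ∀ᵐ ω ∂μ, condLaw μ Y s τ (Xb τ) ω = multivariateGaussian (act (Φ τ) (x + L ω))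
          (Φ τ * covInt m Ψ G Q.1 s τ * (Φ τ)ᵀ) := by
  have hΨc : Continuous Ψ := continuous_iff_continuousAt.2 fun u => (hΨ u).continuousAt
  have hMc : Continuous M := by
    rw [funext hM]
    exact continuous_const.sub (hG.matrix_mul continuous_const)
  obtain ⟨J, hJ, hrep⟩ := exists_representation hs hWb hVb hG.continuousOn hMc.continuousOn
    (fun u _ => hM u) hΨ hΨs hXY.measurable_Y hXm hXc hX
  refine ⟨J, hJ, fun τ hτ => ?_⟩
  obtain ⟨L, I₁, I₂, hL, hI₁, hI₂, heq⟩ := hrep τ hτ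
  refine ⟨L, hL, ?_⟩
  set Yp : Ω → Set.Icc s τ → Vec r' := fun ω u => Y u ω with hYp
  have hYpm : Measurable Yp := measurable_pi_iff.2 fun u => hXY.measurable_Y u
  have mY : ∀ u ∈ Set.Icc s τ,
      AEStronglyMeasurable[MeasurableSpace.comap Yp inferInstance] (Y u) μ := fun u hu =>
    ((measurable_pi_apply (⟨u, hu⟩ : Set.Icc s τ)).comp
      (comap_measurable Yp)).stronglyMeasurable.aestronglyMeasurable
  have mJ : ∀ u ∈ Set.Icc s τ,
      AEStronglyMeasurable[MeasurableSpace.comap Yp inferInstance] (J u) μ := fun u hu =>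
    tendstoInMeasure_aestronglyMeasurable (fun n => aestronglyMeasurable_riemannSum hu.1
      (fun w hw => mY w ⟨hw.1, hw.2.trans hu.2⟩) n)
      (isStochIntegral_iff.1 (hJ u ⟨hu.1, hu.2.trans hτ.2⟩))
  have mL : AEStronglyMeasurable[MeasurableSpace.comap Yp inferInstance] L μ :=
    tendstoInMeasure_aestronglyMeasurable (fun n => aestronglyMeasurable_riemannSum hτ.1 mJ n)
      (isStochIntegral_iff.1 hL)
  have mm : AEStronglyMeasurable[MeasurableSpace.comap Yp inferInstance]
      (fun ω => act (Φ τ) (x + L ω)) μ :=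
    aestronglyMeasurable_act _ (aestronglyMeasurable_const.add mL)
  obtain ⟨g, hg, hmg⟩ := mm
  obtain ⟨f, hf, rfl⟩ := hg.exists_eq_measurable_comp
  -- `X̄_τ` is the sum of the observable `f(Y)` and of `D`, a function of `(X̄_s, W̄, V̄)`
  set D : Ω → Vec r := fun ω => act (Φ τ) (Xb s ω - x + I₁ ω - I₂ ω) with hD
  set j : Ω → Vec r × (ℝ≥0 → Vec r) × (ℝ≥0 → Vec r') := fun ω => (Xb s ω, path Wb ω, path Vb ω)
    with hj
  have hjm : Measurable[MeasurableSpace.comap j inferInstance] j := comap_measurable j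
  have mD : AEStronglyMeasurable[MeasurableSpace.comap j inferInstance] D μ := by
    refine aestronglyMeasurable_act _ (AEStronglyMeasurable.sub (AEStronglyMeasurable.add
      (AEStronglyMeasurable.sub ?_ aestronglyMeasurable_const) ?_) ?_)
    · exact (measurable_fst.comp hjm).stronglyMeasurable.aestronglyMeasurable
    · exact hI₁.aestronglyMeasurable fun t => ((measurable_pi_apply t).comp
        (measurable_fst.comp measurable_snd)).comp hjm
    · exact hI₂.aestronglyMeasurable fun t => ((measurable_pi_apply t).comp
        (measurable_snd.comp measurable_snd)).comp hjm
  have hjle : MeasurableSpace.comap j inferInstance ≤ mΩ :=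
    (hXm.prodMk ((measurable_path hWb).prodMk (measurable_path hVb))).comap_le
  have hYD : IndepFun Yp D μ := indepFun_of_measurable_completion hind
    (measurable_path_completion fun u => (hXY.aestronglyMeasurable_obs (hs.trans u.2.1)))
    (measurable_completion mD)
  have hZ : ∀ᵐ ω ∂μ, Xb τ ω = f (Yp ω) + D ω := by
    filter_upwards [hmg] with ω hω
    rw [← Function.comp_apply (f := f) (g := Yp), ← hω, hD]
    simp only
    rw [← act_add]
    have : Xb τ ω = act (Φ τ) (act (Ψ τ) (Xb τ ω)) := by rw [← act_mul, hΦΨ, one_act]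
    rw [this, heq ω]
    congr 1
    abel
  have hDlaw := map_gaussian_add_wiener hWb hVb hWV hXm hXWV Q.2 hlaw.map_eq hτ.1
    (hΨc.matrix_mul continuous_const).continuousOn
    (hΨc.matrix_mul (hG.matrix_mul continuous_const)).continuousOn hI₁ hI₂ (Φ τ)
  filter_upwards [condDistrib_add_indep hYpm hf.measurable (mD.mono hjle).aemeasurable hYD hZ,
    hmg] with ω hω hω'
  rw [condLaw]
  refine hω.trans ?_
  rw [hDlaw, multivariateGaussian_map_add, hω']
  rfl

theorem covMatrix_multivariateGaussian (a : Vec r) {S : Mat r} (hS : S.PosSemidef) :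
    covMatrix (multivariateGaussian a S) = S := by
  ext i j
  exact covariance_eval_multivariateGaussian hS i j

/-- The covariance of the linear equation satisfies the Lyapunov differential equation. -/
theorem hasDerivAt_covInt {G : ℝ → Matrix (Fin r) (Fin r') ℝ} (hG : Continuous G)
    {M Φ Ψ : ℝ → Mat r} (hΦ : ∀ u, HasDerivAt Φ (M u * Φ u) u) (hΨ : Continuous Ψ)
    (hΦΨ : ∀ u, Φ u * Ψ u = 1) (Q : Mat r) (s u : ℝ) :
    HasDerivAt (fun u => Φ u * covInt m Ψ G Q s u * (Φ u)ᵀ)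
      (M u * (Φ u * covInt m Ψ G Q s u * (Φ u)ᵀ)
        + (Φ u * covInt m Ψ G Q s u * (Φ u)ᵀ) * (M u)ᵀ + m.R + G u * m.Sig * (G u)ᵀ) u := by
  have c1 : Continuous fun u => (Ψ u * CFC.sqrt m.R) * (Ψ u * CFC.sqrt m.R)ᵀ :=
    (hΨ.matrix_mul continuous_const).matrix_mul (hΨ.matrix_mul continuous_const).matrix_transpose
  have c2 : Continuous fun u =>
      (Ψ u * (G u * CFC.sqrt m.Sig)) * (Ψ u * (G u * CFC.sqrt m.Sig))ᵀ :=
    (hΨ.matrix_mul (hG.matrix_mul continuous_const)).matrix_mul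
      (hΨ.matrix_mul (hG.matrix_mul continuous_const)).matrix_transpose
  have d1 := intervalIntegral.integral_hasDerivAt_right (c1.intervalIntegrable s u)
    (c1.stronglyMeasurableAtFilter volume (𝓝 u)) c1.continuousAt
  have d2 := intervalIntegral.integral_hasDerivAt_right (c2.intervalIntegrable s u)
    (c2.stronglyMeasurableAtFilter volume (𝓝 u)) c2.continuousAt
  have d3 : HasDerivAt (fun u => covInt m Ψ G Q s u)
      ((Ψ u * CFC.sqrt m.R) * (Ψ u * CFC.sqrt m.R)ᵀ
        + (Ψ u * (G u * CFC.sqrt m.Sig)) * (Ψ u * (G u * CFC.sqrt m.Sig))ᵀ) u :=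
    (d1.const_add Q).add d2
  have d4 : HasDerivAt (fun u => (Φ u)ᵀ) ((M u * Φ u)ᵀ) u :=
    (transposeL r r).hasFDerivAt.comp_hasDerivAt u (hΦ u)
  have d5 := ((hΦ u).mul d3).mul d4
  refine d5.congr_deriv ?_
  have s1 : (CFC.sqrt m.R)ᵀ = CFC.sqrt m.R := transpose_eq_of_isHermitian (posSemidef_sqrt _).1
  have s2 : (CFC.sqrt m.Sig)ᵀ = CFC.sqrt m.Sig :=
    transpose_eq_of_isHermitian (posSemidef_sqrt _).1
  have e1 : Φ u * ((Ψ u * CFC.sqrt m.R) * (Ψ u * CFC.sqrt m.R)ᵀ) * (Φ u)ᵀ = m.R := by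
    calc _ = (Φ u * Ψ u) * (CFC.sqrt m.R * CFC.sqrt m.R) * (Φ u * Ψ u)ᵀ := by
          simp only [Matrix.transpose_mul, s1, Matrix.mul_assoc]
      _ = m.R := by rw [hΦΨ, sqrt_mul_sqrt m.posDef_R.posSemidef]; simp
  have e2 : Φ u * ((Ψ u * (G u * CFC.sqrt m.Sig)) * (Ψ u * (G u * CFC.sqrt m.Sig))ᵀ) * (Φ u)ᵀ
      = G u * m.Sig * (G u)ᵀ := by
    calc _ = (Φ u * Ψ u) * (G u * (CFC.sqrt m.Sig * CFC.sqrt m.Sig) * (G u)ᵀ) * (Φ u * Ψ u)ᵀ := by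
          simp only [Matrix.transpose_mul, s2, Matrix.mul_assoc]
      _ = _ := by rw [hΦΨ, sqrt_mul_sqrt m.posDef_Sig.posSemidef]; simp
  rw [mul_add, add_mul, add_mul, e1, e2, Matrix.transpose_mul]
  simp only [Pi.mul_apply, Matrix.mul_assoc]
  abel

theorem covInt_self (Ψ : ℝ → Mat r) (G : ℝ → Matrix (Fin r) (Fin r') ℝ) (Q : Mat r) (s : ℝ) :
    covInt m Ψ G Q s s = Q := by
  simp [covInt]

theorem gain_mul_C (G : Psd r) : gain m G * m.C = G.1 * m.S := by
  simp only [gain, Model.S, Matrix.mul_assoc]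

theorem gain_mul_Sig_mul_transpose (G : Psd r) :
    gain m G * m.Sig * (gain m G)ᵀ = G.1 * m.S * G.1 := by
  have h1 : (G.1)ᵀ = G.1 := transpose_eq_of_isHermitian G.2.1
  have h2 : (m.Sig⁻¹)ᵀ = m.Sig⁻¹ := by
    rw [Matrix.transpose_nonsing_inv, transpose_eq_of_isHermitian m.posDef_Sig.1]
  have h3 : m.Sig⁻¹ * m.Sig = 1 := Matrix.nonsing_inv_mul _ m.posDef_Sig.det_pos.ne'.isUnit
  calc _ = G.1 * m.Cᵀ * (m.Sig⁻¹ * m.Sig) * (m.Sig⁻¹ * m.C * G.1) := by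
        simp only [gain, Matrix.transpose_mul, Matrix.transpose_transpose, h1, h2,
          Matrix.mul_assoc]
    _ = _ := by
        rw [h3, Matrix.mul_one]
        simp only [Model.S, Matrix.mul_assoc]

/-- The Lyapunov drift with the gain `p(Q) C' Sig⁻¹` is the perturbed Riccati drift. -/
theorem riccPert_eq_lyapunov (p : Psd r → Psd r) (Q : Psd r) :
    (m.A - gain m (p Q) * m.C) * Q.1 + Q.1 * (m.A - gain m (p Q) * m.C)ᵀ + m.R
      + gain m (p Q) * m.Sig * (gain m (p Q))ᵀ = riccPert m p Q := by
  rw [gain_mul_C, gain_mul_Sig_mul_transpose, riccPert]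

theorem riccPert_id : riccPert m (ContinuousMap.id (Psd r)) = ricc m := by
  funext Q
  have h1 : (Q.1)ᵀ = Q.1 := transpose_eq_of_isHermitian Q.2.1
  simp only [riccPert, ricc, ContinuousMap.id_apply, Matrix.transpose_sub, Matrix.transpose_mul,
    m.transpose_S, h1, sub_mul, mul_sub, Matrix.mul_assoc]
  abel

/-- The conditional law of the nonlinear diffusion is Gaussian, with mean the Kalman-Bucy filter
and covariance the Riccati flow. -/
theorem condLaw_diffusion [IsProbabilityMeasure μ] (hXY : IsSignalObs m μ W V X Y)
    {p : C(Psd r, Psd r)} {φ : ℝ → Psd r → Psd r} (hφ : IsRiccatiFlow (riccPert m p) φ) {s t : ℝ}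
    (hs : 0 ≤ s) (hst : s ≤ t) {x : Vec r} {Q : Psd r} {ψ Xb : ℝ → Ω → Vec r}
    (hψ : IsFilter m μ Y (fun u => p (φ (u - s) Q)) s x ψ)
    (hXb : IsDiffusion m μ W V X Y p s x Q Xb) :
    ∀ᵐ ω ∂μ, condLaw μ Y s t (Xb t) ω = multivariateGaussian (ψ t ω) (φ (t - s) Q).1 := by
  obtain ⟨Wb, Vb, P, hWb, hVb, hWV, hXWV, hind, hlaw, hXm, hXc, hPc, hcov, hX⟩ := hXb
  have hgc : ContinuousOn (fun u => gain m (p (P u))) (Set.Ici s) := by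
    have : ContinuousOn (fun u => (p (P u)).1) (Set.Ici s) :=
      (continuous_subtype_val.comp p.continuous).comp_continuousOn hPc
    exact continuousOn_matrix_mul (continuousOn_matrix_mul this continuousOn_const)
      continuousOn_const
  -- the gain is frozen outside of `[s, T]`, to have global fundamental matrices
  have hrep : ∀ T, s ≤ T → ∃ (G : ℝ → Matrix (Fin r) (Fin r') ℝ) (M Φ Ψ : ℝ → Mat r)
      (J : ℝ → Ω → Vec r), Continuous G ∧ (∀ u ∈ Set.Icc s T, G u = gain m (p (P u))) ∧
      (∀ u, M u = m.A - G u * m.C) ∧ Φ s = 1 ∧ Ψ s = 1 ∧ (∀ u, HasDerivAt Φ (M u * Φ u) u) ∧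
      (∀ u, HasDerivAt Ψ (-(Ψ u * M u)) u) ∧ (∀ u, Φ u * Ψ u = 1) ∧
      (∀ u ∈ Set.Icc s T, IsStochIntegral μ G Y s u (J u)) ∧
      ∀ τ ∈ Set.Icc s T, ∃ L : Ω → Vec r, IsStochIntegral μ Ψ J s τ L ∧
        ∀ᵐ ω ∂μ, condLaw μ Y s τ (Xb τ) ω = multivariateGaussian (act (Φ τ) (x + L ω))
          (Φ τ * covInt m Ψ G Q.1 s τ * (Φ τ)ᵀ) := by
    intro T hT
    let c : ℝ → ℝ := fun u => max s (min u T)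
    have hc : ∀ u, c u ∈ Set.Icc s T := fun u =>
      ⟨le_max_left _ _, max_le hT (min_le_right _ _)⟩
    have hcid : ∀ u ∈ Set.Icc s T, c u = u := fun u hu => by
      simp only [c, min_eq_left hu.2, max_eq_right hu.1]
    have hG : Continuous fun u => gain m (p (P (c u))) :=
      hgc.comp_continuous (f := c) (by fun_prop) fun u => (hc u).1
    have hM : Continuous fun u => m.A - gain m (p (P (c u))) * m.C :=
      continuous_const.sub (hG.matrix_mul continuous_const)
    obtain ⟨B, hB⟩ := isCompact_Icc.exists_bound_of_continuousOn (s := Set.Icc s T)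
      hM.continuousOn
    have hB' : ∀ u, ‖m.A - gain m (p (P (c u))) * m.C‖ ≤ B := fun u => by
      have := hB (c u) (hc u)
      rwa [hcid _ (hc u)] at this
    obtain ⟨Φ, Ψ, hΦs, hΨs, hΦ, hΨ, hΦΨ⟩ := exists_fundamental _ hM B hB' s
    have hGe : ∀ u ∈ Set.Icc s T, gain m (p (P (c u))) = gain m (p (P u)) := fun u hu => by
      rw [hcid u hu]
    obtain ⟨J, hJ, hL⟩ := condLaw_of_gain hXY hs hWb hVb hWV hXWV hind hlaw (hXm s le_rfl)
      (hXc.mono fun ω hω => hω.mono Set.Icc_subset_Ici_self) hG (fun _ => rfl) hΨs hΨ hΦΨ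
      (fun u hu => isStochIntegral_congr_gain hu.1
        (fun w hw => (hGe w ⟨hw.1, hw.2.trans hu.2⟩).symm) (hX u hu.1))
    exact ⟨_, _, Φ, Ψ, J, hG, hGe, fun _ => rfl, hΦs, hΨs, hΦ, hΨ, hΦΨ, hJ, hL⟩
  -- the covariance is deterministic, so comparing it with the explicit one at a single `ω` suffices
  have hPeq : ∀ {G : ℝ → Matrix (Fin r) (Fin r') ℝ} {Φ Ψ : ℝ → Mat r} {τ : ℝ} {a : Ω → Vec r},
      s ≤ τ → Continuous G → Continuous Ψ →
      (∀ᵐ ω ∂μ, condLaw μ Y s τ (Xb τ) ω = multivariateGaussian (a ω)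
          (Φ τ * covInt m Ψ G Q.1 s τ * (Φ τ)ᵀ)) →
      (P τ).1 = Φ τ * covInt m Ψ G Q.1 s τ * (Φ τ)ᵀ := by
    intro G Φ Ψ τ a hτ hG hΨ h
    obtain ⟨ω, h1, h2⟩ := (h.and (hcov τ hτ)).exists
    have hpsd : (Φ τ * covInt m Ψ G Q.1 s τ * (Φ τ)ᵀ).PosSemidef := by
      simpa using (covInt_posSemidef Q.2 hτ hΨ hG).mul_mul_conjTranspose_same (Φ τ)
    rw [← h2, h1, covMatrix_multivariateGaussian _ hpsd]
  -- the explicit covariance solves the Lyapunov equation whose gain is `p` of that covariance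
  have hsol : IsRiccatiSol (riccPert m p) Q (fun u => P (s + u)) := by
    constructor
    · obtain ⟨G, M, Φ, Ψ, J, hG, hGe, hM, hΦs, hΨs, hΦ, hΨ, hΦΨ, hJ, hL⟩ := hrep s le_rfl
      have hΨc : Continuous Ψ := continuous_iff_continuousAt.2 fun u => (hΨ u).continuousAt
      obtain ⟨L, -, h⟩ := hL s ⟨le_rfl, le_rfl⟩
      have := hPeq le_rfl hG hΨc h
      rw [hΦs, covInt_self] at this
      refine Subtype.ext ?_
      simpa using this
    · intro w hw
      obtain ⟨G, M, Φ, Ψ, J, hG, hGe, hM, hΦs, hΨs, hΦ, hΨ, hΦΨ, hJ, hL⟩ :=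
        hrep (s + w + 1) (by linarith)
      have hΨc : Continuous Ψ := continuous_iff_continuousAt.2 fun u => (hΨ u).continuousAt
      have hP : ∀ u, 0 ≤ u → u ≤ w + 1 →
          (P (s + u)).1 = Φ (s + u) * covInt m Ψ G Q.1 s (s + u) * (Φ (s + u))ᵀ := by
        intro u hu0 hu1
        obtain ⟨L, -, h⟩ := hL (s + u) ⟨by linarith, by linarith⟩
        exact hPeq (by linarith) hG hΨc h
      have hd := (hasDerivAt_covInt (m := m) hG hΦ hΨc hΦΨ Q.1 s (s + w)).comp_const_add s w
      rw [← hP w hw (by linarith), hM, hGe (s + w) ⟨by linarith, by linarith⟩,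
        riccPert_eq_lyapunov p (P (s + w))] at hd
      refine hd.hasDerivWithinAt.congr_of_eventuallyEq ?_ (hP w hw (by linarith))
      filter_upwards [self_mem_nhdsWithin,
        mem_nhdsWithin_of_mem_nhds (Iio_mem_nhds (by linarith : w < w + 1))] with u hu0 hu1
      exact hP u hu0 (le_of_lt hu1)
  have hPφ : ∀ u, s ≤ u → P u = φ (u - s) Q := fun u hu => by
    have := (hφ Q).2 _ hsol (u - s) (by linarith)
    simpa using this
  obtain ⟨G, M, Φ, Ψ, J, hG, hGe, hM, hΦs, hΨs, hΦ, hΨ, hΦΨ, hJ, hL⟩ := hrep t hst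
  obtain ⟨L, hL, hlawt⟩ := hL t ⟨hst, le_rfl⟩
  have hΨc : Continuous Ψ := continuous_iff_continuousAt.2 fun u => (hΨ u).continuousAt
  have hMc : Continuous M := by
    rw [funext hM]
    exact continuous_const.sub (hG.matrix_mul continuous_const)
  have hfilter := filter_eq (A := m.A) (C := m.C) (⟨hst, le_rfl⟩ : t ∈ Set.Icc s t)
    hMc.continuousOn (fun u _ => hM u) hΨ hΨs hJ hL hXY.measurable_Y hψ.init
    (hψ.continuous.mono fun ω hω => hω.mono Set.Icc_subset_Ici_self) (fun u hu => by
      have := isStochIntegral_congr_gain (G' := G) (b := fun _ => 0) hu.1 (fun w hw => by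
        rw [hGe w ⟨hw.1, hw.2.trans hu.2⟩, hPφ w hw.1])
        (by simpa only [sub_zero] using hψ.eq u hu.1)
      simpa only [sub_zero] using this)
  have hcovt := hPeq hst hG hΨc hlawt
  filter_upwards [hlawt, hfilter] with ω h1 h2
  rw [h1, ← hcovt, hPφ t hst, ← h2, ← act_mul, hΦΨ, one_act]

end ConditionalLaws

end

end KalmanBucy

theorem theorem3p5 {r r' : ℕ} (m : KalmanBucy.Model r r')
    {v obsLow ctrLow ctrObsUp obsCtrUp : ℝ}
    (hG : KalmanBucy.GramianBounds m v obsLow ctrLow ctrObsUp obsCtrUp)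
    {Ω : Type*} [MeasurableSpace Ω] (μ : Measure Ω) [IsProbabilityMeasure μ]
    (W : ℝ → Ω → KalmanBucy.Vec r) (V : ℝ → Ω → KalmanBucy.Vec r')
    (X : ℝ → Ω → KalmanBucy.Vec r) (Y : ℝ → Ω → KalmanBucy.Vec r')
    (hXY : KalmanBucy.IsSignalObs m μ W V X Y)
    (Pert : Set C(KalmanBucy.Psd r, KalmanBucy.Psd r))
    (d : C(KalmanBucy.Psd r, KalmanBucy.Psd r) → KalmanBucy.PertData r)
    (H0 : ∀ p ∈ Pert, KalmanBucy.CondH0 m p (d p))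
    (H2 : KalmanBucy.CondH2 m Pert d)
    (p : C(KalmanBucy.Psd r, KalmanBucy.Psd r)) (hp : p ∈ Pert)
    (φ φp : ℝ → KalmanBucy.Psd r → KalmanBucy.Psd r)
    (hφ : KalmanBucy.IsRiccatiFlow (KalmanBucy.ricc m) φ)
    (hφp : KalmanBucy.IsRiccatiFlow (KalmanBucy.riccPert m p) φp)
    {s t : ℝ} (hs : 0 ≤ s) (hst : s + v ≤ t) :
    (∀ (x : KalmanBucy.Vec r) (Q : KalmanBucy.Psd r) (ψ ψp Xb Xbp : ℝ → Ω → KalmanBucy.Vec r),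
      KalmanBucy.IsFilter m μ Y (fun u => φ (u - s) Q) s x ψ →
      KalmanBucy.IsFilter m μ Y (fun u => p (φp (u - s) Q)) s x ψp →
      KalmanBucy.IsDiffusion m μ W V X Y (ContinuousMap.id _) s x Q Xb →
      KalmanBucy.IsDiffusion m μ W V X Y p s x Q Xbp →
      ∀ᵐ ω ∂μ,
        KalmanBucy.wasserstein 2 (KalmanBucy.condLaw μ Y s t (Xbp t) ω)
            (KalmanBucy.condLaw μ Y s t (Xb t) ω) ≠ ⊤ ∧
        (KalmanBucy.wasserstein 2 (KalmanBucy.condLaw μ Y s t (Xbp t) ω)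
            (KalmanBucy.condLaw μ Y s t (Xb t) ω)).toReal ^ 2
          ≤ ‖ψp t ω - ψ t ω‖ ^ 2 + ((φp (t - s) Q).1 - (φ (t - s) Q).1).trace
            + 4 * r * (ctrObsUp + 1 / obsLow) * (obsCtrUp + 1 / ctrLow)
              * ‖(φp (t - s) Q).1 - (φ (t - s) Q).1‖) ∧
    (∀ (n : ℕ), 1 ≤ n → ∀ (x₁ x₂ : KalmanBucy.Vec r) (Q₁ Q₂ : KalmanBucy.Psd r)
      (ψ ψp Xb Xbp : ℝ → Ω → KalmanBucy.Vec r),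
      KalmanBucy.IsFilter m μ Y (fun u => φ (u - s) Q₁) s x₁ ψ →
      KalmanBucy.IsFilter m μ Y (fun u => p (φp (u - s) Q₂)) s x₂ ψp →
      KalmanBucy.IsDiffusion m μ W V X Y (ContinuousMap.id _) s x₁ Q₁ Xb →
      KalmanBucy.IsDiffusion m μ W V X Y p s x₂ Q₂ Xbp →
      ∀ᵐ ω ∂μ,
        KalmanBucy.wasserstein (2 * n) (KalmanBucy.condLaw μ Y s t (Xb t) ω)
            (KalmanBucy.condLaw μ Y s t (Xbp t) ω) ≠ ⊤ ∧
        (KalmanBucy.wasserstein (2 * n) (KalmanBucy.condLaw μ Y s t (Xb t) ω)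
            (KalmanBucy.condLaw μ Y s t (Xbp t) ω)).toReal
          ≤ ‖ψ t ω - ψp t ω‖
            + √(r * n / 2) * √(obsCtrUp + 1 / ctrLow)
              * ‖(φ (t - s) Q₁).1 - (φp (t - s) Q₂).1‖
              * Real.exp (1 / 2 + 3 / (4 * n))) := by
  have hv := hG.v_pos
  have hst' : s ≤ t := by linarith
  have hφ' : KalmanBucy.IsRiccatiFlow
      (KalmanBucy.riccPert m (ContinuousMap.id (KalmanBucy.Psd r))) φ := by
    rwa [KalmanBucy.riccPert_id]
  have hb : 0 < obsCtrUp + 1 / ctrLow := add_pos hG.obsCtrUp_pos (one_div_pos.2 hG.ctrLow_pos)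
  have hU : 0 < ctrObsUp + 1 / obsLow := add_pos hG.ctrObsUp_pos (one_div_pos.2 hG.obsLow_pos)
  have hbd := fun Q => KalmanBucy.riccati_bounds hG (hφ Q).1 (τ := t - s) (by linarith)
  constructor
  · intro x Q ψ ψp Xb Xbp hψ hψp hXb hXbp
    filter_upwards [KalmanBucy.condLaw_diffusion hXY hφ' hs hst' hψ hXb,
      KalmanBucy.condLaw_diffusion hXY hφp hs hst' hψp hXbp] with ω h1 h2
    rw [h1, h2]
    exact KalmanBucy.wasserstein_two_gaussian _ _ (φp (t - s) Q).2 (φ (t - s) Q).2 hb hU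
      (hbd Q).1 (hbd Q).2
  · intro n hn x₁ x₂ Q₁ Q₂ ψ ψp Xb Xbp hψ hψp hXb hXbp
    filter_upwards [KalmanBucy.condLaw_diffusion hXY hφ' hs hst' hψ hXb,
      KalmanBucy.condLaw_diffusion hXY hφp hs hst' hψp hXbp] with ω h1 h2
    rw [h1, h2]
    exact KalmanBucy.wasserstein_even_gaussian n hn _ _ (φ (t - s) Q₁).2 (φp (t - s) Q₂).2 hb
      (hbd Q₁).1
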